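/- A quasi-Banach space is a complex vector space $X$ that is complete for a quasi-norm $\|\cdot\|$ (that is, $\|cx\|=|c|\,\|x\|$, $\|x\|=0$ only for $x=0$, and $\|x+y\|\le K(\|x\|+\|y\|)$ for some constant $K$). A quasi-norm is plurisubharmonic if it is upper semicontinuous and $\|x\|\le\frac1{2\pi}\int_0^{2\pi}\|x+e^{i\theta}y\|\,d\theta$ for all $x,y\in X$; $X$ is A-convex if it has an equivalent plurisubharmonic quasi-norm. Let $\epsilon_k$ be the coordinate functions on the Cantor group $\Delta=\{\pm1\}^{\mathbb N}$ with its normalized Haar measure. Let $G$ be a compact abelian group with normalized Haar measure and dual group $\Gamma$, and let $E\subset\Gamma$. For $0<p\le\infty$, $E$ has property $\mathcal C_p(X)$ if there is a constant $M>0$ such that for all distinct $\gamma_1,\dots,\gamma_n\in E$ and all $x_1,\dots,x_n\in X$ $$M^{-1}\Big\|\sum_{k=1}^n x_k\epsilon_k\Big\|_p\le\Big\|\sum_{k=1}^n x_k\gamma_k\Big\|_p\le M\Big\|\sum_{k=1}^n x_k\epsilon_k\Big\|_p,$$ where $\|\phi\|_p$ is the $L_p$-norm (for $p=\infty$ the essential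 supremum) of $\|\phi(\cdot)\|$. $E$ is an analytic Sidon set if it has $\mathcal C_\infty(X)$ for every A-convex quasi-Banach space $X$, and a set of interpolation ($I_0$-set) if every bounded complex function on $E$ extends to a continuous function on the Bohr compactification $b\Gamma$ of $\Gamma$. A Hadamard gap sequence is a sequence $(\lambda_k)_{k\ge1}$ of positive integers such that for some $q>1$ one has $\lambda_{k+1}/\lambda_k\ge q$ for all $k$. Theorem. Let $G=\mathbb T$, so that $\Gamma=\mathbb Z$. If $E\subset\mathbb N$ is a finite union of Hadamard gap sequences, then $E$ is an analytic Sidon set. In particular $\{3^n:n\ge1\}\cup\{3^n+n:n\ge1\}$ is an analytic Sidon set, but it is not a set of interpolation. -/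

import Mathlib

open MeasureTheory
open scoped NNReal ENNReal

universe u v

/-! ### Quasi-Banach spaces and A-convexity -/

/-- A quasi-norm on a complex vector space. -/
structure QuasiNorm (X : Type u) [AddCommGroup X] [Module ℂ X] where
  /-- the value of the quasi-norm at a vector -/
  toFun : X → ℝ
  nonneg : ∀ x, 0 ≤ toFun x
  eq_zero_of_apply_eq_zero : ∀ x, toFun x = 0 → x = 0
  smul : ∀ (c : ℂ) (x : X), toFun (c • x) = ‖c‖ * toFun x
  quasi_triangle : ∃ K : ℝ, ∀ x y, toFun (x + y) ≤ K * (toFun x + toFun y)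

namespace QuasiNorm

variable {X : Type u} [AddCommGroup X] [Module ℂ X]

instance : CoeFun (QuasiNorm X) (fun _ => X → ℝ) := ⟨QuasiNorm.toFun⟩

/-- Completeness: every Cauchy sequence for the quasi-norm converges. A vector space with a
complete quasi-norm is a quasi-Banach space. -/
def IsComplete (N : QuasiNorm X) : Prop :=
  ∀ v : ℕ → X, (∀ ε : ℝ, 0 < ε → ∃ n₀, ∀ m ≥ n₀, ∀ n ≥ n₀, N (v m - v n) < ε) →
    ∃ x : X, ∀ ε : ℝ, 0 < ε → ∃ n₀, ∀ n ≥ n₀, N (v n - x) < ε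

/-- Two quasi-norms on the same space are equivalent. -/
def Equivalent (N N' : QuasiNorm X) : Prop :=
  ∃ c C : ℝ, 0 < c ∧ 0 < C ∧ ∀ x, c * N x ≤ N' x ∧ N' x ≤ C * N x

/-- Upper semicontinuity of a quasi-norm for the topology that it defines itself. Continuous
quasi-norms, in particular all `r`-norms (`‖x + y‖ ^ r ≤ ‖x‖ ^ r + ‖y‖ ^ r`), have this property;
it makes the circle averages below integrals of bounded measurable functions. -/
def IsUpperSemicontinuous (N : QuasiNorm X) : Prop :=
  ∀ x : X, ∀ ε : ℝ, 0 < ε → ∃ δ : ℝ, 0 < δ ∧ ∀ y : X, N (y - x) < δ → N y < N x + ε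

/-- A quasi-norm is plurisubharmonic if it is upper semicontinuous and
`‖x‖ ≤ ∫₀^{2π} ‖x + e^{iθ} y‖ dθ / 2π` for all `x`, `y`. -/
def IsPlurisubharmonic (N : QuasiNorm X) : Prop :=
  N.IsUpperSemicontinuous ∧
    ∀ x y : X, N x ≤ (2 * Real.pi)⁻¹ *
      ∫ θ in (0 : ℝ)..(2 * Real.pi), N (x + Complex.exp (θ * Complex.I) • y)

/-- A quasi-normed space is A-convex if it has an equivalent plurisubharmonic quasi-norm. -/
def IsAConvex (N : QuasiNorm X) : Prop :=
  ∃ N' : QuasiNorm X, N.Equivalent N' ∧ N'.IsPlurisubharmonic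

end QuasiNorm

/-! ### The Cantor group and the property `C_p(X)` -/

/-- The normalized Haar measure of the Cantor group `{±1}^ℕ`: the infinite product of the
uniform probability measures on `{±1}`. -/
noncomputable def cantorMeasure : Measure (ℕ → ℤˣ) :=
  Measure.infinitePi fun _ : ℕ => ProbabilityTheory.uniformOn (Set.univ : Set ℤˣ)

/-- The coordinate functions `ε_n` on the Cantor group, with values `1` and `-1`. -/
def cantorCoord (n : ℕ) (t : ℕ → ℤˣ) : ℂ := ((t n : ℤ) : ℂ)

section CompactGroup

variable (G : Type v) [CommGroup G] [TopologicalSpace G] [IsTopologicalGroup G]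
  [CompactSpace G] [T2Space G] [MeasurableSpace G] [BorelSpace G]

/-- Normalized Haar measure on a compact group. -/
noncomputable def normalizedHaar : Measure G :=
  Measure.haarMeasure (⊤ : TopologicalSpace.PositiveCompacts G)

variable {G}

/-- A set `E` of characters of the compact abelian group `G` has property `C_p(X)`, where `X` is a
space with the quasi-norm `N`: for some constant `M`, all distinct `γ₁, …, γₙ` in `E` and all
`x₁, …, xₙ` in `X`,
`M⁻¹ ‖∑ xₖ εₖ‖_p ≤ ‖∑ xₖ γₖ‖_p ≤ M ‖∑ xₖ εₖ‖_p`. -/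
def HasPropertyC (p : ℝ≥0∞) {X : Type u} [AddCommGroup X] [Module ℂ X] (N : QuasiNorm X)
    (E : Set (PontryaginDual G)) : Prop :=
  ∃ M : ℝ≥0, 0 < M ∧ ∀ (n : ℕ) (γ : Fin n → PontryaginDual G) (x : Fin n → X),
    Function.Injective γ → (∀ k, γ k ∈ E) →
      (M : ℝ≥0∞)⁻¹ * eLpNorm (fun t => N (∑ k : Fin n, cantorCoord (Fin.val k) t • x k)) p cantorMeasure
          ≤ eLpNorm (fun g : G => N (∑ k, (γ k g : ℂ) • x k)) p (normalizedHaar G) ∧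
      eLpNorm (fun g : G => N (∑ k, (γ k g : ℂ) • x k)) p (normalizedHaar G)
          ≤ (M : ℝ≥0∞) * eLpNorm (fun t => N (∑ k : Fin n, cantorCoord (Fin.val k) t • x k)) p cantorMeasure

/-- `E` is an analytic Sidon set if it has property `C_∞(X)` for every A-convex quasi-Banach
space `X`. -/
def IsAnalyticSidon (E : Set (PontryaginDual G)) : Prop :=
  ∀ (X : Type u) [AddCommGroup X] [Module ℂ X] (N : QuasiNorm X),
    N.IsComplete → N.IsAConvex → HasPropertyC ∞ N E

end CompactGroup

/-! ### Sets of interpolation -/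

section Bohr

/-- The Bohr compactification `bΓ` of the dual group `Γ` of a compact abelian group `G`: the
dual of `G` made discrete, that is, all (not necessarily continuous) homomorphisms from `G` to the
circle group, with the topology of pointwise convergence. -/
def BohrCompactification (G : Type*) [CommGroup G] : Type _ := G →* Circle

noncomputable instance (G : Type*) [CommGroup G] : TopologicalSpace (BohrCompactification G) :=
  TopologicalSpace.induced (fun (χ : G →* Circle) (g : G) => χ g) inferInstance

variable {G : Type*} [CommGroup G] [TopologicalSpace G]

/-- The canonical map `Γ → bΓ`. -/
noncomputable def toBohr (γ : PontryaginDual G) : BohrCompactification G :=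
  ContinuousMonoidHom.toMonoidHom γ

/-- `E` is a set of interpolation (an `I_0`-set) if every bounded function on `E` extends to a
continuous function on the Bohr compactification. -/
def IsInterpolationSet (E : Set (PontryaginDual G)) : Prop :=
  ∀ f : E → ℂ, (∃ C : ℝ, ∀ γ, ‖f γ‖ ≤ C) →
    ∃ F : BohrCompactification G → ℂ, Continuous F ∧ ∀ γ : E, F (toBohr γ.1) = f γ

end Bohr

/-! ### Sets of integers as sets of characters of the circle group -/

/-- The circle group carries its Borel sigma-algebra. -/
noncomputable instance : MeasurableSpace Circle := borel Circle

instance : BorelSpace Circle := ⟨rfl⟩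

/-- The character `z ↦ z ^ n` of the circle group. -/
noncomputable def circleCharacter (n : ℤ) : PontryaginDual Circle :=
  ({ toFun := fun z => z ^ n
     map_one' := one_zpow n
     map_mul' := fun z w => mul_zpow z w n
     continuous_toFun := continuous_zpow n } : Circle →ₜ* Circle)

/-- A set of natural numbers, regarded as a set of characters of the circle group. -/
def natCharacters (E : Set ℕ) : Set (PontryaginDual Circle) :=
  (fun n : ℕ => circleCharacter n) '' E

/-- A Hadamard gap sequence: positive integers with `λ_{k+1} / λ_k ≥ q` for some `q > 1`. -/
def IsHadamardGapSequence (l : ℕ → ℕ) : Prop :=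
  (∀ k, 0 < l k) ∧ ∃ q : ℝ, 1 < q ∧ ∀ k, q ≤ (l (k + 1) : ℝ) / (l k : ℝ)

/-- A finite union of Hadamard gap sequences. -/
def IsFiniteUnionOfHadamard (E : Set ℕ) : Prop :=
  ∃ (m : ℕ) (l : Fin m → ℕ → ℕ),
    (∀ i, IsHadamardGapSequence (l i)) ∧ E = ⋃ i, Set.range (l i)

/-!
Let `N` be a plurisubharmonic quasi-norm with modulus of concavity `K`, and let `E` be a finite
set of positive integers with at most `μ h` elements in each interval `[R, 2 ^ h R)`. The positive
half of the theorem is the estimate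
`N (∑ zₙ xₙ) ≤ C sup_T N (∑ cis (n T) xₙ)` for `|zₙ| ≤ 1`, where `cis t = e^{2πit}` and `C` depends
only on `K` and `μ` (`QuasiNorm.IsPlurisubharmonic.exists_sidon_bound`). There is no duality in
`X`, so Riesz products are not available as functionals. They are replaced by three facts.

*Multipliers.* Averaging `L` translates of a polynomial costs at most a factor `K ^ L`; hence
multiplying the coefficients by `fejerGap L (n τ - l)`, one minus a normalised Fejér kernel, or by a
product of boundedly many such factors, increases the supremum by a constant factor only
(`QuasiNorm.IsMultiplier`). If the phase `n τ` is close to `l` modulo `1`, this multiplier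
annihilates the frequency `n` up to a small error; if it is far from `l`, the multiplier is close
to `1`.

*Random phases.* Split `E` into `M` classes, in each of which any two elements have ratio at least
a huge `Q`. Fix one class `D` and annihilate the other ones. For each other class `F`, one of two parts
at a time, `exists_phases_of_isSeparated` gives finitely many phases `τ` such that every `f` in the part has
phase close to `l`, whereas each `m ∈ D` has it for a small proportion of the `τ` only. They come
from a random walk that moves through the scales `1 / f` and, at each scale, first steps to a point
with the prescribed phase and then makes a small random step. A frequency `m` comparable with `f` is
controlled by choosing between two points with the prescribed phase, unless `m` is almost a multiple
of `f`; then the difference `|m - a f|` is a much smaller frequency, which is randomised by an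
earlier step unless it is itself comparable with an element `f'` of `F`. The relation `f ↦ f'` is a
decreasing partial function, so a two-colouring of `F` removes this obstacle.

*Geometric means.* The multipliers thus act on `D` by positive numbers `rₙ`, of which each is close
to `1` for most, but not for all, choices of the phases. Plurisubharmonicity makes the sublevel
sets of `y ↦ sup {N (∑ zₙ xₙ) : |zₙ| ≤ exp yₙ}` convex
(`QuasiNorm.IsPlurisubharmonic.convex_polydiscSup_le`), so the bound obtained for `y = log r` holds
for the average of `log r` as well, and this average is at least `-1`. Since all phases on a
separated class can be prescribed simultaneously (`exists_phase_approx`), this estimates all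
coefficients on `D` (`QuasiNorm.IsPlurisubharmonic.sum_separated_le`). The error terms involve the
supremum over all `|zₙ| ≤ 1` with a small factor. With the scales chosen as powers of `B = 2 ^ g`,
the number of classes is `M = 10 μ g`, so the sum over all classes costs a power of `g` and the
factor is of the order of a power of `g` divided by `2 ^ g`: for large `g` it is absorbed.

A finite union of Hadamard sequences satisfies the counting condition. The other inequality in the
definition of property `C_∞` holds in every quasi-normed space
(`QuasiNorm.HasModulus.exists_coeff_bound`), since coefficients in the unit disc have binary
expansions with digits `±1`.

The set `{3 ^ n} ∪ {3 ^ n + n}` is not a set of interpolation, since along `n → 0` in the Bohr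
compactification the points `3 ^ n` and `3 ^ n + n` have a common limit, whereas an interpolating
function could be `0` at the former and `1` at the latter.
-/

/-! ### Quasi-norms of finite sums -/

namespace QuasiNorm

variable {X : Type u} [AddCommGroup X] [Module ℂ X]

/-- `K` is a modulus of concavity of `N`, normalised by `1 ≤ K`. -/
def HasModulus (N : QuasiNorm X) (K : ℝ) : Prop :=
  1 ≤ K ∧ ∀ x y, N (x + y) ≤ K * (N x + N y)

theorem exists_hasModulus (N : QuasiNorm X) : ∃ K, N.HasModulus K := by
  obtain ⟨K, hK⟩ := N.quasi_triangle
  refine ⟨max K 1, le_max_right _ _, fun x y => (hK x y).trans ?_⟩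
  exact mul_le_mul_of_nonneg_right (le_max_left _ _) (add_nonneg (N.nonneg x) (N.nonneg y))

theorem map_zero (N : QuasiNorm X) : N (0 : X) = 0 := by
  have h := N.smul 0 0
  simpa using h

theorem map_neg (N : QuasiNorm X) (x : X) : N (-x) = N x := by
  have h := N.smul (-1) x
  simpa using h

theorem map_real_smul (N : QuasiNorm X) {r : ℝ} (hr : 0 ≤ r) (x : X) :
    N ((r : ℂ) • x) = r * N x := by
  rw [N.smul, Complex.norm_real, Real.norm_of_nonneg hr]

namespace HasModulus

variable {N : QuasiNorm X} {K : ℝ}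

theorem pos (h : N.HasModulus K) : 0 < K := zero_lt_one.trans_le h.1

theorem add_le (h : N.HasModulus K) (x y : X) : N (x + y) ≤ K * (N x + N y) := h.2 x y

/-- Halving the set of summands costs one factor `K`, so that the constant for `n` summands grows
only like a power of `n`. -/
theorem sum_le_pow (h : N.HasModulus K) {ι : Type*} (a : ℕ) (s : Finset ι) (hs : s.card ≤ 2 ^ a)
    (f : ι → X) : N (∑ i ∈ s, f i) ≤ K ^ a * ∑ i ∈ s, N (f i) := by
  classical
  induction a generalizing s with
  | zero =>
    have hs' : s.card ≤ 1 := by simpa using hs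
    rcases Nat.le_one_iff_eq_zero_or_eq_one.1 hs' with H | H
    · simp [Finset.card_eq_zero.1 H, map_zero]
    · obtain ⟨i, rfl⟩ := Finset.card_eq_one.1 H
      simp
  | succ a ih =>
    by_cases hc : s.card ≤ 2 ^ a
    · refine (ih s hc).trans ?_
      refine mul_le_mul_of_nonneg_right ?_ (Finset.sum_nonneg fun i _ => N.nonneg _)
      exact pow_le_pow_right₀ h.1 (Nat.le_succ a)
    · obtain ⟨t, hts, htc⟩ := Finset.exists_subset_card_eq (le_of_not_ge hc)
      have h1 := ih t htc.le
      have h2 := ih (s \ t) (by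
        rw [Finset.card_sdiff_of_subset hts, htc]
        rw [pow_succ] at hs
        omega)
      rw [← Finset.sum_sdiff hts, ← Finset.sum_sdiff hts (f := fun i => N (f i))]
      calc N (∑ i ∈ s \ t, f i + ∑ i ∈ t, f i)
          ≤ K * (N (∑ i ∈ s \ t, f i) + N (∑ i ∈ t, f i)) := h.add_le _ _
        _ ≤ K * (K ^ a * ∑ i ∈ s \ t, N (f i) + K ^ a * ∑ i ∈ t, N (f i)) :=
            mul_le_mul_of_nonneg_left (add_le_add h2 h1) h.pos.le
        _ = _ := by rw [pow_succ]; ring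

theorem sum_smul_le (h : N.HasModulus K) {ι : Type*} (s : Finset ι) (x : ι → X) (z : ι → ℂ) :
    N (∑ i ∈ s, z i • x i) ≤ K ^ s.card * ∑ i ∈ s, ‖z i‖ * N (x i) := by
  simpa only [N.smul] using h.sum_le_pow s.card s Nat.lt_two_pow_self.le (fun i => z i • x i)

theorem exists_bound (h : N.HasModulus K) {ι : Type*} (s : Finset ι) (x : ι → X) :
    ∃ b : ℝ, 0 ≤ b ∧ ∀ z : ι → ℂ, (∀ i ∈ s, ‖z i‖ ≤ 1) → N (∑ i ∈ s, z i • x i) ≤ b := by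
  refine ⟨K ^ s.card * ∑ i ∈ s, N (x i), mul_nonneg (pow_nonneg h.pos.le _)
    (Finset.sum_nonneg fun i _ => N.nonneg _), fun z hz => (h.sum_smul_le s x z).trans ?_⟩
  refine mul_le_mul_of_nonneg_left (Finset.sum_le_sum fun i hi => ?_) (pow_nonneg h.pos.le _)
  exact mul_le_of_le_one_left (N.nonneg _) (hz i hi)

/-- A bound that improves itself. The supremum over the admissible coefficients is finite, so it
may be inserted for `A`; the constant `2 b` does not depend on any a priori bound. -/
theorem le_of_self_improving (h : N.HasModulus K) {ι : Type*} (s : Finset ι) (x : ι → X)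
    (P : (ι → ℂ) → Prop) (hP : ∀ z, P z → ∀ i ∈ s, ‖z i‖ ≤ 1) {b q : ℝ} (hq1 : q ≤ 1 / 2)
    (H : ∀ A : ℝ, 0 ≤ A → (∀ z, P z → N (∑ i ∈ s, z i • x i) ≤ A) →
      ∀ z, P z → N (∑ i ∈ s, z i • x i) ≤ b + q * A) (z : ι → ℂ) (hz : P z) :
    N (∑ i ∈ s, z i • x i) ≤ 2 * b := by
  obtain ⟨b₀, hb₀, hbd⟩ := h.exists_bound s x
  set T : Set ℝ := {r | ∃ z, P z ∧ r = N (∑ i ∈ s, z i • x i)} with hT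
  have hbdd : BddAbove T := ⟨b₀, by rintro r ⟨z, hz, rfl⟩; exact hbd z (hP z hz)⟩
  have hmem : ∀ z, P z → N (∑ i ∈ s, z i • x i) ≤ sSup T := fun z hz =>
    le_csSup hbdd ⟨z, hz, rfl⟩
  have h0 : 0 ≤ sSup T := (N.nonneg _).trans (hmem z hz)
  have h1 : sSup T ≤ b + q * sSup T := by
    refine csSup_le ⟨_, z, hz, rfl⟩ ?_
    rintro r ⟨z', hz', rfl⟩
    exact H _ h0 hmem z' hz'
  have h2 := hmem z hz
  nlinarith [mul_le_mul_of_nonneg_right hq1 h0]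

/-- Real coefficients in `[-1, 1]`: expand in binary digits `±1`. After finitely many digits the
remainder is absorbed by `le_of_self_improving`. -/
theorem exists_real_coeff_bound (h : N.HasModulus K) : ∃ C : ℝ, 0 ≤ C ∧
    ∀ {ι : Type} (s : Finset ι) (x : ι → X) (b : ℝ),
      (∀ ε : ι → ℤˣ, N (∑ i ∈ s, ((ε i : ℤ) : ℂ) • x i) ≤ b) →
      ∀ c : ι → ℝ, (∀ i, |c i| ≤ 1) → N (∑ i ∈ s, (c i : ℂ) • x i) ≤ C * b := by
  obtain ⟨J, hJ⟩ : ∃ J : ℕ, K * (1 / 2) ^ J ≤ 1 / 2 := by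
    obtain ⟨J, hJ⟩ := exists_pow_lt_of_lt_one (show (0 : ℝ) < 1 / (2 * K) by
      have := h.pos; positivity) (show (1 / 2 : ℝ) < 1 by norm_num)
    refine ⟨J, ?_⟩
    have := mul_le_mul_of_nonneg_left hJ.le h.pos.le
    have hK := h.pos.ne'
    calc _ ≤ _ := this
      _ = 1 / 2 := by field_simp
  -- `c' i` is the remainder of `c i` after `J` binary digits
  have key : ∀ J : ℕ, ∃ C : ℝ, 0 ≤ C ∧ ∀ {ι : Type} (s : Finset ι) (x : ι → X) (b : ℝ),
      (∀ ε : ι → ℤˣ, N (∑ i ∈ s, ((ε i : ℤ) : ℂ) • x i) ≤ b) →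
      ∀ c : ι → ℝ, (∀ i, |c i| ≤ 1) → ∃ c' : ι → ℝ, (∀ i, |c' i| ≤ 1) ∧
        N (∑ i ∈ s, ((c i - (1 / 2) ^ J * c' i : ℝ) : ℂ) • x i) ≤ C * b := by
    intro J
    induction J with
    | zero =>
      exact ⟨0, le_rfl, fun s x b _ c hc => ⟨c, hc, by simp [map_zero]⟩⟩
    | succ J ih =>
      obtain ⟨C, hC, H⟩ := ih
      refine ⟨K * (C + 1), mul_nonneg h.pos.le (by linarith), fun {ι} s x b hb c hc => ?_⟩
      obtain ⟨c', hc', hN⟩ := H s x b hb c hc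
      have hb0 : 0 ≤ b := (N.nonneg _).trans (hb 1)
      let ε : ι → ℤˣ := fun i => if 0 ≤ c' i then 1 else -1
      refine ⟨fun i => 2 * c' i - ((ε i : ℤ) : ℝ), fun i => ?_, ?_⟩
      · have := abs_le.1 (hc' i)
        simp only [ε]
        split_ifs with h0
        · rw [abs_le]; push_cast; constructor <;> linarith
        · rw [abs_le]; push_cast; constructor <;> linarith
      · have e1 : ∑ i ∈ s, ((c i - (1 / 2) ^ (J + 1) * (2 * c' i - ((ε i : ℤ) : ℝ)) : ℝ) : ℂ) • x i
            = ∑ i ∈ s, ((c i - (1 / 2) ^ J * c' i : ℝ) : ℂ) • x i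
              + (((1 / 2) ^ (J + 1) : ℝ) : ℂ) • ∑ i ∈ s, ((ε i : ℤ) : ℂ) • x i := by
          rw [Finset.smul_sum, ← Finset.sum_add_distrib]
          refine Finset.sum_congr rfl fun i _ => ?_
          rw [smul_smul, ← add_smul]
          congr 1
          push_cast
          ring
        rw [e1]
        refine (h.add_le _ _).trans ?_
        rw [mul_assoc]
        refine mul_le_mul_of_nonneg_left ?_ h.pos.le
        rw [N.map_real_smul (by positivity), add_mul, one_mul]
        refine add_le_add hN ?_
        calc (1 / 2 : ℝ) ^ (J + 1) * N (∑ i ∈ s, ((ε i : ℤ) : ℂ) • x i) ≤ 1 * b :=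
              mul_le_mul (pow_le_one₀ (by norm_num) (by norm_num)) (hb ε) (N.nonneg _) (by norm_num)
          _ = b := one_mul b
  obtain ⟨C, hC, H⟩ := key J
  refine ⟨2 * (K * C), mul_nonneg (by norm_num) (mul_nonneg h.pos.le hC),
    fun {ι} s x b hb c hc => ?_⟩
  rw [mul_assoc 2]
  refine h.le_of_self_improving s x (fun z => ∃ c : ι → ℝ, (∀ i, |c i| ≤ 1) ∧ z = fun i => (c i : ℂ))
    ?_ hJ ?_ _ ⟨c, hc, rfl⟩
  · rintro z ⟨c, hc, rfl⟩ i -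
    simpa using hc i
  · rintro A hA hall z ⟨c, hc, rfl⟩
    obtain ⟨c', hc', hN⟩ := H s x b hb c hc
    have e1 : ∑ i ∈ s, (c i : ℂ) • x i = ∑ i ∈ s, ((c i - (1 / 2) ^ J * c' i : ℝ) : ℂ) • x i
        + (((1 / 2) ^ J : ℝ) : ℂ) • ∑ i ∈ s, (c' i : ℂ) • x i := by
      rw [Finset.smul_sum, ← Finset.sum_add_distrib]
      refine Finset.sum_congr rfl fun i _ => ?_
      rw [smul_smul, ← add_smul]
      congr 1
      push_cast
      ring
    simp only
    rw [e1]
    refine (h.add_le _ _).trans ?_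
    rw [N.map_real_smul (by positivity)]
    have h1 := hall _ ⟨c', hc', rfl⟩
    calc K * (N (∑ i ∈ s, ((c i - (1 / 2) ^ J * c' i : ℝ) : ℂ) • x i)
            + (1 / 2) ^ J * N (∑ i ∈ s, (c' i : ℂ) • x i))
        ≤ K * (C * b + (1 / 2) ^ J * A) := by
          refine mul_le_mul_of_nonneg_left (add_le_add hN ?_) h.pos.le
          exact mul_le_mul_of_nonneg_left h1 (by positivity)
      _ = K * C * b + K * (1 / 2) ^ J * A := by ring

/-- In every quasi-normed space the sign choices control all coefficients in the unit disc. -/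
theorem exists_coeff_bound (h : N.HasModulus K) : ∃ C : ℝ, 0 ≤ C ∧
    ∀ {ι : Type} (s : Finset ι) (x : ι → X) (b : ℝ),
      (∀ ε : ι → ℤˣ, N (∑ i ∈ s, ((ε i : ℤ) : ℂ) • x i) ≤ b) →
      ∀ c : ι → ℂ, (∀ i, ‖c i‖ ≤ 1) → N (∑ i ∈ s, c i • x i) ≤ C * b := by
  obtain ⟨C, hC, H⟩ := h.exists_real_coeff_bound
  refine ⟨K * (C + C), mul_nonneg h.pos.le (by linarith), fun {ι} s x b hb c hc => ?_⟩
  have e1 : ∑ i ∈ s, c i • x i = ∑ i ∈ s, ((c i).re : ℂ) • x i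
      + Complex.I • ∑ i ∈ s, ((c i).im : ℂ) • x i := by
    rw [Finset.smul_sum, ← Finset.sum_add_distrib]
    refine Finset.sum_congr rfl fun i _ => ?_
    rw [smul_smul, ← add_smul]
    congr 1
    rw [mul_comm]
    exact (Complex.re_add_im _).symm
  rw [e1]
  refine (h.add_le _ _).trans ?_
  rw [N.smul, Complex.norm_I, one_mul, mul_assoc, add_mul]
  refine mul_le_mul_of_nonneg_left (add_le_add ?_ ?_) h.pos.le
  · exact H s x b hb _ fun i => (Complex.abs_re_le_norm _).trans (hc i)
  · exact H s x b hb _ fun i => (Complex.abs_im_le_norm _).trans (hc i)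

end HasModulus

end QuasiNorm

/-! ### Suprema over polydiscs and their convexity in logarithmic coordinates -/

namespace QuasiNorm

variable {X : Type u} [AddCommGroup X] [Module ℂ X]

/-- A trigonometric majorant on the circle bounds the value at the centre by its mean. No
integrability of `N` on the circle is needed: otherwise the average in the definition is `0`. -/
theorem IsPlurisubharmonic.le_of_circle_le {N : QuasiNorm X} (hN : N.IsPlurisubharmonic) (x y : X)
    (A₀ A₁ A₂ : ℝ)
    (H : ∀ θ : ℝ, N (x + Complex.exp (θ * Complex.I) • y)
      ≤ A₀ + A₁ * Real.cos θ + A₂ * Real.cos θ ^ 2) :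
    N x ≤ A₀ + A₂ / 2 := by
  have hpi := Real.pi_pos
  have hcont : Continuous fun θ : ℝ => A₀ + A₁ * Real.cos θ + A₂ * Real.cos θ ^ 2 := by fun_prop
  have hint : ∫ θ in (0 : ℝ)..(2 * Real.pi), (A₀ + A₁ * Real.cos θ + A₂ * Real.cos θ ^ 2)
      = (2 * Real.pi) * (A₀ + A₂ / 2) := by
    have i1 : IntervalIntegrable (fun θ : ℝ => A₀) volume 0 (2 * Real.pi) :=
      continuous_const.intervalIntegrable _ _
    have i2 : IntervalIntegrable (fun θ : ℝ => A₁ * Real.cos θ) volume 0 (2 * Real.pi) :=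
      (by fun_prop : Continuous fun θ : ℝ => A₁ * Real.cos θ).intervalIntegrable _ _
    have i3 : IntervalIntegrable (fun θ : ℝ => A₂ * Real.cos θ ^ 2) volume 0 (2 * Real.pi) :=
      (by fun_prop : Continuous fun θ : ℝ => A₂ * Real.cos θ ^ 2).intervalIntegrable _ _
    rw [intervalIntegral.integral_add (i1.add i2) i3, intervalIntegral.integral_add i1 i2,
      intervalIntegral.integral_const_mul, intervalIntegral.integral_const_mul, integral_cos,
      integral_cos_sq]
    simp
    ring
  have hle : ∫ θ in (0 : ℝ)..(2 * Real.pi), N (x + Complex.exp (θ * Complex.I) • y)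
      ≤ ∫ θ in (0 : ℝ)..(2 * Real.pi), (A₀ + A₁ * Real.cos θ + A₂ * Real.cos θ ^ 2) := by
    by_cases hi : IntervalIntegrable (fun θ : ℝ => N (x + Complex.exp (θ * Complex.I) • y))
        volume 0 (2 * Real.pi)
    · exact intervalIntegral.integral_mono_on (by positivity) hi
        (hcont.intervalIntegrable _ _) fun θ _ => H θ
    · rw [intervalIntegral.integral_undef hi]
      exact intervalIntegral.integral_nonneg (by positivity) fun θ _ => (N.nonneg _).trans (H θ)
  calc N x ≤ _ := hN.2 x y
    _ ≤ (2 * Real.pi)⁻¹ * ((2 * Real.pi) * (A₀ + A₂ / 2)) := by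
        rw [← hint]
        exact mul_le_mul_of_nonneg_left hle (by positivity)
    _ = A₀ + A₂ / 2 := by field_simp

/-- Second order expansion of `log |1 + r e^{iθ}|`, as an upper bound with a cubic error. -/
theorem _root_.norm_one_add_mul_exp_le {r : ℝ} (hr : |r| ≤ 1 / 8) (θ : ℝ) :
    ‖1 + (r : ℂ) * Complex.exp (θ * Complex.I)‖
      ≤ Real.exp (r * Real.cos θ + r ^ 2 / 2 - r ^ 2 * Real.cos θ ^ 2 + 30 * |r| ^ 3) := by
  set k := Real.cos θ with hk
  have hk1 : |k| ≤ 1 := Real.abs_cos_le_one θ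
  set t : ℝ := 2 * r * k + r ^ 2 with ht
  have hsq : ‖1 + (r : ℂ) * Complex.exp (θ * Complex.I)‖ ^ 2 = 1 + t := by
    rw [Complex.sq_norm, Complex.normSq_apply, Complex.exp_mul_I]
    simp only [Complex.add_re, Complex.one_re, Complex.mul_re, Complex.ofReal_re,
      Complex.ofReal_im, Complex.add_im, Complex.one_im, Complex.mul_im, Complex.I_re,
      Complex.I_im, Complex.cos_ofReal_re, Complex.cos_ofReal_im, Complex.sin_ofReal_re,
      Complex.sin_ofReal_im]
    have := Real.sin_sq_add_cos_sq θ
    rw [← hk] at this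
    rw [ht]
    linear_combination r ^ 2 * this
  have hr0 := abs_nonneg r
  have hrk : |r * k| ≤ |r| := by
    rw [abs_mul]
    exact mul_le_of_le_one_right hr0 hk1
  have hr2 : r ^ 2 = |r| ^ 2 := (sq_abs r).symm
  have ht3 : |t| ≤ 3 * |r| := by
    calc |t| ≤ |2 * r * k| + |r ^ 2| := abs_add_le _ _
      _ = 2 * |r * k| + |r| ^ 2 := by rw [mul_assoc, abs_mul, abs_two, abs_pow]
      _ ≤ 3 * |r| := by nlinarith
  have ht2 : |t| ≤ 1 / 2 := by linarith
  have hlog : Real.log (1 + t) ≤ t - t ^ 2 / 2 + 2 * |t| ^ 3 := by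
    have h := Real.abs_log_sub_add_sum_range_le (x := -t) (by rw [abs_neg]; linarith) 2
    rw [abs_neg, sub_neg_eq_add] at h
    have h2 := (abs_le.1 h).2
    simp only [Finset.sum_range_succ, Finset.sum_range_zero] at h2
    have h3 : |t| ^ (2 + 1) / (1 - |t|) ≤ 2 * |t| ^ 3 := by
      rw [div_le_iff₀ (by linarith)]
      have h0 : 0 ≤ |t| ^ 3 * (1 - 2 * |t|) := mul_nonneg (by positivity) (by linarith)
      norm_num
      linarith
    norm_num at h2 h3 ⊢
    linarith
  have hr3 : r ^ 3 * k ≥ -|r| ^ 3 := by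
    have : |r ^ 3 * k| ≤ |r| ^ 3 := by
      rw [abs_mul, abs_pow]
      exact mul_le_of_le_one_right (by positivity) hk1
    exact (abs_le.1 this).1
  have hcube : |t| ^ 3 ≤ 27 * |r| ^ 3 := by
    calc |t| ^ 3 ≤ (3 * |r|) ^ 3 := pow_le_pow_left₀ (abs_nonneg _) ht3 3
      _ = _ := by ring
  have hfin : Real.log (1 + t) ≤ 2 * (r * k + r ^ 2 / 2 - r ^ 2 * k ^ 2 + 30 * |r| ^ 3) := by
    refine hlog.trans ?_
    have e : t ^ 2 / 2 = 2 * r ^ 2 * k ^ 2 + 2 * (r ^ 3 * k) + r ^ 4 / 2 := by rw [ht]; ring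
    have : 0 ≤ r ^ 4 := by positivity
    have h0 : 0 ≤ |r| ^ 3 := by positivity
    rw [e]
    linarith
  have hpos : 0 < 1 + t := by have := (abs_le.1 ht2).1; linarith
  have h4 : 1 + t ≤ Real.exp (r * k + r ^ 2 / 2 - r ^ 2 * k ^ 2 + 30 * |r| ^ 3) ^ 2 := by
    rw [← Real.exp_nat_mul]
    exact (Real.log_le_iff_le_exp hpos).1 (by exact_mod_cast hfin)
  rw [← hsq] at h4
  exact le_of_sq_le_sq h4 (Real.exp_pos _).le

variable {ι : Type*} [Fintype ι]

/-- The supremum of `N (∑ zᵢ xᵢ)` over the closed polydisc with radii `exp (yᵢ)`. As a function of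
the radii it is a lattice quasi-norm. -/
noncomputable def polydiscSup (N : QuasiNorm X) (x : ι → X) (y : ι → ℝ) : ℝ :=
  sSup {r | ∃ z : ι → ℂ, (∀ i, ‖z i‖ ≤ Real.exp (y i)) ∧ r = N (∑ i, z i • x i)}

theorem le_polydiscSup (N : QuasiNorm X) (x : ι → X) {y : ι → ℝ} {z : ι → ℂ}
    (hz : ∀ i, ‖z i‖ ≤ Real.exp (y i)) : N (∑ i, z i • x i) ≤ N.polydiscSup x y := by
  obtain ⟨K, hK⟩ := N.exists_hasModulus
  refine le_csSup ⟨K ^ (Finset.univ : Finset ι).card * ∑ i, Real.exp (y i) * N (x i), ?_⟩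
    ⟨z, hz, rfl⟩
  rintro r ⟨z, hz, rfl⟩
  refine (hK.sum_smul_le _ x z).trans (mul_le_mul_of_nonneg_left (Finset.sum_le_sum fun i _ => ?_)
    (pow_nonneg hK.pos.le _))
  exact mul_le_mul_of_nonneg_right (hz i) (N.nonneg _)

theorem polydiscSup_le (N : QuasiNorm X) (x : ι → X) {y : ι → ℝ} {b : ℝ}
    (H : ∀ z : ι → ℂ, (∀ i, ‖z i‖ ≤ Real.exp (y i)) → N (∑ i, z i • x i) ≤ b) :
    N.polydiscSup x y ≤ b := by
  refine csSup_le ⟨_, 0, fun i => by simpa using (Real.exp_pos _).le, rfl⟩ ?_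
  rintro r ⟨z, hz, rfl⟩
  exact H z hz

theorem polydiscSup_nonneg (N : QuasiNorm X) (x : ι → X) (y : ι → ℝ) : 0 ≤ N.polydiscSup x y :=
  (N.nonneg _).trans (N.le_polydiscSup x (z := 0) fun i => by simpa using (Real.exp_pos _).le)

theorem polydiscSup_le_exp_mul (N : QuasiNorm X) (x : ι → X) {y y' : ι → ℝ} {d : ℝ}
    (h : ∀ i, y' i ≤ y i + d) : N.polydiscSup x y' ≤ Real.exp d * N.polydiscSup x y := by
  refine N.polydiscSup_le x fun z hz => ?_
  have h1 : N (∑ i, ((Real.exp (-d) : ℝ) : ℂ) • z i • x i) ≤ N.polydiscSup x y := by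
    simp only [smul_smul]
    refine N.le_polydiscSup x fun i => ?_
    rw [norm_mul, Complex.norm_real, Real.norm_of_nonneg (Real.exp_pos _).le]
    calc Real.exp (-d) * ‖z i‖ ≤ Real.exp (-d) * Real.exp (y i + d) :=
          mul_le_mul_of_nonneg_left ((hz i).trans (Real.exp_le_exp.2 (h i))) (Real.exp_pos _).le
      _ = Real.exp (y i) := by rw [← Real.exp_add]; ring_nf
  rw [← Finset.smul_sum, N.map_real_smul (Real.exp_pos _).le, Real.exp_neg,
    inv_mul_le_iff₀ (Real.exp_pos d)] at h1
  exact h1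

theorem continuous_polydiscSup (N : QuasiNorm X) (x : ι → X) : Continuous (N.polydiscSup x) := by
  rw [continuous_iff_continuousAt]
  intro y
  have h1 : Filter.Tendsto (fun y' : ι → ℝ => Real.exp (-‖y' - y‖) * N.polydiscSup x y)
      (nhds y) (nhds (N.polydiscSup x y)) := by
    have : Continuous fun y' : ι → ℝ => Real.exp (-‖y' - y‖) * N.polydiscSup x y := by fun_prop
    simpa using this.tendsto y
  have h2 : Filter.Tendsto (fun y' : ι → ℝ => Real.exp ‖y' - y‖ * N.polydiscSup x y)
      (nhds y) (nhds (N.polydiscSup x y)) := by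
    have : Continuous fun y' : ι → ℝ => Real.exp ‖y' - y‖ * N.polydiscSup x y := by fun_prop
    simpa using this.tendsto y
  have hcoord : ∀ (y' : ι → ℝ) i, |y' i - y i| ≤ ‖y' - y‖ := fun y' i => norm_le_pi_norm (y' - y) i
  refine tendsto_of_tendsto_of_tendsto_of_le_of_le h1 h2 (fun y' => ?_) fun y' => ?_
  · have h3 : N.polydiscSup x y ≤ Real.exp ‖y' - y‖ * N.polydiscSup x y' :=
      N.polydiscSup_le_exp_mul x fun i => by
        have := (abs_le.1 (hcoord y' i)).1
        linarith
    simp only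
    rw [Real.exp_neg, inv_mul_le_iff₀ (Real.exp_pos _)]
    exact h3
  · exact N.polydiscSup_le_exp_mul x fun i => by
      have := (abs_le.1 (hcoord y' i)).2
      linarith

theorem _root_.sq_pi_norm_le_sum_sq (e : ι → ℝ) : ‖e‖ ^ 2 ≤ ∑ i, e i ^ 2 := by
  have h : ‖e‖ ≤ √(∑ i, e i ^ 2) := by
    rw [pi_norm_le_iff_of_nonneg (Real.sqrt_nonneg _)]
    intro i
    refine Real.abs_le_sqrt ?_
    exact Finset.single_le_sum (f := fun i => e i ^ 2) (fun j _ => sq_nonneg (e j))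
      (Finset.mem_univ i)
  calc ‖e‖ ^ 2 ≤ √(∑ i, e i ^ 2) ^ 2 := pow_le_pow_left₀ (norm_nonneg _) h 2
    _ = _ := Real.sq_sqrt (Finset.sum_nonneg fun i _ => sq_nonneg _)

/-- Second order test along an affine disc. If `(t, e)` maximises
`polydiscSup (a + t l + e) - Λ |e|² + ε t²` among its neighbours, then the mean value inequality on
the discs `zᵢ (1 + c lᵢ e^{iθ})` is violated for small `c`: in logarithmic coordinates they move
`t` by `c cos θ` and `e` by an amount of order `c²` whose mean is only of order `c³`. -/
theorem IsPlurisubharmonic.not_local_max {N : QuasiNorm X} (hN : N.IsPlurisubharmonic) (x : ι → X)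
    (a l e : ι → ℝ) {t Λ ε ρ : ℝ} (hΛ : 0 ≤ Λ) (hε : 0 < ε) (hρ : 0 < ρ) (he : ‖e‖ ≤ 1)
    (hmax : ∀ (s : ℝ) (d : ι → ℝ), |s| ≤ ρ → ‖d‖ ≤ ρ →
      N.polydiscSup x (a + (t + s) • l + (e + d)) - Λ * ∑ i, (e i + d i) ^ 2 + ε * (t + s) ^ 2
        ≤ N.polydiscSup x (a + t • l + e) - Λ * ∑ i, e i ^ 2 + ε * t ^ 2) : False := by
  set m : ℝ := (Fintype.card ι : ℝ) with hm
  set R : ℝ := ‖l‖ with hR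
  have hR0 : 0 ≤ R := norm_nonneg l
  have hm0 : 0 ≤ m := Nat.cast_nonneg _
  set Q : ℝ := Λ * (m * (60 * R ^ 3 + 25 * R ^ 4)) with hQ
  have hQ0 : 0 ≤ Q := by positivity
  obtain ⟨c, hc0, hc1, hcρ, hcR, hcR2, hcQ⟩ : ∃ c : ℝ, 0 < c ∧ c ≤ 1 ∧ c ≤ ρ ∧ c * R ≤ 1 / 8 ∧
      5 * (c * R) ^ 2 ≤ ρ ∧ c * Q < ε / 2 := by
    have h1 : ∀ᶠ c in nhdsWithin (0 : ℝ) (Set.Ioi 0), c * R < 1 / 8 ∧ 5 * (c * R) ^ 2 < ρ ∧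
        c * Q < ε / 2 ∧ c < 1 ∧ c < ρ := by
      refine Filter.Eventually.filter_mono nhdsWithin_le_nhds ?_
      have t1 : Filter.Tendsto (fun c : ℝ => c * R) (nhds 0) (nhds (0 * R)) :=
        (by fun_prop : Continuous fun c : ℝ => c * R).tendsto 0
      have t2 : Filter.Tendsto (fun c : ℝ => 5 * (c * R) ^ 2) (nhds 0) (nhds (5 * (0 * R) ^ 2)) :=
        (by fun_prop : Continuous fun c : ℝ => 5 * (c * R) ^ 2).tendsto 0
      have t3 : Filter.Tendsto (fun c : ℝ => c * Q) (nhds 0) (nhds (0 * Q)) :=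
        (by fun_prop : Continuous fun c : ℝ => c * Q).tendsto 0
      filter_upwards [t1.eventually_lt_const (by norm_num : 0 * R < 1 / 8),
        t2.eventually_lt_const (by simpa using hρ : 5 * (0 * R) ^ 2 < ρ),
        t3.eventually_lt_const (by simpa using hε : 0 * Q < ε / 2),
        eventually_lt_nhds (zero_lt_one' ℝ), eventually_lt_nhds hρ] with c h1 h2 h3 h4 h5
      exact ⟨h1, h2, h3, h4, h5⟩
    obtain ⟨c, ⟨h1, h2, h3, h4, h5⟩, hc0⟩ := (h1.and self_mem_nhdsWithin).exists
    exact ⟨c, hc0, h4.le, h5.le, h1.le, h2.le, h3⟩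
  have hl : ∀ i, |l i| ≤ R := fun i => norm_le_pi_norm l i
  have hei : ∀ i, |e i| ≤ 1 := fun i => (norm_le_pi_norm e i).trans he
  have hx : ∀ i, |c * l i| ≤ c * R := fun i => by
    rw [abs_mul, abs_of_pos hc0]
    exact mul_le_mul_of_nonneg_left (hl i) hc0.le
  set y : ι → ℝ := a + t • l + e with hy
  set δ : ℝ → ι → ℝ := fun θ i =>
    (c * l i) ^ 2 / 2 - (c * l i) ^ 2 * Real.cos θ ^ 2 + 30 * |c * l i| ^ 3 with hδ
  have hδb : ∀ θ i, |δ θ i| ≤ 5 * (c * R) ^ 2 := by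
    intro θ i
    have h1 := hx i
    have h2 : (c * l i) ^ 2 ≤ (c * R) ^ 2 := sq_le_sq.2 (h1.trans (le_abs_self _))
    have h3 : |c * l i| ^ 3 ≤ (1 / 8) * (c * R) ^ 2 := by
      have : |c * l i| ^ 3 = |c * l i| * (c * l i) ^ 2 := by rw [← sq_abs (c * l i)]; ring
      rw [this]
      exact mul_le_mul (h1.trans hcR) h2 (sq_nonneg _) (by norm_num)
    have h4 := Real.cos_sq_le_one θ
    have h5 := sq_nonneg (Real.cos θ)
    have h6 : 0 ≤ |c * l i| ^ 3 := by positivity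
    have h7 := sq_nonneg (c * l i)
    have h8 : (c * l i) ^ 2 * Real.cos θ ^ 2 ≤ (c * l i) ^ 2 := mul_le_of_le_one_right h7 h4
    have h9 : 0 ≤ (c * l i) ^ 2 * Real.cos θ ^ 2 := mul_nonneg h7 h5
    simp only [hδ]
    rw [abs_le]
    constructor <;> linarith
  -- On the disc the maximality bounds `N` by the trigonometric polynomial `A₀ + A₁ cos + A₂ cos²`.
  -- The terms of order `c²` in its mean cancel, except for `-ε c² / 2`.
  set A₀ : ℝ := N.polydiscSup x y - Λ * ∑ i, e i ^ 2 + ε * t ^ 2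
    + Λ * (∑ i, e i ^ 2 + ∑ i, 2 * e i * ((c * l i) ^ 2 / 2 + 30 * |c * l i| ^ 3)
      + m * (25 * (c * R) ^ 4)) - ε * t ^ 2 with hA₀
  set A₁ : ℝ := -(2 * ε * t * c) with hA₁
  set A₂ : ℝ := -(Λ * ∑ i, 2 * e i * (c * l i) ^ 2) - ε * c ^ 2 with hA₂
  have hdisc : ∀ z : ι → ℂ, (∀ i, ‖z i‖ ≤ Real.exp (y i)) →
      N (∑ i, z i • x i) ≤ A₀ + A₂ / 2 := by
    intro z hz
    refine hN.le_of_circle_le _ (∑ i, (z i * ((c * l i : ℝ) : ℂ)) • x i) A₀ A₁ A₂ fun θ => ?_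
    have e1 : ∑ i, z i • x i + Complex.exp (θ * Complex.I) •
        ∑ i, (z i * ((c * l i : ℝ) : ℂ)) • x i
        = ∑ i, (z i * (1 + ((c * l i : ℝ) : ℂ) * Complex.exp (θ * Complex.I))) • x i := by
      rw [Finset.smul_sum, ← Finset.sum_add_distrib]
      refine Finset.sum_congr rfl fun i _ => ?_
      rw [smul_smul, ← add_smul]
      congr 1
      ring
    rw [e1]
    have h1 : N (∑ i, (z i * (1 + ((c * l i : ℝ) : ℂ) * Complex.exp (θ * Complex.I))) • x i)
        ≤ N.polydiscSup x (a + (t + c * Real.cos θ) • l + (e + δ θ)) := by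
      refine N.le_polydiscSup x fun i => ?_
      rw [norm_mul]
      refine (mul_le_mul (hz i) (norm_one_add_mul_exp_le ((hx i).trans hcR) θ) (norm_nonneg _)
        (Real.exp_pos _).le).trans_eq ?_
      rw [← Real.exp_add]
      congr 1
      simp only [hy, hδ, Pi.add_apply, Pi.smul_apply, smul_eq_mul]
      ring
    have hcos := Real.abs_cos_le_one θ
    have h2 := hmax (c * Real.cos θ) (δ θ)
      (by
        rw [abs_mul, abs_of_pos hc0]
        exact (mul_le_of_le_one_right hc0.le hcos).trans hcρ)
      (by
        rw [pi_norm_le_iff_of_nonneg hρ.le]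
        exact fun i => (hδb θ i).trans hcR2)
    have h3 : ∑ i, (e i + δ θ i) ^ 2 ≤ ∑ i, e i ^ 2 + ∑ i, 2 * e i * δ θ i
        + m * (25 * (c * R) ^ 4) := by
      have : ∀ i, (e i + δ θ i) ^ 2 ≤ e i ^ 2 + 2 * e i * δ θ i + 25 * (c * R) ^ 4 := by
        intro i
        have h4 : δ θ i ^ 2 ≤ (5 * (c * R) ^ 2) ^ 2 :=
          sq_le_sq.2 ((hδb θ i).trans (le_abs_self _))
        nlinarith
      refine (Finset.sum_le_sum fun i _ => this i).trans_eq ?_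
      rw [Finset.sum_add_distrib, Finset.sum_add_distrib, Finset.sum_const, Finset.card_univ,
        nsmul_eq_mul]
    have h5 : ∑ i, 2 * e i * δ θ i = ∑ i, 2 * e i * ((c * l i) ^ 2 / 2 + 30 * |c * l i| ^ 3)
        - (∑ i, 2 * e i * (c * l i) ^ 2) * Real.cos θ ^ 2 := by
      rw [Finset.sum_mul, ← Finset.sum_sub_distrib]
      refine Finset.sum_congr rfl fun i _ => ?_
      simp only [hδ]
      ring
    rw [h5] at h3
    have h6 := mul_le_mul_of_nonneg_left h3 hΛ
    calc _ ≤ _ := h1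
      _ ≤ _ := by
        rw [hA₀, hA₁, hA₂]
        nlinarith
  have hfin := N.polydiscSup_le x hdisc
  have hsum : ∑ i, 2 * e i * ((c * l i) ^ 2 / 2 + 30 * |c * l i| ^ 3)
      - (∑ i, 2 * e i * (c * l i) ^ 2) / 2 ≤ m * (60 * (c * R) ^ 3) := by
    rw [Finset.sum_div, ← Finset.sum_sub_distrib]
    have : ∀ i ∈ Finset.univ, 2 * e i * ((c * l i) ^ 2 / 2 + 30 * |c * l i| ^ 3)
        - 2 * e i * (c * l i) ^ 2 / 2 ≤ 60 * (c * R) ^ 3 := by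
      intro i _
      have h1 : |c * l i| ^ 3 ≤ (c * R) ^ 3 := pow_le_pow_left₀ (abs_nonneg _) (hx i) 3
      have h2 : e i * |c * l i| ^ 3 ≤ 1 * (c * R) ^ 3 :=
        mul_le_mul ((le_abs_self _).trans (hei i)) h1 (by positivity) zero_le_one
      linarith
    refine (Finset.sum_le_sum this).trans_eq ?_
    rw [Finset.sum_const, Finset.card_univ, nsmul_eq_mul]
  have h7 := mul_le_mul_of_nonneg_left hsum hΛ
  have h8 : Λ * (m * (60 * (c * R) ^ 3)) + Λ * (m * (25 * (c * R) ^ 4)) ≤ c ^ 2 * (c * Q) := by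
    have e4 : Λ * (m * (25 * (c * R) ^ 4)) = c ^ 3 * (Λ * (m * (25 * R ^ 4))) * c := by ring
    have : c ^ 3 * (Λ * (m * (25 * R ^ 4))) * c ≤ c ^ 3 * (Λ * (m * (25 * R ^ 4))) :=
      mul_le_of_le_one_right (by positivity) hc1
    rw [e4]
    calc _ ≤ Λ * (m * (60 * (c * R) ^ 3)) + c ^ 3 * (Λ * (m * (25 * R ^ 4))) := by linarith
      _ = _ := by rw [hQ]; ring
  have h9 : c ^ 2 * (c * Q) < c ^ 2 * (ε / 2) := mul_lt_mul_of_pos_left hcQ (by positivity)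
  rw [hA₀, hA₂] at hfin
  nlinarith

set_option maxHeartbeats 1000000 in
/-- Sublevel sets of `polydiscSup` are convex: in terms of the radii, the value at a geometric mean
is at most the maximum of the values at the vectors averaged. Otherwise a penalised version of
`polydiscSup` on a neighbourhood of a segment has an interior maximum, contrary to
`IsPlurisubharmonic.not_local_max`. -/
theorem IsPlurisubharmonic.convex_polydiscSup_le {N : QuasiNorm X} (hN : N.IsPlurisubharmonic)
    (x : ι → X) (b : ℝ) : Convex ℝ {y | N.polydiscSup x y ≤ b} := by
  rw [convex_iff_segment_subset]
  intro a ha a' ha' y hy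
  rw [segment_eq_image'] at hy
  obtain ⟨t₀, ht₀, rfl⟩ := hy
  set l := a' - a with hl
  simp only [Set.mem_ofPred_eq] at ha ha' ⊢
  by_contra! hlt
  set ε : ℝ := (N.polydiscSup x (a + t₀ • l) - b) / 4 with hε
  have hε0 : 0 < ε := by rw [hε]; linarith
  have hb0 : 0 ≤ b := (N.polydiscSup_nonneg x a).trans ha
  set B : ℝ := Real.exp ‖l‖ * b with hB
  have hB0 : 0 ≤ B := by positivity
  set Λ : ℝ := 3 * B + b ^ 2 / ε + 1 with hΛ
  have hΛ1 : 1 ≤ Λ := by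
    have : 0 ≤ b ^ 2 / ε := by positivity
    rw [hΛ]; linarith
  -- The penalty `Λ` keeps the maximum away from `‖e‖ = 1`, and the small convex term `ε t²`, which
  -- produces the contradiction, does not outweigh the excess `4 ε` over the ends of the segment.
  set Ψ : ℝ × (ι → ℝ) → ℝ := fun p =>
    N.polydiscSup x (a + p.1 • l + p.2) - Λ * ∑ i, p.2 i ^ 2 + ε * p.1 ^ 2 with hΨ
  have hΨc : Continuous Ψ := by
    have := N.continuous_polydiscSup x
    fun_prop
  have hcomp : IsCompact (Set.Icc (0 : ℝ) 1 ×ˢ Metric.closedBall (0 : ι → ℝ) 1) :=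
    isCompact_Icc.prod (isCompact_closedBall _ _)
  obtain ⟨⟨t, e⟩, ⟨ht, he⟩, hmax⟩ := hcomp.exists_isMaxOn
    ⟨(t₀, 0), ht₀, by simp⟩ hΨc.continuousOn
  simp only [mem_closedBall_zero_iff] at he ht
  have hge : b + 4 * ε ≤ Ψ (t, e) := by
    have h1 : Ψ (t₀, 0) ≤ Ψ (t, e) := hmax (show (t₀, (0 : ι → ℝ)) ∈ _ from ⟨ht₀, by simp⟩)
    have h2 : Ψ (t₀, 0) = N.polydiscSup x (a + t₀ • l) + ε * t₀ ^ 2 := by simp [hΨ]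
    have h3 : 0 ≤ ε * t₀ ^ 2 := by positivity
    rw [h2] at h1
    linarith
  have hbΛ : b ^ 2 ≤ ε * Λ := by
    have : b ^ 2 = ε * (b ^ 2 / ε) := by field_simp
    rw [this]
    refine mul_le_mul_of_nonneg_left ?_ hε0.le
    rw [hΛ]
    linarith
  have hend : ∀ v : ι → ℝ, N.polydiscSup x v ≤ b →
      N.polydiscSup x (v + e) - Λ * ∑ i, e i ^ 2 ≤ b + ε := by
    intro v hv
    have h1 : N.polydiscSup x (v + e) ≤ Real.exp ‖e‖ * N.polydiscSup x v :=
      N.polydiscSup_le_exp_mul x fun i =>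
        add_le_add le_rfl ((le_abs_self _).trans (norm_le_pi_norm e i))
    have h2 : Real.exp ‖e‖ ≤ 1 + 2 * ‖e‖ := by
      have h := Real.abs_exp_sub_one_le (x := ‖e‖) (by rwa [abs_of_nonneg (norm_nonneg _)])
      rw [abs_of_nonneg (norm_nonneg e)] at h
      have := (abs_le.1 h).2
      linarith
    have h3 := sq_pi_norm_le_sum_sq e
    have h4 : Real.exp ‖e‖ * N.polydiscSup x v ≤ (1 + 2 * ‖e‖) * b :=
      mul_le_mul h2 hv (N.polydiscSup_nonneg x v) (by positivity)
    have h5 : Λ * ‖e‖ ^ 2 ≤ Λ * ∑ i, e i ^ 2 := mul_le_mul_of_nonneg_left h3 (by linarith)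
    have h6 : 2 * ‖e‖ * b ≤ Λ * ‖e‖ ^ 2 + ε := by
      have h7 : 0 ≤ (Λ * ‖e‖ - b) ^ 2 := sq_nonneg _
      have h8 : Λ * (2 * ‖e‖ * b) ≤ Λ * (Λ * ‖e‖ ^ 2 + ε) := by nlinarith
      exact le_of_mul_le_mul_left h8 (by linarith)
    nlinarith
  have ht0 : t ≠ 0 := by
    rintro rfl
    have h1 := hend a ha
    have h2 : Ψ (0, e) = N.polydiscSup x (a + e) - Λ * ∑ i, e i ^ 2 := by simp [hΨ]
    linarith
  have ht1 : t ≠ 1 := by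
    rintro rfl
    have h1 := hend a' ha'
    have h2 : Ψ (1, e) = N.polydiscSup x (a' + e) - Λ * ∑ i, e i ^ 2 + ε := by simp [hΨ, hl]
    linarith
  have he1 : ‖e‖ ≠ 1 := by
    intro h
    have h3 := sq_pi_norm_le_sum_sq e
    rw [h] at h3
    have h1 : N.polydiscSup x (a + t • l + e) ≤ Real.exp (‖l‖ + 1) * N.polydiscSup x a := by
      refine N.polydiscSup_le_exp_mul x fun i => ?_
      have h4 : t * l i ≤ ‖l‖ := by
        calc t * l i ≤ |t * l i| := le_abs_self _
          _ = t * |l i| := by rw [abs_mul, abs_of_nonneg ht.1]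
          _ ≤ 1 * ‖l‖ := mul_le_mul ht.2 (norm_le_pi_norm l i) (abs_nonneg _) zero_le_one
          _ = ‖l‖ := one_mul _
      have h5 : e i ≤ 1 := (le_abs_self _).trans ((norm_le_pi_norm e i).trans he)
      simp only [Pi.add_apply, Pi.smul_apply, smul_eq_mul]
      linarith
    have h2 : Real.exp (‖l‖ + 1) * N.polydiscSup x a ≤ 3 * B := by
      rw [Real.exp_add, hB]
      have h4 := Real.exp_one_lt_three.le
      have h5 : Real.exp ‖l‖ * N.polydiscSup x a ≤ Real.exp ‖l‖ * b :=
        mul_le_mul_of_nonneg_left ha (Real.exp_pos _).le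
      have h6 : 0 ≤ Real.exp ‖l‖ * N.polydiscSup x a :=
        mul_nonneg (Real.exp_pos _).le (N.polydiscSup_nonneg x a)
      nlinarith [Real.exp_pos 1]
    have h6 : Ψ (t, e) ≤ 3 * B - Λ * 1 + ε * 1 := by
      have h7 : Λ * 1 ≤ Λ * ∑ i, e i ^ 2 := mul_le_mul_of_nonneg_left (by linarith) (by linarith)
      have h8 : ε * t ^ 2 ≤ ε * 1 :=
        mul_le_mul_of_nonneg_left (pow_le_one₀ ht.1 ht.2) hε0.le
      simp only [hΨ]
      linarith
    have : 0 ≤ b ^ 2 / ε := by positivity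
    rw [hΛ] at h6
    linarith
  have ht0' : 0 < t := lt_of_le_of_ne ht.1 (Ne.symm ht0)
  have ht1' : t < 1 := lt_of_le_of_ne ht.2 ht1
  have he1' : ‖e‖ < 1 := lt_of_le_of_ne he he1
  refine hN.not_local_max x a l e (t := t) (Λ := Λ) (ε := ε) (ρ := min (min t (1 - t)) (1 - ‖e‖))
    (by linarith) hε0 (by simp [ht0', ht1', he1']) he fun s d hs hd => ?_
  have hs1 := abs_le.1 (hs.trans ((min_le_left _ _).trans (min_le_left _ _)))
  have hs2 := abs_le.1 (hs.trans ((min_le_left _ _).trans (min_le_right _ _)))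
  have hd1 := hd.trans (min_le_right _ _)
  have hmem : (t + s, e + d) ∈ Set.Icc (0 : ℝ) 1 ×ˢ Metric.closedBall (0 : ι → ℝ) 1 := by
    refine ⟨⟨by linarith, by linarith⟩, ?_⟩
    simp only [mem_closedBall_zero_iff]
    exact (norm_add_le _ _).trans (by linarith)
  have h := hmax hmem
  simpa only [hΨ, Set.mem_ofPred_eq, Pi.add_apply] using h

end QuasiNorm

/-! ### Phases of real numbers -/

/-- The point of the unit circle reached after `t` turns. -/
noncomputable def cis (t : ℝ) : ℂ := Complex.exp (2 * Real.pi * t * Complex.I)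

theorem cis_eq (t : ℝ) : cis t = Complex.exp (Complex.I * ((2 * Real.pi * t : ℝ) : ℂ)) := by
  rw [cis]; congr 1; push_cast; ring

theorem norm_cis (t : ℝ) : ‖cis t‖ = 1 := by
  rw [cis_eq, mul_comm, Complex.norm_exp_ofReal_mul_I]

theorem cis_zero : cis 0 = 1 := by simp [cis]

theorem cis_add (s t : ℝ) : cis (s + t) = cis s * cis t := by
  rw [cis, cis, cis, ← Complex.exp_add]; congr 1; push_cast; ring

theorem cis_intCast (k : ℤ) : cis k = 1 := by
  rw [cis, Complex.exp_eq_one_iff]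
  exact ⟨k, by push_cast; ring⟩

theorem cis_nat_mul (k : ℕ) (t : ℝ) : cis (k * t) = cis t ^ k := by
  rw [cis, cis, ← Complex.exp_nat_mul]; congr 1; push_cast; ring

theorem cis_neg_mul_cis (t : ℝ) : cis (-t) * cis t = 1 := by
  rw [← cis_add, neg_add_cancel, cis_zero]

theorem cis_sub (s t : ℝ) : cis (s - t) = cis s * cis (-t) := by rw [sub_eq_add_neg, cis_add]

theorem norm_cis_sub_one_le (t : ℝ) : ‖cis t - 1‖ ≤ 2 * Real.pi * |t| := by
  rw [cis_eq]
  refine (Real.norm_exp_I_mul_ofReal_sub_one_le).trans_eq ?_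
  rw [Real.norm_eq_abs, abs_mul, abs_of_pos (by positivity)]

theorem norm_cis_sub_cis (s t : ℝ) : ‖cis s - cis t‖ = ‖cis (s - t) - 1‖ := by
  have h : cis s - cis t = (cis (s - t) - 1) * cis t := by
    rw [cis_sub, sub_mul, mul_assoc, cis_neg_mul_cis]; ring
  rw [h, norm_mul, norm_cis, mul_one]

theorem norm_cis_sub_cis_le (s t : ℝ) : ‖cis s - cis t‖ ≤ 2 * Real.pi * |s - t| := by
  rw [norm_cis_sub_cis]; exact norm_cis_sub_one_le _

theorem four_mul_abs_le_norm_cis_sub_one {t : ℝ} (ht : |t| ≤ 1 / 2) : 4 * |t| ≤ ‖cis t - 1‖ := by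
  rw [cis_eq, Complex.norm_exp_I_mul_ofReal_sub_one, norm_mul, Real.norm_eq_abs, Real.norm_eq_abs,
    abs_two]
  have e : 2 * Real.pi * t / 2 = Real.pi * t := by ring
  rw [e]
  have h := Real.mul_abs_le_abs_sin (x := Real.pi * t) (by
    rw [abs_mul, abs_of_pos Real.pi_pos]
    nlinarith [Real.pi_pos])
  rw [abs_mul, abs_of_pos Real.pi_pos] at h
  have e2 : 2 / Real.pi * (Real.pi * |t|) = 2 * |t| := by
    have := Real.pi_ne_zero
    field_simp
  linarith

theorem cis_sub_round (t : ℝ) : cis (t - round t) = cis t := by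
  rw [cis_sub, ← Int.cast_neg, cis_intCast, mul_one]

theorem four_mul_abs_sub_round_le (t : ℝ) : 4 * |t - round t| ≤ ‖cis t - 1‖ := by
  rw [← cis_sub_round t]
  exact four_mul_abs_le_norm_cis_sub_one (abs_sub_round t)

theorem exists_cis_eq {z : ℂ} (hz : ‖z‖ = 1) : ∃ t : ℝ, cis t = z := by
  refine ⟨z.arg / (2 * Real.pi), ?_⟩
  have h := Complex.norm_mul_exp_arg_mul_I z
  rw [hz, Complex.ofReal_one, one_mul] at h
  rw [cis]
  conv_rhs => rw [← h]
  congr 1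
  push_cast
  have : (Real.pi : ℂ) ≠ 0 := by exact_mod_cast Real.pi_ne_zero
  field_simp

theorem norm_pow_sub_pow_le_of_norm_one {u v : ℂ} (hu : ‖u‖ = 1) (hv : ‖v‖ = 1) (k : ℕ) :
    ‖u ^ k - v ^ k‖ ≤ k * ‖u - v‖ := by
  induction k with
  | zero => simp
  | succ k ih =>
    have e : u ^ (k + 1) - v ^ (k + 1) = (u ^ k - v ^ k) * u + v ^ k * (u - v) := by ring
    rw [e]
    refine (norm_add_le _ _).trans ?_
    rw [norm_mul, norm_mul, norm_pow, hu, hv, one_pow, mul_one, one_mul]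
    push_cast
    linarith

/-! ### Counting points of arithmetic progressions close to integers -/

theorem card_Icc_ceil_floor_le {a b : ℝ} (h : a ≤ b + 1) :
    ((Finset.Icc ⌈a⌉ ⌊b⌋).card : ℝ) ≤ b - a + 1 := by
  rw [Int.card_Icc]
  rcases le_total (⌊b⌋ + 1 - ⌈a⌉) 0 with h0 | h0
  · rw [Int.toNat_of_nonpos h0]
    push_cast
    linarith
  · have : (((⌊b⌋ + 1 - ⌈a⌉).toNat : ℤ) : ℝ) = ((⌊b⌋ + 1 - ⌈a⌉ : ℤ) : ℝ) := by
      rw [Int.toNat_of_nonneg h0]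
    rw [Int.cast_natCast] at this
    rw [this]
    push_cast
    have h1 := Int.floor_le b
    have h2 := Int.le_ceil a
    linarith

theorem card_le_of_forall_mem_Icc (S : Finset ℕ) {a b : ℝ} (h : a ≤ b + 1)
    (hS : ∀ n ∈ S, a ≤ n ∧ (n : ℝ) ≤ b) : (S.card : ℝ) ≤ b - a + 1 := by
  refine le_trans ?_ (card_Icc_ceil_floor_le h)
  have : S.card = (S.image (fun n : ℕ => (n : ℤ))).card :=
    (Finset.card_image_of_injective _ Nat.cast_injective).symm
  rw [this]
  refine Nat.cast_le.2 (Finset.card_le_card fun k hk => ?_)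
  obtain ⟨n, hn, rfl⟩ := Finset.mem_image.1 hk
  rw [Finset.mem_Icc]
  exact ⟨Int.ceil_le.2 (by exact_mod_cast (hS n hn).1), Int.le_floor.2 (by exact_mod_cast (hS n hn).2)⟩

/-- In an arithmetic progression of `J` terms with step `s`, running over a range of length `s J`,
only few terms are within `w` of an integer. -/
theorem card_near_int_le (J : ℕ) (α : ℝ) {s w : ℝ} (hs : 0 < s) (hsw : s ≤ w) (hw : w ≤ 1 / 2)
    (S : Finset ℕ) (hS : ∀ n ∈ S, n < J ∧ ∃ z : ℤ, |α + s * n - z| ≤ w) :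
    (S.card : ℝ) ≤ 3 * w * (s * J + 2) / s := by
  classical
  have hw0 : 0 < w := hs.trans_le hsw
  set Z := Finset.Icc ⌈α - w⌉ ⌊α + s * J + w⌋ with hZ
  have hsub : S ⊆ Z.biUnion fun z => S.filter fun n => |α + s * n - z| ≤ w := by
    intro n hn
    obtain ⟨hnJ, z, hz⟩ := hS n hn
    rw [Finset.mem_biUnion]
    have hn0 : (0 : ℝ) ≤ s * n := by positivity
    have hnJ' : s * n ≤ s * J := mul_le_mul_of_nonneg_left (by exact_mod_cast hnJ.le) hs.le
    have h1 := abs_le.1 hz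
    refine ⟨z, Finset.mem_Icc.2 ⟨Int.ceil_le.2 (by linarith), Int.le_floor.2 (by linarith)⟩,
      Finset.mem_filter.2 ⟨hn, hz⟩⟩
  have h1 : (S.card : ℝ) ≤ ∑ z ∈ Z, ((S.filter fun n : ℕ => |α + s * n - z| ≤ w).card : ℝ) := by
    exact_mod_cast (Finset.card_le_card hsub).trans Finset.card_biUnion_le
  have h2 : ∀ z ∈ Z, ((S.filter fun n : ℕ => |α + s * n - z| ≤ w).card : ℝ) ≤ 3 * w / s := by
    intro z _
    have h3 := card_le_of_forall_mem_Icc (S.filter fun n : ℕ => |α + s * n - z| ≤ w)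
      (a := (z - α - w) / s) (b := (z - α + w) / s) (by
        have : (z - α - w) / s ≤ (z - α + w) / s := div_le_div_of_nonneg_right (by linarith) hs.le
        linarith) (by
        intro n hn
        have h := abs_le.1 (Finset.mem_filter.1 hn).2
        rw [div_le_iff₀ hs, le_div_iff₀ hs]
        constructor <;> linarith)
    refine h3.trans ?_
    have : (z - α + w) / s - (z - α - w) / s + 1 = (2 * w + s) / s := by
      field_simp
      ring
    rw [this]
    exact div_le_div_of_nonneg_right (by linarith) hs.le
  have h3 : (Z.card : ℝ) ≤ s * J + 2 := by
    have hJ : (0 : ℝ) ≤ s * J := by positivity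
    refine (card_Icc_ceil_floor_le (by linarith)).trans ?_
    linarith
  calc (S.card : ℝ) ≤ _ := h1
    _ ≤ Z.card * (3 * w / s) := by
        rw [← nsmul_eq_mul]; exact Finset.sum_le_card_nsmul _ _ _ h2
    _ ≤ (s * J + 2) * (3 * w / s) := mul_le_mul_of_nonneg_right h3 (by positivity)
    _ = _ := by ring

/-- If a property of a point of a product space has proportion at most `β` on every line in
direction `i`, then it has proportion at most `β`. -/
theorem card_filter_le_of_fiberwise {I A : Type*} [Fintype I] [DecidableEq I] [Fintype A]
    (i : I) (p : (I → A) → Prop) [DecidablePred p] {β : ℝ}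
    (H : ∀ ω : I → A, ((Finset.univ.filter fun a => p (Function.update ω i a)).card : ℝ)
      ≤ β * Fintype.card A) :
    ((Finset.univ.filter p).card : ℝ) ≤ β * Fintype.card (I → A) := by
  rcases isEmpty_or_nonempty (I → A) with hE | ⟨⟨ω₀⟩⟩
  · simp
  have hA : 0 < (Fintype.card A : ℝ) := by
    have : Nonempty A := ⟨ω₀ i⟩
    exact_mod_cast Fintype.card_pos
  let f : (I → A) → ℝ := fun ω => if p ω then 1 else 0
  have hinv : Function.Involutive fun q : (I → A) × A => (Function.update q.1 i q.2, q.1 i) := by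
    rintro ⟨ω, a⟩
    simp
  have h1 : ∑ q : (I → A) × A, f (Function.update q.1 i q.2) = ∑ q : (I → A) × A, f q.1 :=
    Equiv.sum_comp hinv.toPerm fun q => f q.1
  rw [Fintype.sum_prod_type, Fintype.sum_prod_type] at h1
  have h2 : ∑ ω : I → A, ∑ a : A, f (Function.update ω i a)
      ≤ ∑ _ω : I → A, β * Fintype.card A := by
    refine Finset.sum_le_sum fun ω _ => ?_
    refine le_trans (le_of_eq ?_) (H ω)
    simp only [f]
    rw [Finset.sum_boole]
  have h3 : ∑ ω : I → A, ∑ _a : A, f ω = Fintype.card A * ((Finset.univ.filter p).card : ℝ) := by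
    simp only [Finset.sum_const, Finset.card_univ, nsmul_eq_mul, ← Finset.mul_sum, f]
    rw [Finset.sum_boole]
  rw [h1, h3, Finset.sum_const, Finset.card_univ, nsmul_eq_mul] at h2
  refine le_of_mul_le_mul_left ?_ hA
  linarith

/-! ### Random walks that hit prescribed phases -/

/-- One correction of the walk. The frequency `ν` gets the phase `l`; of the two candidates at
distance `1 / ν` at least one keeps the phase of `m` away from `l`, unless `m / ν` is close to an
integer. -/
theorem exists_phase_step {ν : ℝ} (hν : 0 < ν) (l m w t : ℝ) :
    ∃ f : ℝ, 0 ≤ f ∧ f ≤ 2 / ν ∧ cis (ν * (t + f)) = cis l ∧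
      (2 * w ≤ ‖cis (m / ν) - 1‖ → w ≤ ‖cis (m * (t + f)) - cis l‖) := by
  set f₀ := Int.fract (l - ν * t) / ν with hf₀
  have h0 : 0 ≤ f₀ := div_nonneg (Int.fract_nonneg _) hν.le
  have h1 : f₀ ≤ 1 / ν := div_le_div_of_nonneg_right (Int.fract_lt_one _).le hν.le
  have hpos : 0 ≤ 1 / ν := by positivity
  have hc0 : cis (ν * (t + f₀)) = cis l := by
    have e : ν * (t + f₀) = l - (⌊l - ν * t⌋ : ℤ) := by
      rw [hf₀, mul_add, mul_div_cancel₀ _ hν.ne', Int.fract]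
      ring
    rw [e, cis_sub, ← Int.cast_neg, cis_intCast, mul_one]
  have hc1 : cis (ν * (t + (f₀ + 1 / ν))) = cis l := by
    have e : ν * (t + (f₀ + 1 / ν)) = ν * (t + f₀) + ((1 : ℤ) : ℝ) := by
      field_simp
      push_cast
      ring
    rw [e, cis_add, cis_intCast, mul_one, hc0]
  have h2 : (2 : ℝ) / ν = 1 / ν + 1 / ν := by ring
  by_cases hw : w ≤ ‖cis (m * (t + f₀)) - cis l‖
  · exact ⟨f₀, h0, by linarith, hc0, fun _ => hw⟩
  · refine ⟨f₀ + 1 / ν, by linarith, by linarith, hc1, fun h => ?_⟩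
    have e : m * (t + (f₀ + 1 / ν)) = m / ν + m * (t + f₀) := by
      field_simp
      ring
    rw [e, cis_add]
    push Not at hw
    have e2 : cis (m / ν) * cis (m * (t + f₀)) - cis l = (cis (m / ν) - 1) * cis (m * (t + f₀))
        + (cis (m * (t + f₀)) - cis l) := by ring
    rw [e2]
    have h3 := norm_sub_le_norm_add ((cis (m / ν) - 1) * cis (m * (t + f₀)))
      (cis (m * (t + f₀)) - cis l)
    rw [norm_mul, norm_cis, mul_one] at h3
    linarith

/-- The walk that starts at `0`, with forced steps `f i`, depending on the current position, and free steps `ω i`. -/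
noncomputable def phaseWalk (f : ℕ → ℝ → ℝ) (ω : ℕ → ℝ) : ℕ → ℝ
  | 0 => 0
  | i + 1 => phaseWalk f ω i + f i (phaseWalk f ω i) + ω i

theorem phaseWalk_congr (f : ℕ → ℝ → ℝ) {ω ω' : ℕ → ℝ} {i : ℕ} (h : ∀ j < i, ω j = ω' j) :
    phaseWalk f ω i = phaseWalk f ω' i := by
  induction i with
  | zero => rfl
  | succ i ih =>
    rw [phaseWalk, phaseWalk, ih fun j hj => h j (by omega), h i (by omega)]

/-- The steps decrease geometrically, so the walk stays within `6 / ν i` after time `i`. -/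
theorem phaseWalk_tail {f : ℕ → ℝ → ℝ} {ω ν : ℕ → ℝ} (hν : ∀ i, 0 < ν i)
    (hν2 : ∀ i, 2 * ν i ≤ ν (i + 1)) (hf0 : ∀ i t, 0 ≤ f i t) (hf : ∀ i t, f i t ≤ 2 / ν i)
    (hω0 : ∀ i, 0 ≤ ω i) (hω : ∀ i, ω i ≤ 1 / ν i) {i s : ℕ} (his : i ≤ s) :
    phaseWalk f ω i ≤ phaseWalk f ω s ∧ phaseWalk f ω s ≤ phaseWalk f ω i + 6 / ν i := by
  suffices H : phaseWalk f ω i ≤ phaseWalk f ω s ∧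
      phaseWalk f ω s ≤ phaseWalk f ω i + 6 / ν i - 6 / ν s by
    have : 0 < 6 / ν s := div_pos (by norm_num) (hν s)
    exact ⟨H.1, by linarith [H.2]⟩
  induction s, his using Nat.le_induction with
  | base => constructor <;> linarith
  | succ s _ ih =>
    rw [phaseWalk]
    have h1 := hf0 s (phaseWalk f ω s)
    have h2 := hf s (phaseWalk f ω s)
    have h3 := hω0 s
    have h4 := hω s
    have h5 : 6 / ν (s + 1) ≤ 3 / ν s := by
      rw [div_le_div_iff₀ (hν _) (hν _)]
      linarith [hν2 s]
    have h6 : 6 / ν s = 3 / ν s + (2 / ν s + 1 / ν s) := by ring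
    constructor <;> linarith [ih.1, ih.2]

/-- The scales of the construction: precision `η` of the prescribed phase, separation `w` achieved
by the forced choices, distance `c` from the prescribed phase below which a target frequency counts
as bad, largest ratio `X` of comparable frequencies, prescribed phase `l` and lacunarity `Q`. -/
structure SeparationScales (Q η w c X l : ℝ) : Prop where
  η_pos : 0 < η
  η_le : η ≤ 1
  w_pos : 0 < w
  w_le : w ≤ 1 / 8
  c_pos : 0 < c
  c_le : 2 * c ≤ w
  one_le_X : 1 ≤ X
  X_le : 8 * Real.pi * η * X ≤ w
  l_ge : w ≤ 2 * l
  l_le : 4 * X * l ≤ 1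
  Q_ge : 6 ≤ η * Q
  Q_gt_window : 2 < Q * (w * η)
  Q_gt : 4 * X < Q * w

theorem SeparationScales.two_le_Q {Q η w c X l : ℝ} (S : SeparationScales Q η w c X l) :
    2 ≤ Q := by
  have h1 := S.one_le_X
  have h2 := S.Q_gt
  have h3 := S.w_le
  have h4 := S.w_pos
  nlinarith

/-- How a frequency `m` is related to the frequencies `ν i`, `i < s`, whose phases are prescribed:
it is controlled by a forced choice at some `ν i`; or it is a multiple of some `ν i`; or it differs
from a multiple (possibly `0`) of some `ν j` by a frequency `e` in the gap between `ν i` and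
`ν (i + 1)`, where the walk has a free step. The number `tgt i` is the frequency in whose favour the forced
choice at `ν i` is made. -/
def IsAvoidable (η w X : ℝ) (ν tgt : ℕ → ℝ) (s : ℕ) (m : ℝ) : Prop :=
  (∃ i < s, tgt i = m ∧ 2 * w ≤ ‖cis (m / ν i) - 1‖ ∧ m ≤ X * ν i) ∨
  (∃ i < s, ∃ a : ℕ, m = a * ν i ∧ 2 ≤ a ∧ (a : ℝ) ≤ 2 * X) ∨
  (∃ i < s, ∃ j < s, ∃ a : ℕ, ∃ σ e : ℝ, (σ = 1 ∨ σ = -1) ∧ m = a * ν j + σ * e ∧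
    (a : ℝ) ≤ 2 * X ∧ 0 < e ∧ e ≤ m ∧ e ≤ w / 2 * ν (i + 1) ∧
    ((a = 0 ∧ X * ν i ≤ e) ∨ ν i ≤ e * η))

/-- A finite probability space of phases `τ` such that all `ν i`, `i < s`, have phase close to `l`,
whereas each avoidable frequency of `D` has it with small probability only. -/
theorem exists_phases {Q η w c X l : ℝ} (S : SeparationScales Q η w c X l) {ν : ℕ → ℝ}
    (hν0 : 1 ≤ Q * ν 0) (hνQ : ∀ i, Q * ν i ≤ ν (i + 1)) (tgt : ℕ → ℝ) (s : ℕ) (D : Finset ℕ)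
    (hD : ∀ m ∈ D, IsAvoidable η w X ν tgt s m) :
    ∃ (Ω : Type) (_ : Fintype Ω) (_ : Nonempty Ω) (τ : Ω → ℝ),
      (∀ ω, ∀ i < s, ‖cis (ν i * τ ω) - cis l‖ ≤ 4 * Real.pi * η) ∧
      ∀ m ∈ D, (Nat.card {ω // ‖cis (m * τ ω) - cis l‖ < c} : ℝ)
        ≤ (36 * (c + w) + 2 * c / (X * η) + 36 / (η * Q)) * Nat.card Ω := by
  classical
  have hη := S.η_pos
  have hw := S.w_pos
  have hc := S.c_pos
  have hX := S.one_le_X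
  have hXw := S.X_le
  have hQ2 := S.two_le_Q
  have hQ0 : 0 < Q := by linarith
  have hpi := Real.pi_pos
  have hνpos : ∀ i, 0 < ν i := by
    intro i
    induction i with
    | zero => exact pos_of_mul_pos_right (by linarith : 0 < Q * ν 0) hQ0.le
    | succ i ih => exact (mul_pos hQ0 ih).trans_le (hνQ i)
  have hν2 : ∀ i, 2 * ν i ≤ ν (i + 1) := fun i =>
    (mul_le_mul_of_nonneg_right hQ2 (hνpos i).le).trans (hνQ i)
  have hν1 : ∀ i, 1 ≤ Q * ν i := by
    intro i
    induction i with
    | zero => exact hν0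
    | succ i ih => exact ih.trans (mul_le_mul_of_nonneg_left (by linarith [hν2 i, hνpos i]) hQ0.le)
  choose f hf0 hf2 hfl hfm using fun (i : ℕ) (t : ℝ) => exists_phase_step (hνpos i) l (tgt i) w t
  -- number of values of each free step; large, so that the step size is below the resolution `c`
  obtain ⟨J, hJ⟩ := exists_nat_gt (∑ m ∈ D, (m : ℝ) * (4 * η * Q / c))
  have hJ0 : (0 : ℝ) < J := by
    refine lt_of_le_of_lt (Finset.sum_nonneg fun m _ => ?_) hJ
    positivity
  have hJm : ∀ m ∈ D, (m : ℝ) * (4 * η * Q / c) ≤ J := fun m hm =>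
    (Finset.single_le_sum (f := fun m : ℕ => (m : ℝ) * (4 * η * Q / c))
      (fun m _ => by positivity) hm).trans hJ.le
  have hJne : Nonempty (Fin J) := ⟨⟨0, by exact_mod_cast hJ0⟩⟩
  let free : (Fin s → Fin J) → ℕ → ℝ := fun ω i =>
    if h : i < s then η / ν i * ((ω ⟨i, h⟩ : ℕ) / J) else 0
  have hfree0 : ∀ ω i, 0 ≤ free ω i := by
    intro ω i
    simp only [free]
    split_ifs
    · have := hνpos i; positivity
    · exact le_rfl
  have hfreeη : ∀ ω i, free ω i ≤ η / ν i := by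
    intro ω i
    have h1 : 0 ≤ η / ν i := div_nonneg hη.le (hνpos i).le
    simp only [free]
    split_ifs with h
    · refine mul_le_of_le_one_right h1 ?_
      rw [div_le_one hJ0]
      exact_mod_cast (ω ⟨i, h⟩).2.le
    · exact h1
  have hfree1 : ∀ ω i, free ω i ≤ 1 / ν i := fun ω i =>
    (hfreeη ω i).trans (div_le_div_of_nonneg_right S.η_le (hνpos i).le)
  set τ : (Fin s → Fin J) → ℝ := fun ω => phaseWalk f (free ω) s with hτ
  set P : (Fin s → Fin J) → ℕ → ℝ := fun ω i =>
    phaseWalk f (free ω) i + f i (phaseWalk f (free ω) i) with hP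
  have htail : ∀ ω, ∀ i < s, 0 ≤ τ ω - (P ω i + free ω i) ∧
      τ ω - (P ω i + free ω i) ≤ 6 / ν (i + 1) := by
    intro ω i hi
    have h := phaseWalk_tail hνpos hν2 hf0 hf2 (hfree0 ω) (hfree1 ω) (Nat.succ_le_of_lt hi)
    rw [phaseWalk] at h
    simp only [hτ, hP]
    constructor <;> linarith [h.1, h.2]
  have hQν : ∀ i, 6 / ν (i + 1) ≤ η / ν i := by
    intro i
    rw [div_le_div_iff₀ (hνpos _) (hνpos _)]
    calc 6 * ν i ≤ η * Q * ν i := mul_le_mul_of_nonneg_right S.Q_ge (hνpos i).le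
      _ = η * (Q * ν i) := by ring
      _ ≤ η * ν (i + 1) := mul_le_mul_of_nonneg_left (hνQ i) hη.le
  have hclose : ∀ ω, ∀ i < s, |τ ω - P ω i| ≤ 2 * η / ν i := by
    intro ω i hi
    have h1 := htail ω i hi
    have h2 := hfree0 ω i
    have h3 := hfreeη ω i
    have h4 := hQν i
    have h5 : 2 * η / ν i = η / ν i + η / ν i := by ring
    rw [abs_le]
    constructor <;> linarith [h1.1, h1.2]
  have hkill : ∀ ω, ∀ i < s, ‖cis (ν i * τ ω) - cis l‖ ≤ 4 * Real.pi * η := by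
    intro ω i hi
    rw [← hfl i (phaseWalk f (free ω) i)]
    refine (norm_cis_sub_cis_le _ _).trans ?_
    rw [← mul_sub, abs_mul, abs_of_pos (hνpos i)]
    have h := mul_le_mul_of_nonneg_left (hclose ω i hi) (hνpos i).le
    have e : ν i * (2 * η / ν i) = 2 * η := by
      have := (hνpos i).ne'
      field_simp
    rw [e] at h
    calc 2 * Real.pi * (ν i * |τ ω - P ω i|) ≤ 2 * Real.pi * (2 * η) :=
          mul_le_mul_of_nonneg_left h (by positivity)
      _ = _ := by ring
  have hβ0 : 0 ≤ (36 * (c + w) + 2 * c / (X * η) + 36 / (η * Q)) := by positivity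
  refine ⟨Fin s → Fin J, inferInstance, inferInstance, τ, hkill, fun m hm => ?_⟩
  rw [Nat.card_eq_fintype_card, Fintype.card_subtype, Nat.card_eq_fintype_card]
  have hnever : (∀ ω, c ≤ ‖cis (m * τ ω) - cis l‖) →
      ((Finset.univ.filter fun ω => ‖cis (m * τ ω) - cis l‖ < c).card : ℝ)
        ≤ (36 * (c + w) + 2 * c / (X * η) + 36 / (η * Q)) * Fintype.card (Fin s → Fin J) := by
    intro h
    have : (Finset.univ.filter fun ω => ‖cis (m * τ ω) - cis l‖ < c) = ∅ :=
      Finset.filter_eq_empty_iff.2 fun ω _ => not_lt.2 (h ω)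
    rw [this]
    simp only [Finset.card_empty, Nat.cast_zero]
    positivity
  have hapow : ∀ ω, ∀ i < s, ∀ a : ℕ, (a : ℝ) ≤ 2 * X →
      ‖cis (a * (ν i * τ ω)) - cis (a * l)‖ ≤ a * (4 * Real.pi * η) := by
    intro ω i hi a ha
    rw [cis_nat_mul, cis_nat_mul]
    exact (norm_pow_sub_pow_le_of_norm_one (norm_cis _) (norm_cis _) a).trans
      (mul_le_mul_of_nonneg_left (hkill ω i hi) (Nat.cast_nonneg a))
  rcases hD m hm with ⟨i, hi, htgt, hmw, hmX⟩ | ⟨i, hi, a, hma, ha2, haX⟩ |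
    ⟨i, hi, j, hj, a, σ, e, hσ, hme, haX, he0, hem, heν, hcase⟩
  -- the forced choice at `ν i` keeps the phase of `m` away from `l`, and later steps hardly move it
  · refine hnever fun ω => ?_
    have h1 := hfm i (phaseWalk f (free ω) i) (by rw [htgt]; exact hmw)
    rw [htgt] at h1
    have h2 : ‖cis (m * P ω i) - cis (m * τ ω)‖ ≤ w / 2 := by
      refine (norm_cis_sub_cis_le _ _).trans ?_
      rw [← mul_sub, abs_mul, abs_of_nonneg (Nat.cast_nonneg m), abs_sub_comm]
      calc 2 * Real.pi * (m * |τ ω - P ω i|)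
          ≤ 2 * Real.pi * ((X * ν i) * (2 * η / ν i)) := by
            refine mul_le_mul_of_nonneg_left ?_ (by positivity)
            exact mul_le_mul hmX (hclose ω i hi) (abs_nonneg _) ((Nat.cast_nonneg m).trans hmX)
        _ = 4 * Real.pi * η * X := by
            have := (hνpos i).ne'
            field_simp
            ring
        _ ≤ w / 2 := by linarith
    have h3 := norm_sub_le_norm_sub_add_norm_sub (cis (m * P ω i)) (cis (m * τ ω)) (cis l)
    have h4 := S.c_le
    simp only [hP] at h2 h3
    linarith
  -- `m = a ν i` has phase close to `a l`, which is away from `l`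
  · refine hnever fun ω => ?_
    have h1 := hapow ω i hi a haX
    have h2 : 2 * w ≤ ‖cis (a * l) - cis l‖ := by
      rw [norm_cis_sub_cis]
      have e : (a : ℝ) * l - l = (a - 1) * l := by ring
      rw [e]
      have ha1 : (1 : ℝ) ≤ a - 1 := by
        have : (2 : ℝ) ≤ a := by exact_mod_cast ha2
        linarith
      have hl := S.l_ge
      have hl0 : 0 < l := by linarith
      have h3 : (a - 1) * l ≤ 1 / 2 := by
        have : (a - 1) * l ≤ 2 * X * l := mul_le_mul_of_nonneg_right (by linarith) hl0.le
        linarith [S.l_le]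
      have h4 : l ≤ (a - 1) * l := le_mul_of_one_le_left hl0.le ha1
      have h5 := four_mul_abs_le_norm_cis_sub_one (t := (a - 1) * l)
        (by rw [abs_of_nonneg (by linarith)]; exact h3)
      rw [abs_of_nonneg (by linarith)] at h5
      linarith
    have h3 : a * (4 * Real.pi * η) ≤ w := by
      calc a * (4 * Real.pi * η) ≤ 2 * X * (4 * Real.pi * η) :=
            mul_le_mul_of_nonneg_right haX (by positivity)
        _ = 8 * Real.pi * η * X := by ring
        _ ≤ w := hXw
    have e : (m : ℝ) * τ ω = a * (ν i * τ ω) := by rw [hma]; ring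
    rw [e]
    have h4 := norm_sub_le_norm_sub_add_norm_sub (cis (a * l)) (cis (a * (ν i * τ ω))) (cis l)
    rw [norm_sub_rev (cis (a * l)) (cis (a * (ν i * τ ω)))] at h4
    linarith [S.c_le]
  -- the phase of `e`, hence of `m`, runs through `R` turns with the free step at `ν i`; the earlier
  -- steps are fixed, and the later ones are too small to matter
  · set R : ℝ := e * η / ν i with hR
    have hR0 : 0 < R := div_pos (mul_pos he0 hη) (hνpos i)
    set w' : ℝ := c / 4 + a * (Real.pi * η) + 6 * e / ν (i + 1) with hw'
    have he6 : 6 * e / ν (i + 1) ≤ 3 * w := by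
      rw [div_le_iff₀ (hνpos _)]
      linarith
    have he60 : 0 ≤ 6 * e / ν (i + 1) := div_nonneg (by linarith) (hνpos _).le
    have haη : a * (Real.pi * η) ≤ w / 4 := by
      have : a * (Real.pi * η) ≤ 2 * X * (Real.pi * η) :=
        mul_le_mul_of_nonneg_right haX (by positivity)
      linarith
    have haη0 : 0 ≤ a * (Real.pi * η) := by positivity
    have hw'le : w' ≤ 1 / 2 := by
      have := S.w_le
      have := S.c_le
      rw [hw']
      linarith
    have hstep : R / J ≤ w' := by
      have h1 : R ≤ c / 4 * J := by
        have h2 : R ≤ m * (η * Q) := by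
          rw [hR, div_le_iff₀ (hνpos i)]
          calc e * η ≤ m * η := mul_le_mul_of_nonneg_right hem hη.le
            _ = m * η * 1 := (mul_one _).symm
            _ ≤ m * η * (Q * ν i) := mul_le_mul_of_nonneg_left (hν1 i) (by positivity)
            _ = _ := by ring
        have h3 := mul_le_mul_of_nonneg_left (hJm m hm) (by positivity : 0 ≤ c / 4)
        have e3 : c / 4 * (m * (4 * η * Q / c)) = m * (η * Q) := by
          have := hc.ne'
          field_simp
        linarith
      rw [div_le_iff₀ hJ0]
      refine h1.trans (mul_le_mul_of_nonneg_right ?_ hJ0.le)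
      rw [hw']
      linarith
    have hbound : 3 * w' * (1 + 2 / R) ≤ 36 * (c + w) + 2 * c / (X * η) + 36 / (η * Q) := by
      have p1 : 0 ≤ 2 * c / (X * η) := by positivity
      have p2 : 0 ≤ 36 / (η * Q) := by positivity
      rcases hcase with ⟨ha0, hXe⟩ | hRe
      · have hRX : X * η ≤ R := by
          rw [hR, le_div_iff₀ (hνpos i)]
          nlinarith
        have h1 : w' = c / 4 + 6 * e / ν (i + 1) := by rw [hw', ha0]; simp
        have h2 : c / R ≤ c / (X * η) := div_le_div_of_nonneg_left hc.le (by positivity) hRX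
        have h3 : 6 * e / ν (i + 1) / R ≤ 6 / (η * Q) := by
          have e3 : 6 * e / ν (i + 1) / R = 6 * ν i / (η * ν (i + 1)) := by
            rw [hR]
            have := (hνpos i).ne'
            have := (hνpos (i + 1)).ne'
            field_simp
          rw [e3, div_le_div_iff₀ (mul_pos hη (hνpos _)) (mul_pos hη hQ0)]
          have := mul_le_mul_of_nonneg_left (hνQ i) hη.le
          nlinarith
        have e4 : 3 * w' * (1 + 2 / R) = 3 * (c / 4) + 3 * (6 * e / ν (i + 1)) + 3 / 2 * (c / R)
            + 6 * (6 * e / ν (i + 1) / R) := by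
          rw [h1]
          field_simp
          ring
        have e5 : 2 * c / (X * η) = 2 * (c / (X * η)) := by ring
        have e6 : 36 / (η * Q) = 6 * (6 / (η * Q)) := by ring
        have p3 : 0 ≤ c / (X * η) := by positivity
        rw [e4, e5, e6]
        linarith
      · have hR1 : 1 ≤ R := by
          rw [hR, le_div_iff₀ (hνpos i), one_mul]
          exact hRe
        have h1 : 2 / R ≤ 2 := div_le_self (by norm_num) hR1
        have hw0 : 0 ≤ w' := by rw [hw']; positivity
        calc 3 * w' * (1 + 2 / R) ≤ 3 * w' * 3 :=
              mul_le_mul_of_nonneg_left (by linarith) (by linarith)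
          _ ≤ _ := by rw [hw']; linarith
    refine card_filter_le_of_fiberwise (⟨i, hi⟩ : Fin s) _ fun ω => ?_
    rw [Fintype.card_fin]
    set α : ℝ := e * P ω i + σ * ((a - 1) * l) with hα
    have hPu : ∀ k : Fin J, P (Function.update ω ⟨i, hi⟩ k) i = P ω i := by
      intro k
      have : phaseWalk f (free (Function.update ω ⟨i, hi⟩ k)) i = phaseWalk f (free ω) i := by
        refine phaseWalk_congr f fun j hj => ?_
        simp only [free]
        split_ifs with h
        · rw [Function.update_of_ne]
          intro h'
          exact hj.ne (congrArg Fin.val h')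
        · rfl
      simp only [hP, this]
    have hfu : ∀ k : Fin J, free (Function.update ω ⟨i, hi⟩ k) i = η / ν i * ((k : ℕ) / J) := by
      intro k
      simp [free, hi]
    set Bad : Finset (Fin J) := Finset.univ.filter fun k =>
      ‖cis (m * τ (Function.update ω ⟨i, hi⟩ k)) - cis l‖ < c with hBad
    have hcard := card_near_int_le J α (s := R / J) (w := w') (div_pos hR0 hJ0) hstep hw'le
      (Bad.map Fin.valEmbedding) (by
        intro n hn
        obtain ⟨k, hk, rfl⟩ := Finset.mem_map.1 hn
        refine ⟨k.2, ?_⟩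
        have hk' := (Finset.mem_filter.1 hk).2
        set ω' := Function.update ω ⟨i, hi⟩ k with hω'
        have h1 := hapow ω' j hj a haX
        have e1 : (m : ℝ) * τ ω' = a * (ν j * τ ω') + σ * (e * τ ω') := by rw [hme]; ring
        have h2 : ‖cis (a * l + σ * (e * τ ω')) - cis l‖ ≤ c + a * (4 * Real.pi * η) := by
          have h3 := norm_sub_le_norm_sub_add_norm_sub (cis (a * l + σ * (e * τ ω')))
            (cis (m * τ ω')) (cis l)
          have h4 : ‖cis (a * l + σ * (e * τ ω')) - cis (m * τ ω')‖ ≤ a * (4 * Real.pi * η) := by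
            rw [e1, cis_add, cis_add, ← sub_mul, norm_mul, norm_cis, mul_one, norm_sub_rev]
            exact h1
          linarith
        rw [norm_cis_sub_cis] at h2
        have h5 := (four_mul_abs_sub_round_le _).trans h2
        set z := round (a * l + σ * (e * τ ω') - l) with hz
        have h6 : |e * τ ω' + σ * ((a - 1) * l) - σ * z| ≤ c / 4 + a * (Real.pi * η) := by
          have e6 : |e * τ ω' + σ * ((a - 1) * l) - σ * z| = |a * l + σ * (e * τ ω') - l - z| := by
            rcases hσ with rfl | rfl
            · congr 1; ring
            · rw [← abs_neg]; congr 1; ring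
          rw [e6]
          linarith
        have h7 := htail ω' i hi
        rw [hPu k, hfu k] at h7
        have h8 : |α + R / J * (k : ℕ) - e * τ ω' - σ * ((a - 1) * l)| ≤ 6 * e / ν (i + 1) := by
          have e8 : α + R / J * (k : ℕ) - e * τ ω' - σ * ((a - 1) * l)
              = -(e * (τ ω' - (P ω i + η / ν i * ((k : ℕ) / J)))) := by
            rw [hα, hR]
            ring
          rw [e8, abs_neg, abs_of_nonneg (mul_nonneg he0.le h7.1)]
          calc _ ≤ e * (6 / ν (i + 1)) := mul_le_mul_of_nonneg_left h7.2 he0.le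
            _ = _ := by ring
        have h9 : ∃ z' : ℤ, (z' : ℝ) = σ * z := by
          rcases hσ with rfl | rfl
          · exact ⟨z, by simp⟩
          · exact ⟨-z, by push_cast; ring⟩
        obtain ⟨z', hz'⟩ := h9
        refine ⟨z', ?_⟩
        rw [hz', hw']
        have e10 : α + R / J * (k : ℕ) - σ * z
            = (α + R / J * (k : ℕ) - e * τ ω' - σ * ((a - 1) * l))
              + (e * τ ω' + σ * ((a - 1) * l) - σ * z) := by ring
        have h11 := abs_add_le (α + R / J * (k : ℕ) - e * τ ω' - σ * ((a - 1) * l))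
          (e * τ ω' + σ * ((a - 1) * l) - σ * z)
        rw [← e10] at h11
        simp only [Fin.valEmbedding_apply]
        linarith)
    rw [Finset.card_map] at hcard
    refine hcard.trans ?_
    have e12 : 3 * w' * (R / J * J + 2) / (R / J) = 3 * w' * (1 + 2 / R) * J := by
      field_simp
    rw [e12]
    exact mul_le_mul_of_nonneg_right hbound hJ0.le

/-! ### Separating two lacunary sets by phases -/

/-- Any two elements of `F` have ratio at least `Q`. -/
def IsSeparated (Q : ℝ) (F : Finset ℕ) : Prop := ∀ a ∈ F, ∀ b ∈ F, a < b → Q * a ≤ b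

theorem IsSeparated.mono {Q : ℝ} {F F' : Finset ℕ} (h : IsSeparated Q F) (hF : F' ⊆ F) :
    IsSeparated Q F' := fun a ha b hb => h a (hF ha) b (hF hb)

/-- A decreasing partial function on `ℕ` defines a forest, which is two-colourable. -/
theorem exists_two_colouring {r : ℕ → ℕ → Prop} (hlt : ∀ a b, r a b → b < a)
    (hfun : ∀ a b c, r a b → r a c → b = c) (n : ℕ) :
    ∃ col : ℕ → Bool, ∀ a < n, ∀ b, r a b → col a ≠ col b := by
  induction n with
  | zero => exact ⟨fun _ => false, fun a ha => absurd ha (Nat.not_lt_zero a)⟩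
  | succ n ih =>
    obtain ⟨col, hcol⟩ := ih
    by_cases h : ∃ b, r n b
    · obtain ⟨b, hb⟩ := h
      refine ⟨Function.update col n (!col b), fun a ha b' hb' => ?_⟩
      rcases Nat.lt_succ_iff_lt_or_eq.1 ha with ha | rfl
      · have := hlt a b' hb'
        rw [Function.update_of_ne (by omega), Function.update_of_ne (by omega)]
        exact hcol a ha b' hb'
      · have := hlt a b' hb'
        rw [hfun a b' b hb' hb] at this ⊢
        rw [Function.update_self, Function.update_of_ne (by omega)]
        simp
    · refine ⟨col, fun a ha b hb => ?_⟩
      rcases Nat.lt_succ_iff_lt_or_eq.1 ha with ha | rfl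
      · exact hcol a ha b hb
      · exact absurd ⟨b, hb⟩ h

/-- A finite separated set extends to an infinite separated sequence of real numbers with given
first term, all of whose additional terms are large. -/
theorem exists_separated_sequence {Q : ℝ} (hQ : 1 ≤ Q) (L : ℝ) (n : ℕ) :
    ∀ (F : Finset ℕ), F.card = n → IsSeparated Q F → ∀ ν₀ : ℝ, 0 < ν₀ → (∀ f ∈ F, Q * ν₀ ≤ f) →
    ∃ ν : ℕ → ℝ, ν 0 = ν₀ ∧ (∀ i, Q * ν i ≤ ν (i + 1)) ∧ (∀ f ∈ F, ∃ i, ν i = f) ∧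
      ∀ i, (∃ f ∈ F, ν (i + 1) = f) ∨ L ≤ ν (i + 1) := by
  induction n with
  | zero =>
    intro F hF _ ν₀ hν₀ _
    rw [Finset.card_eq_zero] at hF
    subst hF
    have hm : 0 ≤ max L (Q * ν₀) := le_max_of_le_right (by positivity)
    refine ⟨fun i => Nat.casesOn i ν₀ fun i => max L (Q * ν₀) * Q ^ i, rfl, fun i => ?_,
      by simp, fun i => Or.inr ?_⟩
    · cases i with
      | zero => simp
      | succ i => exact le_of_eq (by simp only [pow_succ]; ring)
    · exact (le_max_left _ _).trans (le_mul_of_one_le_right hm (one_le_pow₀ hQ))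
  | succ n ih =>
    intro F hF hsep ν₀ hν₀ hle
    have hne : F.Nonempty := Finset.card_pos.1 (by omega)
    set f₀ := F.min' hne with hf₀
    have hf₀F : f₀ ∈ F := F.min'_mem hne
    have hf₀pos : (0 : ℝ) < f₀ := by
      have h1 := hle f₀ hf₀F
      have h2 : 0 < Q * ν₀ := by positivity
      linarith
    obtain ⟨ν, h0, hstep, hcov, hlarge⟩ := ih (F.erase f₀)
      (by rw [Finset.card_erase_of_mem hf₀F, hF]; rfl)
      (hsep.mono (Finset.erase_subset _ _)) f₀ hf₀pos (fun f hf => by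
        rw [Finset.mem_erase] at hf
        exact hsep f₀ hf₀F f hf.2 (lt_of_le_of_ne (F.min'_le f hf.2) (Ne.symm hf.1)))
    refine ⟨fun i => Nat.casesOn i ν₀ ν, rfl, fun i => ?_, fun f hf => ?_, fun i => ?_⟩
    · cases i with
      | zero => simpa [h0] using hle f₀ hf₀F
      | succ i => exact hstep i
    · by_cases h : f = f₀
      · exact ⟨1, by simp [h0, h]⟩
      · obtain ⟨i, hi⟩ := hcov f (Finset.mem_erase.2 ⟨h, hf⟩)
        exact ⟨i + 1, hi⟩
    · cases i with
      | zero => exact Or.inl ⟨f₀, hf₀F, h0⟩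
      | succ i =>
        rcases hlarge i with ⟨f, hf, h⟩ | h
        · exact Or.inl ⟨f, (Finset.mem_erase.1 hf).2, h⟩
        · exact Or.inr h

/-- The phase of `m` is determined by that of `f`, up to the phase of the small frequency
`|m - a f|`, and this is comparable with the element `f'` of `F`. -/
def IsParent (η w X : ℝ) (F D : Finset ℕ) (f f' : ℕ) : Prop :=
  f ∈ F ∧ f' ∈ F ∧ ∃ m ∈ D, ∃ a : ℕ, 1 ≤ a ∧ (m : ℝ) ≤ X * f ∧
    |(m : ℝ) - a * f| < w / 2 * f ∧ w / 2 * f' ≤ |(m : ℝ) - a * f| ∧ |(m : ℝ) - a * f| * η ≤ f'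

theorem IsParent.lt {η w X : ℝ} (hw : 0 < w) {F D : Finset ℕ} {f f' : ℕ}
    (h : IsParent η w X F D f f') : f' < f := by
  obtain ⟨-, -, m, -, a, -, -, h1, h2, -⟩ := h
  have h3 : w / 2 * f' < w / 2 * f := h2.trans_lt h1
  exact_mod_cast lt_of_mul_lt_mul_left h3 (by positivity)

/-- By lacunarity of `D` only one `m` is comparable with `f`, and only one `f'` is comparable with
`|m - a f|`. -/
theorem IsParent.unique {Q η w c X l : ℝ} (S : SeparationScales Q η w c X l) {F D : Finset ℕ}
    (hFpos : ∀ f ∈ F, 0 < f) (hF : IsSeparated Q F) (hD : IsSeparated Q D) {f f₁ f₂ : ℕ}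
    (h₁ : IsParent η w X F D f f₁) (h₂ : IsParent η w X F D f f₂) : f₁ = f₂ := by
  have hη := S.η_pos
  have hw := S.w_pos
  have hw8 := S.w_le
  have hX := S.one_le_X
  have hQX := S.Q_gt
  have hQ2 := S.two_le_Q
  obtain ⟨hf, hf₁, m₁, hm₁, a₁, ha₁, hX₁, hd₁, hl₁, hu₁⟩ := h₁
  obtain ⟨-, hf₂, m₂, hm₂, a₂, ha₂, hX₂, hd₂, hl₂, hu₂⟩ := h₂
  have hfpos : (0 : ℝ) < f := by exact_mod_cast hFpos f hf
  have hhalf : ∀ (m a : ℕ), 1 ≤ a → |(m : ℝ) - a * f| < w / 2 * f → (f : ℝ) / 2 ≤ m := by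
    intro m a ha hd
    have h1 : (1 : ℝ) * f ≤ a * f := mul_le_mul_of_nonneg_right (by exact_mod_cast ha) hfpos.le
    have h2 := (abs_lt.1 hd).1
    nlinarith
  have hmle : ∀ m m' : ℕ, m ∈ D → m' ∈ D → (f : ℝ) / 2 ≤ m → (m' : ℝ) ≤ X * f → m' ≤ m := by
    intro m m' hm hm' h1 h2
    by_contra! hlt
    have h3 := hD m hm m' hm' hlt
    have hm0 : (0 : ℝ) < m := by linarith
    have h4 : Q * m ≤ 2 * X * m := by nlinarith
    have h5 := le_of_mul_le_mul_right h4 hm0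
    nlinarith
  have hmeq : m₁ = m₂ := le_antisymm (hmle m₂ m₁ hm₂ hm₁ (hhalf m₂ a₂ ha₂ hd₂) hX₁)
    (hmle m₁ m₂ hm₁ hm₂ (hhalf m₁ a₁ ha₁ hd₁) hX₂)
  subst hmeq
  have haeq : a₁ = a₂ := by
    have h1 : |(a₁ : ℝ) * f - a₂ * f| < 1 * f := by
      have e : (a₁ : ℝ) * f - a₂ * f = (m₁ - a₂ * f) - (m₁ - a₁ * f) := by ring
      rw [e]
      have h2 := abs_sub ((m₁ : ℝ) - a₂ * f) (m₁ - a₁ * f)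
      nlinarith
    rw [← sub_mul, abs_mul, abs_of_pos hfpos] at h1
    have h2 := lt_of_mul_lt_mul_right h1 hfpos.le
    have h3 : |(a₁ : ℤ) - a₂| < 1 := by exact_mod_cast h2
    have h4 := Int.abs_lt_one_iff.1 h3
    omega
  subst haeq
  set d := |(m₁ : ℝ) - a₁ * f|
  have hle : ∀ g g' : ℕ, g ∈ F → g' ∈ F → d * η ≤ g → w / 2 * g' ≤ d → g' ≤ g := by
    intro g g' hg hg' h1 h2
    by_contra! hlt
    have h3 := hF g hg g' hg' hlt
    have hg0 : (0 : ℝ) < g := by exact_mod_cast hFpos g hg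
    have h4 := S.Q_gt_window
    have h5 : Q * (w * η) * g ≤ 2 * g := by
      calc Q * (w * η) * g = (w * η) * (Q * g) := by ring
        _ ≤ (w * η) * g' := mul_le_mul_of_nonneg_left h3 (by positivity)
        _ = 2 * ((w / 2 * g') * η) := by ring
        _ ≤ 2 * (d * η) := by
            have := mul_le_mul_of_nonneg_right h2 hη.le
            linarith
        _ ≤ 2 * g := by linarith
    have h6 := le_of_mul_le_mul_right h5 hg0
    linarith
  exact le_antisymm (hle f₂ f₁ hf₂ hf₁ hu₂ hl₁) (hle f₁ f₂ hf₁ hf₂ hu₁ hl₂)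

/-- All of `D` is avoidable for a set `F` without parent relations. Here `ν` enumerates `F`, after
the term `ν 0 = 1 / Q`, which makes room for a free step before the first element of `F`. The bound
`L` separates `F` and `D` from the additional terms of `ν`. -/
theorem isAvoidable_of_no_parent {Q η w c X l : ℝ} (S : SeparationScales Q η w c X l)
    {F D : Finset ℕ} (hDpos : ∀ m ∈ D, 0 < m) (hdisj : Disjoint F D)
    (hpar : ∀ f f', ¬ IsParent η w X F D f f') {ν tgt : ℕ → ℝ} {L : ℝ}
    (hLD : ∀ m ∈ D, 2 * (m : ℝ) < L) (hLF : ∀ f ∈ F, (f : ℝ) < L)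
    (hν0 : Q * ν 0 = 1) (hνQ : ∀ i, Q * ν i ≤ ν (i + 1))
    (hνF : ∀ i, (∃ f ∈ F, ν (i + 1) = f) ∨ L ≤ ν (i + 1)) {s : ℕ} (hs : L ≤ ν s)
    (htgt : ∀ i, ∀ m ∈ D, 2 * w ≤ ‖cis (m / ν i) - 1‖ → m ≤ X * ν i → tgt i = m) :
    ∀ m ∈ D, IsAvoidable η w X ν tgt (s + 1) m := by
  classical
  have hη := S.η_pos
  have hw := S.w_pos
  have hw8 := S.w_le
  have hX := S.one_le_X
  have hQX := S.Q_gt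
  have hQ2 := S.two_le_Q
  have hQ0 : 0 < Q := by linarith
  have hνpos : ∀ i, 0 < ν i := by
    intro i
    induction i with
    | zero => exact pos_of_mul_pos_right (by linarith : 0 < Q * ν 0) hQ0.le
    | succ i ih => exact (mul_pos hQ0 ih).trans_le (hνQ i)
  have hmono : StrictMono ν := strictMono_nat_of_lt_succ fun i => by
    have h1 := mul_le_mul_of_nonneg_right hQ2 (hνpos i).le
    linarith [hνQ i, hνpos i]
  intro m hm
  have hm1 : (1 : ℝ) ≤ m := by exact_mod_cast hDpos m hm
  have hex : ∃ i, (m : ℝ) ≤ X * ν i := by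
    refine ⟨s, ?_⟩
    have h1 := hLD m hm
    have h2 : 1 * ν s ≤ X * ν s := mul_le_mul_of_nonneg_right hX (hνpos s).le
    linarith
  obtain ⟨i, hi, hmin⟩ : ∃ i, (m : ℝ) ≤ X * ν i ∧ ∀ j < i, X * ν j < m :=
    ⟨Nat.find hex, Nat.find_spec hex, fun j hj => not_le.1 (Nat.find_min hex hj)⟩
  have his : i < s + 1 := by
    by_contra! h
    have h1 := hmin s (by omega)
    have h2 := hLD m hm
    have h3 : 1 * ν s ≤ X * ν s := mul_le_mul_of_nonneg_right hX (hνpos s).le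
    linarith
  have hi0 : i ≠ 0 := by
    rintro rfl
    have h1 : Q * m ≤ X := by
      calc Q * m ≤ Q * (X * ν 0) := mul_le_mul_of_nonneg_left hi hQ0.le
        _ = X * (Q * ν 0) := by ring
        _ = X := by rw [hν0, mul_one]
    nlinarith
  obtain ⟨k, rfl⟩ := Nat.exists_eq_succ_of_ne_zero hi0
  rw [Nat.succ_eq_add_one] at *
  have hνi := hνpos (k + 1)
  -- `ν (k + 1)` is the first frequency comparable with `m`
  by_cases hA : 2 * w ≤ ‖cis (m / ν (k + 1)) - 1‖
  · exact Or.inl ⟨k + 1, his, htgt _ m hm hA hi, hA, hi⟩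
  push Not at hA
  have hround := (four_mul_abs_sub_round_le (m / ν (k + 1))).trans_lt hA
  have hr0 : 0 ≤ round ((m : ℝ) / ν (k + 1)) := by
    rw [round_eq]
    exact Int.floor_nonneg.2 (by positivity)
  obtain ⟨a, ha⟩ := Int.eq_ofNat_of_zero_le hr0
  rw [ha] at hround
  rw [Int.cast_natCast] at hround
  have hd : |(m : ℝ) - a * ν (k + 1)| < w / 2 * ν (k + 1) := by
    have e : (m : ℝ) - a * ν (k + 1) = (m / ν (k + 1) - a) * ν (k + 1) := by
      field_simp
    rw [e, abs_mul, abs_of_pos hνi]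
    exact mul_lt_mul_of_pos_right (by linarith) hνi
  right
  rcases Nat.eq_zero_or_pos a with rfl | ha1
  · right
    have hd' : (m : ℝ) < w / 2 * ν (k + 1) := by
      have h := (abs_lt.1 hd).2
      simpa using h
    refine ⟨k, by omega, k, by omega, 0, 1, m, Or.inl rfl, by simp, by push_cast; linarith,
      by linarith, le_rfl, hd'.le, Or.inl ⟨rfl, (hmin k (by omega)).le⟩⟩
  have haν : ν (k + 1) ≤ a * ν (k + 1) :=
    le_mul_of_one_le_left hνi.le (by exact_mod_cast ha1)
  have hd2 := abs_lt.1 hd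
  have hmν : ν (k + 1) / 2 ≤ m := by nlinarith
  have haX : (a : ℝ) ≤ 2 * X := by
    have h1 : a * ν (k + 1) ≤ 2 * X * ν (k + 1) := by nlinarith
    exact le_of_mul_le_mul_right h1 hνi
  obtain ⟨f, hf, hνf⟩ : ∃ f ∈ F, ν (k + 1) = f := by
    rcases hνF k with h | h
    · exact h
    · have := hLD m hm
      linarith
  rw [hνf] at hd hd2 haν hmν
  by_cases hd0 : (m : ℝ) - a * f = 0
  · left
    refine ⟨k + 1, his, a, by rw [hνf]; linarith, ?_, haX⟩
    by_contra! h
    have ha' : a = 1 := by omega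
    subst ha'
    have : m = f := by
      have h2 : (m : ℝ) = f := by push_cast at hd0; linarith
      exact_mod_cast h2
    subst this
    exact Finset.disjoint_left.1 hdisj hf hm
  · right
    set e := |(m : ℝ) - a * f| with he
    have he0 : 0 < e := abs_pos.2 hd0
    have he1 : 1 ≤ e := by
      have h1 : (m : ℤ) - a * f ≠ 0 := by
        intro h
        exact hd0 (by exact_mod_cast congrArg (Int.cast : ℤ → ℝ) h)
      have h2 := Int.one_le_abs h1
      rw [he]
      exact_mod_cast h2
    -- `e` lies in the gap before the first `ν j` above `e η`: it is not comparable with `ν j`, as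
    -- there are no parents
    have hex2 : ∃ j, e * η < ν j := by
      refine ⟨k + 1, ?_⟩
      rw [hνf]
      have := S.η_le
      nlinarith
    obtain ⟨j, hj, hjmin⟩ : ∃ j, e * η < ν j ∧ ∀ j' < j, ν j' ≤ e * η :=
      ⟨Nat.find hex2, Nat.find_spec hex2, fun j hj => not_lt.1 (Nat.find_min hex2 hj)⟩
    have hj0 : j ≠ 0 := by
      rintro rfl
      have h1 : Q * (e * η) < 1 := by
        rw [← hν0]
        exact mul_lt_mul_of_pos_left hj hQ0
      have h2 := S.Q_ge
      nlinarith [mul_pos hη hQ0]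
    obtain ⟨j, rfl⟩ := Nat.exists_eq_succ_of_ne_zero hj0
    rw [Nat.succ_eq_add_one] at *
    have hjk : j < k + 1 := by
      refine hmono.lt_iff_lt.1 ((hjmin j (by omega)).trans_lt ?_)
      rw [hνf]
      have := S.η_le
      nlinarith
    have hew : e ≤ w / 2 * ν (j + 1) := by
      by_contra! h
      have hlt : ν (j + 1) < f := by
        have : w / 2 * ν (j + 1) < w / 2 * f := h.trans hd
        exact lt_of_mul_lt_mul_left this (by positivity)
      rcases hνF j with ⟨f', hf', hνf'⟩ | hbig
      · rw [hνf'] at h hj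
        rw [hνf] at hi
        exact hpar f f' ⟨hf, hf', m, hm, a, ha1, hi, hd, h.le, hj.le⟩
      · have := hLF f hf
        linarith
    obtain ⟨σ, hσ, hσe⟩ : ∃ σ : ℝ, (σ = 1 ∨ σ = -1) ∧ (m : ℝ) - a * f = σ * e := by
      rcases abs_choice ((m : ℝ) - a * f) with h | h
      · exact ⟨1, Or.inl rfl, by rw [one_mul, he, h]⟩
      · exact ⟨-1, Or.inr rfl, by rw [he, h]; ring⟩
    refine ⟨j, by omega, k + 1, his, a, σ, e, hσ, ?_, haX, he0, ?_, hew, Or.inr (hjmin j (by omega))⟩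
    · rw [hνf]
      linarith
    · have h3 : (0 : ℝ) < f := by rw [← hνf]; exact hνi
      nlinarith

/-- Two disjoint separated sets `F` and `D`: after splitting `F` into two parts, there are for each
part finitely many phases `τ` such that `F` always has phase close to `l`, while each element of
`D` has it with small probability only. -/
theorem exists_phases_of_isSeparated {Q η w c X l : ℝ} (S : SeparationScales Q η w c X l)
    {F D : Finset ℕ} (hFpos : ∀ f ∈ F, 0 < f) (hDpos : ∀ m ∈ D, 0 < m) (hF : IsSeparated Q F)
    (hD : IsSeparated Q D) (hdisj : Disjoint F D) :
    ∃ col : ℕ → Bool, ∀ b : Bool, ∃ (Ω : Type) (_ : Fintype Ω) (_ : Nonempty Ω) (τ : Ω → ℝ),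
      (∀ ω, ∀ f ∈ F, col f = b → ‖cis (f * τ ω) - cis l‖ ≤ 4 * Real.pi * η) ∧
      ∀ m ∈ D, (Nat.card {ω // ‖cis (m * τ ω) - cis l‖ < c} : ℝ)
        ≤ (36 * (c + w) + 2 * c / (X * η) + 36 / (η * Q)) * Nat.card Ω := by
  classical
  have hη := S.η_pos
  have hw := S.w_pos
  have hX := S.one_le_X
  have hQX := S.Q_gt
  have hQ2 := S.two_le_Q
  have hQ0 : 0 < Q := by linarith
  obtain ⟨col, hcol⟩ := exists_two_colouring (r := IsParent η w X F D)
    (fun a b h => h.lt hw) (fun a b c h h' => h.unique S hFpos hF hD h') (F.sup id + 1)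
  refine ⟨col, fun b => ?_⟩
  set F' := F.filter fun f => col f = b with hF'
  have hsub : F' ⊆ F := Finset.filter_subset _ _
  set L : ℝ := 2 * ∑ m ∈ D, (m : ℝ) + ∑ f ∈ F, (f : ℝ) + 1 with hL
  have hsD : 0 ≤ ∑ m ∈ D, (m : ℝ) := Finset.sum_nonneg fun m _ => Nat.cast_nonneg m
  have hsF : 0 ≤ ∑ f ∈ F, (f : ℝ) := Finset.sum_nonneg fun m _ => Nat.cast_nonneg m
  have hLD : ∀ m ∈ D, 2 * (m : ℝ) < L := fun m hm => by
    have := Finset.single_le_sum (f := fun m : ℕ => (m : ℝ)) (fun m _ => Nat.cast_nonneg m) hm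
    linarith
  have hLF : ∀ f ∈ F', (f : ℝ) < L := fun f hf => by
    have := Finset.single_le_sum (f := fun m : ℕ => (m : ℝ)) (fun m _ => Nat.cast_nonneg m)
      (hsub hf)
    linarith
  obtain ⟨ν, hν0, hνQ, hcov, hνF⟩ := exists_separated_sequence (by linarith : 1 ≤ Q) L _ F' rfl
    (hF.mono hsub) (1 / Q) (by positivity) (fun f hf => by
      rw [mul_one_div_cancel hQ0.ne']
      exact_mod_cast hFpos f (hsub hf))
  have hν0' : Q * ν 0 = 1 := by rw [hν0, mul_one_div_cancel hQ0.ne']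
  have hνpos : ∀ i, 0 < ν i := by
    intro i
    induction i with
    | zero => rw [hν0]; positivity
    | succ i ih => exact (mul_pos hQ0 ih).trans_le (hνQ i)
  have hmono : StrictMono ν := strictMono_nat_of_lt_succ fun i => by
    have h1 := mul_le_mul_of_nonneg_right hQ2 (hνpos i).le
    linarith [hνQ i, hνpos i]
  obtain ⟨s, hs⟩ : ∃ s, L ≤ ν s := by
    have hgrow : ∀ i, (2 : ℝ) ^ i * (1 / Q) ≤ ν i := by
      intro i
      induction i with
      | zero => rw [hν0]; simp
      | succ i ih =>
        have h1 := mul_le_mul_of_nonneg_right hQ2 (hνpos i).le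
        have h2 := hνQ i
        rw [pow_succ]
        linarith
    obtain ⟨s, hs⟩ := pow_unbounded_of_one_lt (L * Q) (by norm_num : (1 : ℝ) < 2)
    refine ⟨s, le_trans ?_ (hgrow s)⟩
    rw [mul_one_div, le_div_iff₀ hQ0]
    exact hs.le
  have huniq : ∀ i, ∀ m ∈ D, ∀ m' ∈ D, 2 * w ≤ ‖cis (m / ν i) - 1‖ → (m' : ℝ) ≤ X * ν i →
      m' ≤ m := by
    intro i m hm m' hm' h1 h2
    by_contra! hlt
    have h3 := hD m hm m' hm' hlt
    have h4 := h1.trans (norm_cis_sub_one_le _)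
    have hm0 : (0 : ℝ) < m := by exact_mod_cast hDpos m hm
    rw [abs_of_nonneg (div_nonneg hm0.le (hνpos i).le)] at h4
    have h5 : w * ν i ≤ 4 * m := by
      have h6 : 2 * w * ν i ≤ 2 * Real.pi * m := by
        calc 2 * w * ν i ≤ 2 * Real.pi * (m / ν i) * ν i :=
              mul_le_mul_of_nonneg_right h4 (hνpos i).le
          _ = 2 * Real.pi * m := by
              have := (hνpos i).ne'
              field_simp
      have h7 := Real.pi_le_four
      nlinarith
    have h6 : Q * w * m ≤ 4 * X * m := by
      calc Q * w * m = w * (Q * m) := by ring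
        _ ≤ w * (X * ν i) := mul_le_mul_of_nonneg_left (h3.trans h2) hw.le
        _ = X * (w * ν i) := by ring
        _ ≤ X * (4 * m) := mul_le_mul_of_nonneg_left h5 (by linarith)
        _ = _ := by ring
    have h7 := le_of_mul_le_mul_right h6 hm0
    linarith
  -- by `huniq`, at most one element of `D` competes for the forced choice at `ν i`
  let tgt : ℕ → ℝ := fun i =>
    if h : ∃ m ∈ D, 2 * w ≤ ‖cis (m / ν i) - 1‖ ∧ (m : ℝ) ≤ X * ν i then (h.choose : ℝ) else 0
  have htgt : ∀ i, ∀ m ∈ D, 2 * w ≤ ‖cis (m / ν i) - 1‖ → m ≤ X * ν i → tgt i = m := by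
    intro i m hm h1 h2
    have h : ∃ m ∈ D, 2 * w ≤ ‖cis (m / ν i) - 1‖ ∧ (m : ℝ) ≤ X * ν i := ⟨m, hm, h1, h2⟩
    have h3 := h.choose_spec
    simp only [tgt]
    rw [dif_pos h]
    exact_mod_cast le_antisymm (huniq i m hm _ h3.1 h1 h3.2.2) (huniq i _ h3.1 m hm h3.2.1 h2)
  have hpar : ∀ f f', ¬ IsParent η w X F' D f f' := by
    rintro f f' ⟨hf, hf', h⟩
    refine hcol f (Nat.lt_succ_of_le (Finset.le_sup (f := id) (hsub hf))) f'
      ⟨hsub hf, hsub hf', h⟩ ?_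
    rw [(Finset.mem_filter.1 hf).2, (Finset.mem_filter.1 hf').2]
  obtain ⟨Ω, i1, i2, τ, hk, hb⟩ := exists_phases S hν0'.ge hνQ tgt (s + 1) D
    (isAvoidable_of_no_parent S hDpos (Finset.disjoint_of_subset_left hsub hdisj) hpar hLD hLF
      hν0' hνQ hνF hs htgt)
  refine ⟨Ω, i1, i2, τ, fun ω f hf hfb => ?_, hb⟩
  have hfF' : f ∈ F' := Finset.mem_filter.2 ⟨hf, hfb⟩
  obtain ⟨i, hi⟩ := hcov f hfF'
  rw [← hi]
  refine hk ω i ?_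
  have h1 := hLF f hfF'
  rw [← hi] at h1
  exact (hmono.lt_iff_lt.1 (h1.trans_le hs)).trans (Nat.lt_succ_self s)

/-! ### Prescribing phases on a separated set -/

/-- All phases on a separated set can be prescribed simultaneously: choose the phase of the smallest
frequency first; the later corrections hardly change it. -/
theorem exists_phase_approx {Q : ℝ} (hQ : 2 ≤ Q) (p : ℕ → ℂ) (hp : ∀ m, ‖p m‖ = 1) (n : ℕ) :
    ∀ D : Finset ℕ, D.card = n → IsSeparated Q D → ∀ t R : ℝ, 0 < R → (∀ m ∈ D, R ≤ m) →
    ∃ T, t ≤ T ∧ T ≤ t + 2 / R ∧ ∀ m ∈ D, ‖cis (m * T) - p m‖ ≤ 4 * Real.pi / Q := by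
  have hQ0 : 0 < Q := by linarith
  induction n with
  | zero =>
    intro D hD _ t R hR _
    rw [Finset.card_eq_zero] at hD
    subst hD
    exact ⟨t, le_rfl, by have : 0 < 2 / R := by positivity
                         linarith, by simp⟩
  | succ n ih =>
    intro D hD hsep t R hR hle
    have hne : D.Nonempty := Finset.card_pos.1 (by omega)
    set m₀ := D.min' hne with hm₀
    have hm₀D : m₀ ∈ D := D.min'_mem hne
    have hm₀pos : (0 : ℝ) < m₀ := hR.trans_le (hle _ hm₀D)
    obtain ⟨l, hl⟩ := exists_cis_eq (hp m₀)
    set f := Int.fract (l - m₀ * t) / m₀ with hf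
    have hf0 : 0 ≤ f := div_nonneg (Int.fract_nonneg _) hm₀pos.le
    have hf1 : f ≤ 1 / m₀ := div_le_div_of_nonneg_right (Int.fract_lt_one _).le hm₀pos.le
    have hcis : cis (m₀ * (t + f)) = p m₀ := by
      have e : m₀ * (t + f) = l - (⌊l - m₀ * t⌋ : ℤ) := by
        rw [hf, mul_add, mul_div_cancel₀ _ hm₀pos.ne', Int.fract]
        ring
      rw [e, cis_sub, ← Int.cast_neg, cis_intCast, mul_one, hl]
    obtain ⟨T, hT0, hT1, hT⟩ := ih (D.erase m₀) (by rw [Finset.card_erase_of_mem hm₀D, hD]; rfl)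
      (hsep.mono (Finset.erase_subset _ _)) (t + f) (Q * m₀) (by positivity) (fun m hm => by
        rw [Finset.mem_erase] at hm
        exact hsep m₀ hm₀D m hm.2 (lt_of_le_of_ne (D.min'_le m hm.2) (Ne.symm hm.1)))
    have h1 : 2 / (Q * m₀) ≤ 1 / m₀ := by
      rw [div_le_div_iff₀ (by positivity) hm₀pos]
      nlinarith
    have h2 : 2 / (m₀ : ℝ) ≤ 2 / R := div_le_div_of_nonneg_left (by norm_num) hR (hle _ hm₀D)
    have h3 : (2 : ℝ) / m₀ = 1 / m₀ + 1 / m₀ := by ring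
    refine ⟨T, by linarith, by linarith, fun m hm => ?_⟩
    by_cases h : m = m₀
    · rw [h, ← hcis]
      refine (norm_cis_sub_cis_le _ _).trans ?_
      rw [← mul_sub, abs_mul, abs_of_pos hm₀pos, abs_of_nonneg (by linarith)]
      calc 2 * Real.pi * (m₀ * (T - (t + f))) ≤ 2 * Real.pi * (m₀ * (2 / (Q * m₀))) := by
            refine mul_le_mul_of_nonneg_left ?_ (by positivity)
            exact mul_le_mul_of_nonneg_left (by linarith) hm₀pos.le
        _ = 4 * Real.pi / Q := by
            field_simp
            ring
    · exact hT m (Finset.mem_erase.2 ⟨h, hm⟩)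

/-! ### A trigonometric polynomial with a sharp zero -/

/-- The normalised Dirichlet kernel `(1 + u + ⋯ + u ^ (L - 1)) / L` at `u = cis φ`. -/
noncomputable def dirichletMean (L : ℕ) (φ : ℝ) : ℂ := (L : ℂ)⁻¹ * ∑ j ∈ Finset.range L, cis (j * φ)

/-- One minus the normalised Fejér kernel: a trigonometric polynomial with values in `[0, 1]` that
vanishes at `0` and is close to `1` away from the integers. -/
noncomputable def fejerGap (L : ℕ) (φ : ℝ) : ℝ := 1 - ‖dirichletMean L φ‖ ^ 2

theorem norm_dirichletMean_le_one {L : ℕ} (hL : 0 < L) (φ : ℝ) : ‖dirichletMean L φ‖ ≤ 1 := by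
  have hL' : (0 : ℝ) < L := by exact_mod_cast hL
  rw [dirichletMean, norm_mul, norm_inv, Complex.norm_natCast, inv_mul_le_iff₀ hL', mul_one]
  refine (norm_sum_le _ _).trans ?_
  simp [norm_cis]

theorem fejerGap_nonneg {L : ℕ} (hL : 0 < L) (φ : ℝ) : 0 ≤ fejerGap L φ := by
  have h1 := norm_dirichletMean_le_one hL φ
  have h2 := pow_le_one₀ (norm_nonneg _) h1 (n := 2)
  rw [fejerGap]; linarith

theorem fejerGap_le_one (L : ℕ) (φ : ℝ) : fejerGap L φ ≤ 1 := by
  rw [fejerGap]; have := sq_nonneg ‖dirichletMean L φ‖; linarith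

theorem fejerGap_le {L : ℕ} (hL : 0 < L) (φ : ℝ) : fejerGap L φ ≤ 2 * L * ‖cis φ - 1‖ := by
  have hL' : (0 : ℝ) < L := by exact_mod_cast hL
  have h1 : ‖dirichletMean L φ - 1‖ ≤ L * ‖cis φ - 1‖ := by
    have e : dirichletMean L φ - 1
        = (L : ℂ)⁻¹ * ∑ j ∈ Finset.range L, (cis φ ^ j - 1 ^ j) := by
      have : (L : ℂ) ≠ 0 := by exact_mod_cast hL.ne'
      rw [dirichletMean, Finset.sum_sub_distrib, mul_sub]
      simp [cis_nat_mul, this]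
    rw [e, norm_mul, norm_inv, Complex.norm_natCast, inv_mul_le_iff₀ hL']
    refine (norm_sum_le _ _).trans ?_
    refine (Finset.sum_le_card_nsmul _ _ (L * ‖cis φ - 1‖) fun j hj => ?_).trans_eq (by simp)
    refine (norm_pow_sub_pow_le_of_norm_one (norm_cis φ) norm_one j).trans ?_
    refine mul_le_mul_of_nonneg_right ?_ (norm_nonneg _)
    exact_mod_cast (Finset.mem_range.1 hj).le
  have h2 : 1 - ‖dirichletMean L φ‖ ≤ ‖dirichletMean L φ - 1‖ := by
    have := norm_sub_norm_le (1 : ℂ) (dirichletMean L φ)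
    rw [norm_one, norm_sub_rev] at this
    exact this
  have h3 := norm_dirichletMean_le_one hL φ
  have h4 := norm_nonneg (dirichletMean L φ)
  rw [fejerGap]
  nlinarith

theorem one_sub_le_fejerGap {L : ℕ} (hL : 0 < L) {φ c : ℝ} (hc : 0 < c) (h : c ≤ ‖cis φ - 1‖) :
    1 - 4 / (L * c) ^ 2 ≤ fejerGap L φ := by
  have hL' : (0 : ℝ) < L := by exact_mod_cast hL
  have h1 : ‖dirichletMean L φ‖ ≤ 2 / (L * c) := by
    have e : (cis φ - 1) * ∑ j ∈ Finset.range L, cis (j * φ) = cis φ ^ L - 1 := by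
      simp only [cis_nat_mul]
      rw [mul_comm, geom_sum_mul]
    have h2 : ‖cis φ - 1‖ * ‖∑ j ∈ Finset.range L, cis (j * φ)‖ ≤ 2 := by
      rw [← norm_mul, e]
      refine (norm_sub_le _ _).trans ?_
      rw [norm_pow, norm_cis, one_pow, norm_one]
      norm_num
    have h3 : c * ‖∑ j ∈ Finset.range L, cis (j * φ)‖ ≤ 2 :=
      (mul_le_mul_of_nonneg_right h (norm_nonneg _)).trans h2
    rw [dirichletMean, norm_mul, norm_inv, Complex.norm_natCast, le_div_iff₀ (by positivity)]
    calc (L : ℝ)⁻¹ * ‖∑ j ∈ Finset.range L, cis (j * φ)‖ * (L * c)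
        = ((L : ℝ)⁻¹ * L) * (c * ‖∑ j ∈ Finset.range L, cis (j * φ)‖) := by ring
      _ = c * ‖∑ j ∈ Finset.range L, cis (j * φ)‖ := by
        rw [inv_mul_cancel₀ hL'.ne', one_mul]
      _ ≤ 2 := h3
  have h2 := pow_le_pow_left₀ (norm_nonneg _) h1 2
  rw [div_pow] at h2
  rw [fejerGap]
  norm_num at h2
  linarith

/-! ### Multipliers of trigonometric polynomials -/

namespace QuasiNorm

variable {X : Type u} [AddCommGroup X] [Module ℂ X]

/-- Multiplying the coefficients of a trigonometric polynomial with nonnegative frequencies by `ψ`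
increases the supremum of its quasi-norm at most by the factor `C`. -/
def IsMultiplier (N : QuasiNorm X) (C : ℝ) (ψ : ℕ → ℂ) : Prop :=
  ∀ (E : Finset ℕ) (x : ℕ → X) (S : ℝ), (∀ T : ℝ, N (∑ n ∈ E, cis (n * T) • x n) ≤ S) →
    ∀ T : ℝ, N (∑ n ∈ E, cis (n * T) • ψ n • x n) ≤ C * S

namespace IsMultiplier

variable {N : QuasiNorm X} {K C C' : ℝ} {ψ ψ' : ℕ → ℂ}

theorem char (N : QuasiNorm X) (a : ℂ) (τ : ℝ) : N.IsMultiplier ‖a‖ fun n => a * cis (n * τ) := by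
  intro E x S hS T
  have e : ∑ n ∈ E, cis (n * T) • (a * cis (n * τ)) • x n = a • ∑ n ∈ E, cis (n * (T + τ)) • x n := by
    rw [Finset.smul_sum]
    refine Finset.sum_congr rfl fun n _ => ?_
    rw [smul_smul, smul_smul, mul_add, cis_add]
    congr 1
    ring
  rw [e, N.smul]
  exact mul_le_mul_of_nonneg_left (hS _) (norm_nonneg a)

theorem mul (h : N.IsMultiplier C ψ) (h' : N.IsMultiplier C' ψ') :
    N.IsMultiplier (C * C') fun n => ψ n * ψ' n := by
  intro E x S hS T
  have := h E (fun n => ψ' n • x n) (C' * S) (h' E x S hS) T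
  simpa only [smul_smul, mul_assoc] using this

theorem one (N : QuasiNorm X) : N.IsMultiplier 1 fun _ => 1 := by
  intro E x S hS T
  simpa using hS T

theorem sum (hK : N.HasModulus K) {L : ℕ} {ψ : ℕ → ℕ → ℂ}
    (h : ∀ j < L, N.IsMultiplier C (ψ j)) :
    N.IsMultiplier (K ^ L * (L * C)) fun n => ∑ j ∈ Finset.range L, ψ j n := by
  intro E x S hS T
  have e : ∑ n ∈ E, cis (n * T) • (∑ j ∈ Finset.range L, ψ j n) • x n
      = ∑ j ∈ Finset.range L, ∑ n ∈ E, cis (n * T) • ψ j n • x n := by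
    rw [Finset.sum_comm]
    refine Finset.sum_congr rfl fun n _ => ?_
    rw [Finset.sum_smul, Finset.smul_sum]
  rw [e]
  refine (hK.sum_le_pow L _ (by rw [Finset.card_range]; exact Nat.lt_two_pow_self.le) _).trans ?_
  rw [mul_assoc]
  refine mul_le_mul_of_nonneg_left ?_ (pow_nonneg hK.pos.le _)
  refine (Finset.sum_le_card_nsmul _ _ (C * S) fun j hj => ?_).trans_eq ?_
  · exact h j (Finset.mem_range.1 hj) E x S hS T
  · rw [Finset.card_range, nsmul_eq_mul]; ring

theorem one_sub (hK : N.HasModulus K) (h : N.IsMultiplier C ψ) :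
    N.IsMultiplier (K * (1 + C)) fun n => 1 - ψ n := by
  intro E x S hS T
  have e : ∑ n ∈ E, cis (n * T) • (1 - ψ n) • x n
      = ∑ n ∈ E, cis (n * T) • x n + -∑ n ∈ E, cis (n * T) • ψ n • x n := by
    rw [← sub_eq_add_neg, ← Finset.sum_sub_distrib]
    refine Finset.sum_congr rfl fun n _ => ?_
    rw [sub_smul, one_smul, smul_sub]
  rw [e]
  refine (hK.add_le _ _).trans ?_
  rw [mul_assoc, N.map_neg, add_mul, one_mul]
  exact mul_le_mul_of_nonneg_left (add_le_add (hS T) (h E x S hS T)) hK.pos.le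

theorem prod {I : Type*} {ψ : I → ℕ → ℂ} (s : Finset I) (h : ∀ i ∈ s, N.IsMultiplier C (ψ i)) :
    N.IsMultiplier (C ^ s.card) fun n => ∏ i ∈ s, ψ i n := by
  classical
  induction s using Finset.induction_on with
  | empty => simpa using one N
  | insert i s hi ih =>
    rw [Finset.card_insert_of_notMem hi, pow_succ']
    simp only [Finset.prod_insert hi]
    exact (h i (Finset.mem_insert_self i s)).mul
      (ih fun j hj => h j (Finset.mem_insert_of_mem hj))

theorem dirichletMean (hK : N.HasModulus K) {L : ℕ} (hL : 0 < L) (τ l : ℝ) :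
    N.IsMultiplier (K ^ L) fun n => _root_.dirichletMean L (n * τ - l) := by
  have hL' : (L : ℝ) ≠ 0 := by exact_mod_cast hL.ne'
  have h := IsMultiplier.sum hK (L := L) (C := (L : ℝ)⁻¹)
    (ψ := fun j n => ((L : ℂ)⁻¹ * cis (-(j * l))) * cis (n * (j * τ))) (by
      intro j _
      have h := char N ((L : ℂ)⁻¹ * cis (-(j * l))) (j * τ)
      rwa [norm_mul, norm_inv, Complex.norm_natCast, norm_cis, mul_one] at h)
  rw [mul_inv_cancel₀ hL', mul_one] at h
  convert h using 2 with n
  rw [_root_.dirichletMean, Finset.mul_sum]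
  refine Finset.sum_congr rfl fun j _ => ?_
  rw [mul_assoc, ← cis_add]
  congr 2
  ring

theorem fejerGap (hK : N.HasModulus K) {L : ℕ} (hL : 0 < L) (τ l : ℝ) :
    N.IsMultiplier (K * (1 + K ^ L * K ^ L)) fun n => ((_root_.fejerGap L (n * τ - l) : ℝ) : ℂ) := by
  have h := one_sub hK ((dirichletMean hK hL τ l).mul (dirichletMean hK hL (-τ) (-l)))
  convert h using 2 with n
  have e : _root_.dirichletMean L (n * -τ - -l)
      = (starRingEnd ℂ) (_root_.dirichletMean L (n * τ - l)) := by
    have hc : ∀ t : ℝ, (starRingEnd ℂ) (cis t) = cis (-t) := fun t => by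
      rw [cis_eq, cis_eq, ← Complex.exp_conj, map_mul, Complex.conj_I, Complex.conj_ofReal]
      congr 1
      push_cast
      ring
    rw [_root_.dirichletMean, _root_.dirichletMean, map_mul, map_inv₀, Complex.conj_natCast, map_sum]
    congr 1
    refine Finset.sum_congr rfl fun j _ => ?_
    rw [hc]
    congr 1
    ring
  rw [e, Complex.mul_conj, Complex.normSq_eq_norm_sq, _root_.fejerGap]
  push_cast
  rfl

end IsMultiplier

end QuasiNorm

theorem abs_prod_sub_prod_le {I : Type*} (s : Finset I) (a b : I → ℝ)
    (ha : ∀ i ∈ s, 0 ≤ a i ∧ a i ≤ 1) (hb : ∀ i ∈ s, 0 ≤ b i ∧ b i ≤ 1) :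
    |∏ i ∈ s, a i - ∏ i ∈ s, b i| ≤ ∑ i ∈ s, |a i - b i| := by
  classical
  induction s using Finset.induction_on with
  | empty => simp
  | insert i s hi ih =>
    rw [Finset.prod_insert hi, Finset.prod_insert hi, Finset.sum_insert hi]
    have h1 := ih (fun j hj => ha j (Finset.mem_insert_of_mem hj))
      (fun j hj => hb j (Finset.mem_insert_of_mem hj))
    have hai := ha i (Finset.mem_insert_self i s)
    have hP0 : 0 ≤ ∏ j ∈ s, b j :=
      Finset.prod_nonneg fun j hj => (hb j (Finset.mem_insert_of_mem hj)).1
    have hP1 : ∏ j ∈ s, b j ≤ 1 := Finset.prod_le_one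
      (fun j hj => (hb j (Finset.mem_insert_of_mem hj)).1)
      (fun j hj => (hb j (Finset.mem_insert_of_mem hj)).2)
    have e : a i * ∏ j ∈ s, a j - b i * ∏ j ∈ s, b j
        = a i * (∏ j ∈ s, a j - ∏ j ∈ s, b j) + (a i - b i) * ∏ j ∈ s, b j := by ring
    rw [e]
    refine (abs_add_le _ _).trans ?_
    rw [abs_mul, abs_mul, abs_of_nonneg hai.1, abs_of_nonneg hP0]
    have h2 : a i * |∏ j ∈ s, a j - ∏ j ∈ s, b j| ≤ |∏ j ∈ s, a j - ∏ j ∈ s, b j| :=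
      mul_le_of_le_one_left (abs_nonneg _) hai.2
    have h3 : |a i - b i| * ∏ j ∈ s, b j ≤ |a i - b i| := mul_le_of_le_one_right (abs_nonneg _) hP1
    linarith

/-- Every point of the closed unit disc is the midpoint of two points of the unit circle. -/
theorem exists_midpoint_of_norm_le_one {z : ℂ} (hz : ‖z‖ ≤ 1) :
    ∃ p q : ℂ, ‖p‖ = 1 ∧ ‖q‖ = 1 ∧ z = (1 / 2 : ℂ) * (p + q) := by
  set α := Real.arccos ‖z‖ with hα
  have hcos : Real.cos α = ‖z‖ := Real.cos_arccos (by linarith [norm_nonneg z]) hz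
  have hn : ∀ t : ℝ, ‖Complex.exp (t * Complex.I)‖ = 1 := Complex.norm_exp_ofReal_mul_I
  refine ⟨Complex.exp (z.arg * Complex.I) * Complex.exp (α * Complex.I),
    Complex.exp (z.arg * Complex.I) * Complex.exp (((-α : ℝ) : ℂ) * Complex.I),
    by rw [norm_mul, hn, hn, one_mul], by rw [norm_mul, hn, hn, one_mul], ?_⟩
  rw [← mul_add]
  have e : Complex.exp (α * Complex.I) + Complex.exp (((-α : ℝ) : ℂ) * Complex.I)
      = 2 * (‖z‖ : ℂ) := by
    rw [← hcos, Complex.ofReal_cos, Complex.two_cos]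
    push_cast
    rfl
  rw [e]
  conv_lhs => rw [← Complex.norm_mul_exp_arg_mul_I z]
  ring

/-! ### The estimate for one separated class of frequencies -/

open scoped Pointwise in
/-- If a convex set contains all sums `∑ i, y i (ω i)`, then it contains the sum of the averages
of the `y i`. -/
theorem Convex.sum_average_mem {V I : Type*} [AddCommGroup V] [Module ℝ V] [Fintype I] {s : Set V}
    (hs : Convex ℝ s) {Ω : I → Type*} [∀ i, Fintype (Ω i)] [∀ i, Nonempty (Ω i)]
    (y : ∀ i, Ω i → V) (h : ∀ ω : ∀ i, Ω i, ∑ i, y i (ω i) ∈ s) :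
    ∑ i, (Fintype.card (Ω i) : ℝ)⁻¹ • ∑ ω, y i ω ∈ s := by
  have h1 : ∑ i, (Fintype.card (Ω i) : ℝ)⁻¹ • ∑ ω, y i ω
      ∈ ∑ i, convexHull ℝ (Set.range (y i)) := by
    rw [Set.mem_finsetSum]
    refine ⟨_, fun {i} _ => ?_, rfl⟩
    rw [Finset.smul_sum]
    refine (convex_convexHull ℝ _).sum_mem (fun _ _ => by positivity) ?_
      fun ω _ => subset_convexHull ℝ _ ⟨ω, rfl⟩
    rw [Finset.sum_const, Finset.card_univ, nsmul_eq_mul]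
    exact mul_inv_cancel₀ (by exact_mod_cast Fintype.card_ne_zero)
  rw [← convexHull_sum] at h1
  refine convexHull_min ?_ hs h1
  intro v hv
  rw [Set.mem_finsetSum] at hv
  obtain ⟨g, hg, rfl⟩ := hv
  choose! ω hω using fun i => hg (i := i) (Finset.mem_univ i)
  have e : ∑ i, g i = ∑ i, y i (ω i) := Finset.sum_congr rfl fun i _ => (hω i).symm
  rw [e]
  exact h ω

/-- The average of the logarithm of the kernel, truncated at `δ`, is close to `0` if the phase of `m`
is rarely close to `l`. -/
theorem le_average_log_fejerGap {L : ℕ} (hL : 0 < L) {c δ β l m : ℝ} (hc : 0 < c) (hδ : 0 < δ)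
    (hδ1 : δ ≤ 1) (hLc : 4 / (L * c) ^ 2 ≤ 1 / 2) {Ω : Type*} [Fintype Ω] [Nonempty Ω] (τ : Ω → ℝ)
    (hβ : (Nat.card {ω // ‖cis (m * τ ω) - cis l‖ < c} : ℝ) ≤ β * Nat.card Ω) :
    -(β * Real.log δ⁻¹ + 8 / (L * c) ^ 2)
      ≤ (Fintype.card Ω : ℝ)⁻¹ * ∑ ω, Real.log (max (fejerGap L (m * τ ω - l)) δ) := by
  classical
  set bad : Finset Ω := Finset.univ.filter fun ω => ‖cis (m * τ ω) - cis l‖ < c with hbad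
  have hlog : 0 ≤ Real.log δ⁻¹ := Real.log_nonneg ((one_le_inv₀ hδ).2 hδ1)
  have hcard : (Nat.card {ω // ‖cis (m * τ ω) - cis l‖ < c} : ℝ) = bad.card := by
    rw [Nat.card_eq_fintype_card, Fintype.card_subtype]
  rw [hcard, Nat.card_eq_fintype_card] at hβ
  have hpt : ∀ ω, -(8 / (L * c) ^ 2) - (if ω ∈ bad then Real.log δ⁻¹ else 0)
      ≤ Real.log (max (fejerGap L (m * τ ω - l)) δ) := by
    intro ω
    split_ifs with h
    · have h1 : Real.log δ ≤ Real.log (max (fejerGap L (m * τ ω - l)) δ) :=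
        Real.log_le_log hδ (le_max_right _ _)
      have h2 : 0 ≤ 8 / (L * c) ^ 2 := by positivity
      rw [Real.log_inv]
      linarith
    · have h1 : c ≤ ‖cis (m * τ ω - l) - 1‖ := by
        rw [← norm_cis_sub_cis]
        simpa [hbad] using h
      have h2 := one_sub_le_fejerGap hL hc h1
      set u := 4 / (L * c) ^ 2 with hu
      have hu8 : 8 / (L * c) ^ 2 = 2 * u := by rw [hu]; ring
      have hu0 : 0 ≤ u := by positivity
      have h3 : Real.log (1 - u) ≤ Real.log (max (fejerGap L (m * τ ω - l)) δ) :=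
        Real.log_le_log (by linarith) (h2.trans (le_max_left _ _))
      have h4 := Real.one_sub_inv_le_log_of_pos (x := 1 - u) (by linarith)
      have h5 : (1 - u)⁻¹ ≤ 1 + 2 * u := by
        rw [inv_le_iff_one_le_mul₀ (by linarith)]
        nlinarith
      rw [hu8]
      linarith
  have hpos : (0 : ℝ) < Fintype.card Ω := by exact_mod_cast Fintype.card_pos
  rw [le_inv_mul_iff₀ hpos]
  refine le_trans ?_ (Finset.sum_le_sum fun ω _ => hpt ω)
  rw [Finset.sum_sub_distrib, Finset.sum_const, Finset.card_univ, nsmul_eq_mul, Finset.sum_ite_mem,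
    Finset.univ_inter, Finset.sum_const, nsmul_eq_mul]
  have := mul_le_mul_of_nonneg_right hβ hlog
  linarith

namespace QuasiNorm

variable {X : Type u} [AddCommGroup X] [Module ℂ X] {N : QuasiNorm X} {K : ℝ}

/-- The phases `τ i` annihilate, up to a small error, the frequencies outside of `D`; the
remaining coefficients can be given arbitrary phases. -/
theorem HasModulus.sum_unimodular_le (hK : N.HasModulus K) {Q η l δ : ℝ} (hQ : 2 ≤ Q) {L : ℕ}
    (hη : 0 < η) (hL : 0 < L) (hδ : 0 < δ) (hδ1 : δ ≤ 1) {E D : Finset ℕ} (hE : ∀ n ∈ E, 0 < n)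
    (hDE : D ⊆ E) (hD : IsSeparated Q D) {I : Type*} [Fintype I] (τ : I → ℝ)
    (hkill : ∀ n ∈ E, n ∉ D → ∃ i, ‖cis (n * τ i) - cis l‖ ≤ 4 * Real.pi * η)
    (x : ℕ → X) {S₀ A : ℝ} (hS : ∀ T : ℝ, N (∑ n ∈ E, cis (n * T) • x n) ≤ S₀)
    (hA : ∀ z : ℕ → ℂ, (∀ n, ‖z n‖ ≤ 1) → N (∑ n ∈ E, z n • x n) ≤ A)
    (p : ℕ → ℂ) (hp : ∀ n, ‖p n‖ = 1) :
    N (∑ n ∈ D, (p n * ((∏ i, max (fejerGap L (n * τ i - l)) δ : ℝ) : ℂ)) • x n)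
      ≤ K * ((K * (1 + K ^ L * K ^ L)) ^ Fintype.card I * S₀
        + (4 * Real.pi / Q + Fintype.card I * δ + 8 * Real.pi * L * η) * A) := by
  classical
  have hQ0 : 0 < Q := by linarith
  have hπ := Real.pi_pos
  obtain ⟨T₀, -, -, hT₀⟩ := exists_phase_approx hQ p hp D.card D rfl hD 0 1 one_pos
    fun m hm => by exact_mod_cast hE m (hDE hm)
  set Δ : ℝ := 4 * Real.pi / Q + Fintype.card I * δ + 8 * Real.pi * L * η with hΔ
  have hL' : (0 : ℝ) < L := by exact_mod_cast hL
  have hΔ0 : 0 < Δ := by positivity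
  have hfg0 : ∀ n i, 0 ≤ fejerGap L ((n : ℕ) * τ i - l) := fun n i => fejerGap_nonneg hL _
  have hfg1 : ∀ n i, fejerGap L ((n : ℕ) * τ i - l) ≤ 1 := fun n i => fejerGap_le_one L _
  set a : ℕ → ℝ := fun n => ∏ i, fejerGap L (n * τ i - l) with ha
  set r : ℕ → ℝ := fun n => ∏ i, max (fejerGap L (n * τ i - l)) δ with hr
  have ha0 : ∀ n, 0 ≤ a n := fun n => Finset.prod_nonneg fun i _ => hfg0 n i
  have ha1 : ∀ n, a n ≤ 1 := fun n => Finset.prod_le_one (fun i _ => hfg0 n i) fun i _ => hfg1 n i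
  have har : ∀ n, |r n - a n| ≤ Fintype.card I * δ := by
    intro n
    refine (abs_prod_sub_prod_le _ _ _
      (fun i _ => ⟨(hfg0 n i).trans (le_max_left _ _), max_le (hfg1 n i) hδ1⟩)
      (fun i _ => ⟨hfg0 n i, hfg1 n i⟩)).trans ?_
    refine (Finset.sum_le_card_nsmul _ _ δ fun i _ => ?_).trans_eq (by simp)
    have := hfg0 n i
    rw [abs_le]
    rcases max_cases (fejerGap L (n * τ i - l)) δ with h | h <;> rw [h.1] <;>
      constructor <;> linarith
  -- the error made by the multiplier `n ↦ cis (n T₀) a n`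
  set e : ℕ → ℂ := fun n => (if n ∈ D then p n * (r n : ℂ) else 0) - cis (n * T₀) * (a n : ℂ) with he
  have hle : ∀ n ∈ E, ‖e n‖ ≤ Δ := by
    intro n hn
    simp only [he]
    split_ifs with hD'
    · have e1 : p n * (r n : ℂ) - cis (n * T₀) * (a n : ℂ)
          = p n * ((r n - a n : ℝ) : ℂ) - (cis (n * T₀) - p n) * (a n : ℂ) := by
        push_cast; ring
      rw [e1]
      refine (norm_sub_le _ _).trans ?_
      rw [norm_mul, norm_mul, hp, one_mul, Complex.norm_real, Complex.norm_real,
        Real.norm_eq_abs, Real.norm_of_nonneg (ha0 n)]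
      have h1 := hT₀ n hD'
      have h2 : ‖cis (n * T₀) - p n‖ * a n ≤ ‖cis (n * T₀) - p n‖ :=
        mul_le_of_le_one_right (norm_nonneg _) (ha1 n)
      have h3 := har n
      have h4 : 0 ≤ 8 * Real.pi * L * η := by positivity
      linarith
    · rw [zero_sub, norm_neg, norm_mul, norm_cis, one_mul, Complex.norm_real,
        Real.norm_of_nonneg (ha0 n)]
      obtain ⟨i, hi⟩ := hkill n hn hD'
      have h1 : a n ≤ fejerGap L (n * τ i - l) := by
        simp only [ha]
        rw [← Finset.mul_prod_erase _ _ (Finset.mem_univ i)]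
        exact mul_le_of_le_one_right (hfg0 n i)
          (Finset.prod_le_one (fun i _ => hfg0 n i) fun i _ => hfg1 n i)
      have h2 := fejerGap_le hL (n * τ i - l)
      rw [← norm_cis_sub_cis] at h2
      have h3 : 2 * L * ‖cis (n * τ i) - cis l‖ ≤ 2 * L * (4 * Real.pi * η) :=
        mul_le_mul_of_nonneg_left hi (by positivity)
      have h4 : 0 ≤ 4 * Real.pi / Q + Fintype.card I * δ := by positivity
      linarith
  have hsplit : ∑ n ∈ D, (p n * (r n : ℂ)) • x n
      = ∑ n ∈ E, cis (n * T₀) • ((a n : ℝ) : ℂ) • x n + ∑ n ∈ E, e n • x n := by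
    rw [← Finset.sum_add_distrib]
    have e1 : ∀ n ∈ E, cis (n * T₀) • ((a n : ℝ) : ℂ) • x n + e n • x n
        = if n ∈ D then (p n * (r n : ℂ)) • x n else 0 := by
      intro n _
      rw [smul_smul, ← add_smul]
      simp only [he]
      rw [add_sub_cancel]
      split_ifs <;> simp
    rw [Finset.sum_congr rfl e1, Finset.sum_ite_mem, Finset.inter_eq_right.2 hDE]
  have hmain : N (∑ n ∈ E, cis (n * T₀) • ((a n : ℝ) : ℂ) • x n)
      ≤ (K * (1 + K ^ L * K ^ L)) ^ Fintype.card I * S₀ := by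
    have := IsMultiplier.prod (N := N) (Finset.univ : Finset I)
      (ψ := fun i n => ((fejerGap L (n * τ i - l) : ℝ) : ℂ))
      fun i _ => IsMultiplier.fejerGap hK hL (τ i) l
    have h1 := this E x S₀ hS T₀
    simpa only [ha, Complex.ofReal_prod, Finset.card_univ] using h1
  have herr : N (∑ n ∈ E, e n • x n) ≤ Δ * A := by
    have e1 : ∑ n ∈ E, e n • x n
        = (Δ : ℂ) • ∑ n ∈ E, (if n ∈ E then e n / (Δ : ℂ) else 0) • x n := by
      rw [Finset.smul_sum]
      refine Finset.sum_congr rfl fun n hn => ?_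
      rw [if_pos hn, smul_smul, mul_div_cancel₀ _ (by exact_mod_cast hΔ0.ne')]
    rw [e1, N.map_real_smul hΔ0.le]
    refine mul_le_mul_of_nonneg_left (hA _ fun n => ?_) hΔ0.le
    split_ifs with hn
    · rw [norm_div, Complex.norm_real, Real.norm_of_nonneg hΔ0.le]
      exact div_le_one_of_le₀ (hle n hn) hΔ0.le
    · simp
  show N (∑ n ∈ D, (p n * (r n : ℂ)) • x n) ≤ _
  rw [hsplit]
  exact (hK.add_le _ _).trans (mul_le_mul_of_nonneg_left (add_le_add hmain herr) hK.pos.le)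

/-- The estimate for a separated class `D ⊆ E`. Every choice of the random phases bounds
`polydiscSup` at a point with coordinates `log ∏ i, max (fejerGap …) δ`. By convexity the same bound
holds at the average over all choices, and this average has coordinates `≥ -1`. -/
theorem IsPlurisubharmonic.sum_separated_le (hN : N.IsPlurisubharmonic) (hK : N.HasModulus K)
    {Q η c l δ β : ℝ} (hQ : 2 ≤ Q) {L : ℕ} (hη : 0 < η) (hc : 0 < c) (hL : 0 < L) (hδ : 0 < δ)
    (hδ1 : δ ≤ 1) (hLc : 4 / (L * c) ^ 2 ≤ 1 / 2) {E D : Finset ℕ} (hE : ∀ n ∈ E, 0 < n)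
    (hDE : D ⊆ E) (hD : IsSeparated Q D) {I : Type*} [Fintype I] {Ω : I → Type*}
    [∀ i, Fintype (Ω i)] [∀ i, Nonempty (Ω i)] (τ : ∀ i, Ω i → ℝ)
    (hkill : ∀ n ∈ E, n ∉ D → ∃ i, ∀ ω, ‖cis (n * τ i ω) - cis l‖ ≤ 4 * Real.pi * η)
    (hβ : ∀ i, ∀ m ∈ D, (Nat.card {ω // ‖cis (m * τ i ω) - cis l‖ < c} : ℝ) ≤ β * Nat.card (Ω i))
    (hI : Fintype.card I * (β * Real.log δ⁻¹ + 8 / (L * c) ^ 2) ≤ 1)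
    (x : ℕ → X) {S₀ A : ℝ} (hS : ∀ T : ℝ, N (∑ n ∈ E, cis (n * T) • x n) ≤ S₀)
    (hA : ∀ z : ℕ → ℂ, (∀ n, ‖z n‖ ≤ 1) → N (∑ n ∈ E, z n • x n) ≤ A)
    (z : ℕ → ℂ) (hz : ∀ n, ‖z n‖ ≤ 1) :
    N (∑ n ∈ D, z n • x n)
      ≤ 3 * (K ^ 2 * ((K * (1 + K ^ L * K ^ L)) ^ Fintype.card I * S₀
        + (4 * Real.pi / Q + Fintype.card I * δ + 8 * Real.pi * L * η) * A)) := by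
  classical
  set B := (K * (1 + K ^ L * K ^ L)) ^ Fintype.card I * S₀
        + (4 * Real.pi / Q + Fintype.card I * δ + 8 * Real.pi * L * η) * A with hB
  set x' : D → X := fun n => x n with hx'
  set y : ∀ i, Ω i → D → ℝ := fun i ω n => Real.log (max (fejerGap L (n * τ i ω - l)) δ) with hy
  have hmem : ∀ ω : ∀ i, Ω i, ∑ i, y i (ω i) ∈ {y | N.polydiscSup x' y ≤ K ^ 2 * B} := by
    intro ω
    refine N.polydiscSup_le x' fun z hz => ?_
    set r : ℕ → ℝ := fun n => ∏ i, max (fejerGap L (n * τ i (ω i) - l)) δ with hr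
    have hr0 : ∀ n, 0 < r n := fun n => Finset.prod_pos fun i _ => hδ.trans_le (le_max_right _ _)
    have hzr : ∀ n : D, ‖z n‖ ≤ r n := by
      intro n
      refine (hz n).trans_eq ?_
      rw [Finset.sum_apply, Real.exp_sum]
      exact Finset.prod_congr rfl fun i _ => Real.exp_log (hδ.trans_le (le_max_right _ _))
    -- the coefficients divided by `r` lie in the unit disc
    set u : ℕ → ℂ := fun n => if h : n ∈ D then z ⟨n, h⟩ / (r n : ℂ) else 0 with hu
    have hu1 : ∀ n, ‖u n‖ ≤ 1 := by
      intro n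
      simp only [hu]
      split_ifs with h
      · rw [norm_div, Complex.norm_real, Real.norm_of_nonneg (hr0 n).le]
        exact div_le_one_of_le₀ (hzr ⟨n, h⟩) (hr0 n).le
      · simp
    choose p q hp hq hpq using fun n => exists_midpoint_of_norm_le_one (hu1 n)
    have e : ∑ n : D, z n • x' n
        = (((1 / 2 : ℝ) : ℝ) : ℂ) • (∑ n ∈ D, (p n * (r n : ℂ)) • x n
          + ∑ n ∈ D, (q n * (r n : ℂ)) • x n) := by
      rw [← Finset.sum_add_distrib, Finset.smul_sum, ← Finset.sum_coe_sort D]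
      refine Finset.sum_congr rfl fun n _ => ?_
      rw [← add_smul, smul_smul, ← add_mul, ← mul_assoc]
      have e1 : ((1 / 2 : ℝ) : ℂ) * (p n + q n) = u n := by rw [hpq]; push_cast; rfl
      rw [e1]
      simp only [hu, hx']
      rw [dif_pos n.2, div_mul_cancel₀ _ (by exact_mod_cast (hr0 n).ne')]
    have hall : ∀ p : ℕ → ℂ, (∀ n, ‖p n‖ = 1) →
        N (∑ n ∈ D, (p n * (r n : ℂ)) • x n) ≤ K * B := fun p hp =>
      hK.sum_unimodular_le hQ hη hL hδ hδ1 hE hDE hD (fun i => τ i (ω i))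
        (fun n hn hnD => (hkill n hn hnD).imp fun i h => h (ω i)) x hS hA p hp
    rw [e, N.map_real_smul (by norm_num)]
    have h1 := hK.add_le (∑ n ∈ D, (p n * (r n : ℂ)) • x n) (∑ n ∈ D, (q n * (r n : ℂ)) • x n)
    have h2 := mul_le_mul_of_nonneg_left (add_le_add (hall p hp) (hall q hq)) hK.pos.le
    calc _ ≤ 1 / 2 * (K * (K * B + K * B)) :=
          mul_le_mul_of_nonneg_left (h1.trans h2) (by norm_num)
      _ = K ^ 2 * B := by ring
  have havg := (hN.convex_polydiscSup_le x' (K ^ 2 * B)).sum_average_mem y hmem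
  set Y : D → ℝ := ∑ i, (Fintype.card (Ω i) : ℝ)⁻¹ • ∑ ω, y i ω with hY
  have hY1 : ∀ n, (0 : D → ℝ) n ≤ Y n + 1 := by
    intro n
    have h1 : ∀ i, -(β * Real.log δ⁻¹ + 8 / (L * c) ^ 2)
        ≤ ((Fintype.card (Ω i) : ℝ)⁻¹ • ∑ ω, y i ω) n := by
      intro i
      rw [Pi.smul_apply, Finset.sum_apply, smul_eq_mul]
      exact le_average_log_fejerGap hL hc hδ hδ1 hLc (τ i) (hβ i n n.2)
    have h2 := Finset.card_nsmul_le_sum Finset.univ _ _ fun i _ => h1 i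
    rw [hY, Finset.sum_apply]
    rw [Finset.card_univ, nsmul_eq_mul] at h2
    simp only [Pi.zero_apply]
    linarith
  have h0 : N (∑ n ∈ D, z n • x n) ≤ N.polydiscSup x' 0 := by
    rw [← Finset.sum_coe_sort D]
    exact N.le_polydiscSup x' (z := fun n : D => z n) fun n => by simpa using hz n
  have h3 := N.polydiscSup_le_exp_mul x' hY1
  have hB0 : 0 ≤ K ^ 2 * B := (N.polydiscSup_nonneg x' Y).trans havg
  calc _ ≤ Real.exp 1 * N.polydiscSup x' Y := h0.trans h3
    _ ≤ Real.exp 1 * (K ^ 2 * B) := mul_le_mul_of_nonneg_left havg (Real.exp_pos 1).le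
    _ ≤ 3 * (K ^ 2 * B) :=
      mul_le_mul_of_nonneg_right (Real.exp_one_lt_d9.le.trans (by norm_num)) hB0

end QuasiNorm

/-! ### The estimate for unions of separated classes -/

/-- The choice of the scales as powers of one large parameter `B`. -/
theorem separationScales_of_pow {B : ℝ} (hB : 4 ≤ B) :
    SeparationScales (B ^ 10) (B ^ 6)⁻¹ (B ^ 3)⁻¹ (B ^ 4)⁻¹ (B ^ 3 / 32) (B ^ 3)⁻¹ := by
  have hB0 : 0 < B := by linarith
  have h1 : (1 : ℝ) ≤ B := by linarith
  have h3 : (64 : ℝ) ≤ B ^ 3 := by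
    calc (64 : ℝ) = 4 ^ 3 := by norm_num
      _ ≤ B ^ 3 := pow_le_pow_left₀ (by norm_num) hB 3
  have h4 : (256 : ℝ) ≤ B ^ 4 := by
    calc (256 : ℝ) = 4 ^ 4 := by norm_num
      _ ≤ B ^ 4 := pow_le_pow_left₀ (by norm_num) hB 4
  have e1 : (B ^ 6)⁻¹ * B ^ 10 = B ^ 4 := by field_simp
  have e2 : B ^ 10 * ((B ^ 3)⁻¹ * (B ^ 6)⁻¹) = B := by field_simp
  have e3 : B ^ 10 * (B ^ 3)⁻¹ = B ^ 3 * B ^ 4 := by field_simp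
  have e4 : 8 * Real.pi * (B ^ 6)⁻¹ * (B ^ 3 / 32) = Real.pi / 4 * (B ^ 3)⁻¹ := by
    field_simp; norm_num
  have e5 : 2 * (B ^ 4)⁻¹ = (2 / B) * (B ^ 3)⁻¹ := by field_simp
  have e6 : 4 * (B ^ 3 / 32) * (B ^ 3)⁻¹ = 1 / 8 := by field_simp; norm_num
  have hw : 0 < (B ^ 3)⁻¹ := by positivity
  refine ⟨by positivity, inv_le_one_of_one_le₀ (one_le_pow₀ h1), by positivity, ?_, by positivity,
    ?_, by linarith, ?_, by linarith, by rw [e6]; norm_num, by rw [e1]; linarith, by rw [e2]; linarith,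
    ?_⟩
  · rw [one_div]
    exact inv_anti₀ (by norm_num) (by linarith)
  · rw [e5]
    refine mul_le_of_le_one_left hw.le ?_
    rw [div_le_one hB0]
    linarith
  · rw [e4]
    refine mul_le_of_le_one_left hw.le ?_
    have := Real.pi_le_four
    linarith
  · rw [e3]
    nlinarith

/-- A set with at most `M` elements in each interval `[a, Q a)` splits into `M` separated classes:
the elements are distributed cyclically. -/
theorem exists_separated_classes {Q : ℝ} {M : ℕ} (hM : 0 < M) (E : Finset ℕ)
    (h : ∀ a ∈ E, (E.filter fun n : ℕ => a ≤ n ∧ (n : ℝ) < Q * a).card ≤ M) :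
    ∃ cls : ℕ → Fin M, ∀ d, IsSeparated Q (E.filter fun n => cls n = d) := by
  set rk : ℕ → ℕ := fun n => (E.filter (· < n)).card with hrk
  refine ⟨fun n => ⟨rk n % M, Nat.mod_lt _ hM⟩, fun d a ha b hb hab => ?_⟩
  rw [Finset.mem_filter] at ha hb
  by_contra! hlt
  have hsub : E.filter (· < a) ⊆ E.filter (· < b) := by
    intro n hn
    rw [Finset.mem_filter] at hn ⊢
    exact ⟨hn.1, hn.2.trans hab⟩
  have hlt' : rk a < rk b := by
    refine Finset.card_lt_card (Finset.ssubset_iff_of_subset hsub |>.2 ⟨a, ?_, ?_⟩)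
    · exact Finset.mem_filter.2 ⟨ha.1, hab⟩
    · simp
  have hmod : rk a % M = rk b % M := by
    have := ha.2.trans hb.2.symm
    simpa using this
  have hdiff : M ≤ rk b - rk a := by
    refine Nat.le_of_dvd (by omega) ?_
    exact (Nat.modEq_iff_dvd' hlt'.le).1 hmod
  have hcard : rk b - rk a = (E.filter (· < b) \ E.filter (· < a)).card :=
    (Finset.card_sdiff_of_subset hsub).symm
  have hins : insert b (E.filter (· < b) \ E.filter (· < a))
      ⊆ E.filter fun n : ℕ => a ≤ n ∧ (n : ℝ) < Q * a := by
    intro n hn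
    rw [Finset.mem_insert, Finset.mem_sdiff, Finset.mem_filter, Finset.mem_filter] at hn
    rw [Finset.mem_filter]
    rcases hn with rfl | ⟨⟨h1, h2⟩, h3⟩
    · exact ⟨hb.1, hab.le, hlt⟩
    · refine ⟨h1, not_lt.1 fun h4 => h3 ⟨h1, h4⟩, lt_trans ?_ hlt⟩
      exact_mod_cast h2
  have h1 := (Finset.card_le_card hins).trans (h a ha.1)
  rw [Finset.card_insert_of_notMem (by simp)] at h1
  omega

/-- Exponential growth of `B = 2 ^ g` beats the powers of `g` which come from the number `10 μ g`
of classes. The first condition makes the average of the logarithms at least `-1`, the second one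
allows to absorb the errors. -/
theorem exists_large_scale (μ κ : ℕ) (hμ : 0 < μ) : ∃ g : ℕ, 2 ≤ g ∧
    (20 * μ * g : ℝ) * (172 * g + 8) ≤ 2 ^ g ∧
    6 * (20 * μ * g : ℝ) ^ κ * (10 * μ * g) * 2 ^ (2 * κ) * (60 * μ * g) ≤ 2 ^ g := by
  have key : ∀ (k : ℕ) (C : ℝ), ∀ᶠ g : ℕ in Filter.atTop, C * (g : ℝ) ^ k ≤ 2 ^ g := by
    intro k C
    have h := (tendsto_pow_const_div_const_pow_of_one_lt k (one_lt_two (α := ℝ))).const_mul C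
    rw [mul_zero] at h
    filter_upwards [h.eventually (gt_mem_nhds one_pos)] with g hg
    rw [← mul_div_assoc, div_lt_one (by positivity)] at hg
    exact hg.le
  obtain ⟨g, h1, h2, h3⟩ := ((key 2 (20 * μ * 180)).and ((key (κ + 2)
    (6 * (20 * μ) ^ κ * (10 * μ) * 2 ^ (2 * κ) * (60 * μ))).and (Filter.eventually_ge_atTop 2))).exists
  refine ⟨g, h3, le_trans ?_ h1, le_trans (le_of_eq ?_) h2⟩
  · have hg : (1 : ℝ) ≤ g := by exact_mod_cast (by omega : 1 ≤ g)
    calc (20 * μ * g : ℝ) * (172 * g + 8) ≤ (20 * μ * g : ℝ) * (172 * g + 8 * g) := by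
          refine mul_le_mul_of_nonneg_left ?_ (by positivity)
          linarith
      _ = 20 * μ * 180 * (g : ℝ) ^ 2 := by ring
  · ring

namespace QuasiNorm

variable {X : Type u} [AddCommGroup X] [Module ℂ X] {N : QuasiNorm X} {K : ℝ}

/-- The contribution of one class, estimated by the phases that annihilate all other classes. -/
theorem IsPlurisubharmonic.sum_class_le (hN : N.IsPlurisubharmonic) (hK : N.HasModulus K)
    {Q η w c X' l δ : ℝ} (S : SeparationScales Q η w c X' l) {L M : ℕ} (hL : 0 < L) (hδ : 0 < δ)
    (hδ1 : δ ≤ 1) (hLc : 4 / (L * c) ^ 2 ≤ 1 / 2)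
    (hM : 2 * M * ((36 * (c + w) + 2 * c / (X' * η) + 36 / (η * Q)) * Real.log δ⁻¹
      + 8 / (L * c) ^ 2) ≤ 1)
    {E : Finset ℕ} (hE : ∀ n ∈ E, 0 < n) (cls : ℕ → Fin M)
    (hcls : ∀ d, IsSeparated Q (E.filter fun n => cls n = d)) (d : Fin M)
    (x : ℕ → X) {S₀ A : ℝ} (hS : ∀ T : ℝ, N (∑ n ∈ E, cis (n * T) • x n) ≤ S₀)
    (hA : ∀ z : ℕ → ℂ, (∀ n, ‖z n‖ ≤ 1) → N (∑ n ∈ E, z n • x n) ≤ A)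
    (z : ℕ → ℂ) (hz : ∀ n, ‖z n‖ ≤ 1) :
    N (∑ n ∈ E with cls n = d, z n • x n)
      ≤ 3 * (K ^ 2 * ((K * (1 + K ^ L * K ^ L)) ^ (M * 2) * S₀
        + (4 * Real.pi / Q + 2 * M * δ + 8 * Real.pi * L * η) * A)) := by
  classical
  set D := E.filter fun n => cls n = d with hD
  -- the sets to be annihilated; `D` itself is replaced by `∅`
  set F : Fin M → Finset ℕ := fun j => if j = d then ∅ else E.filter fun n => cls n = j with hF
  have hFE : ∀ j, F j ⊆ E.filter fun n => cls n = j := by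
    intro j
    simp only [hF]
    split_ifs
    · exact Finset.empty_subset _
    · exact subset_rfl
  have hdisj : ∀ j, Disjoint (F j) D := by
    intro j
    rw [Finset.disjoint_left]
    intro n hn hnD
    simp only [hF] at hn
    split_ifs at hn with h
    · simp at hn
    · exact h ((Finset.mem_filter.1 hn).2.symm.trans (Finset.mem_filter.1 hnD).2)
  have hex := fun j => exists_phases_of_isSeparated S
    (fun f hf => hE f (Finset.mem_filter.1 (hFE j hf)).1)
    (fun m hm => hE m (Finset.mem_filter.1 hm).1) ((hcls j).mono (hFE j)) (hcls d) (hdisj j)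
  choose col Ω i1 i2 τ hkill hbad using hex
  have := hN.sum_separated_le hK S.two_le_Q S.η_pos S.c_pos hL hδ hδ1 hLc hE
    (Finset.filter_subset _ _) (hcls d) (I := Fin M × Bool) (Ω := fun i => Ω i.1 i.2)
    (fun i => τ i.1 i.2) (l := l) ?_ (fun i => hbad i.1 i.2) ?_ x hS hA z hz
  · simpa [mul_comm (M : ℝ) 2] using this
  · intro n hn hnD
    have hne : cls n ≠ d := fun h => hnD (Finset.mem_filter.2 ⟨hn, h⟩)
    refine ⟨(cls n, col (cls n) n), fun ω => hkill (cls n) (col (cls n) n) ω n ?_ rfl⟩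
    simp only [hF]
    rw [if_neg hne]
    exact Finset.mem_filter.2 ⟨hn, rfl⟩
  · simpa [mul_comm (M : ℝ) 2] using hM

/-- The Sidon property in a space with a plurisubharmonic quasi-norm, for the uniform supremum over
the circle. The constant depends on `E` through `μ` only. -/
theorem IsPlurisubharmonic.exists_sidon_bound (hN : N.IsPlurisubharmonic) (hK : N.HasModulus K)
    (μ : ℕ) (hμ : 0 < μ) : ∃ C : ℝ, 0 ≤ C ∧ ∀ E : Finset ℕ, (∀ n ∈ E, 0 < n) →
    (∀ h R : ℕ, 0 < h → (E.filter fun n => R ≤ n ∧ n < 2 ^ h * R).card ≤ μ * h) →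
    ∀ (x : ℕ → X) (S₀ : ℝ), (∀ T : ℝ, N (∑ n ∈ E, cis (n * T) • x n) ≤ S₀) →
    ∀ z : ℕ → ℂ, (∀ n, ‖z n‖ ≤ 1) → N (∑ n ∈ E, z n • x n) ≤ C * S₀ := by
  obtain ⟨κ, hκ⟩ := pow_unbounded_of_one_lt K one_lt_two
  obtain ⟨g, hg2, hg1, hg3⟩ := exists_large_scale μ κ hμ
  have hK0 := hK.pos
  have hπ := Real.pi_pos
  have hπ4 := Real.pi_le_four
  set M : ℕ := 10 * μ * g with hM
  have hM0 : 0 < M := by positivity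
  have hMR : (M : ℝ) = 10 * μ * g := by rw [hM]; push_cast; ring
  have hM1 : (1 : ℝ) ≤ M := by exact_mod_cast hM0
  set B : ℝ := 2 ^ g with hB
  have hB4 : 4 ≤ B := by
    calc (4 : ℝ) = 2 ^ 2 := by norm_num
      _ ≤ 2 ^ g := pow_le_pow_right₀ (by norm_num) hg2
  have hB0 : 0 < B := by linarith
  have hB1 : 1 ≤ B := by linarith
  have S := separationScales_of_pow hB4
  set L : ℕ := (2 ^ g) ^ 5 with hL
  have hL0 : 0 < L := by positivity
  have hLR : (L : ℝ) = B ^ 5 := by rw [hL, hB]; push_cast; rfl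
  have hLc : (L : ℝ) * (B ^ 4)⁻¹ = B := by rw [hLR]; field_simp
  -- summing over `M ≤ 2 ^ a` classes costs `K ^ a`, a power of `M` with exponent depending on `K`
  set a : ℕ := Nat.clog 2 M with ha
  have haM : M ≤ 2 ^ a := Nat.le_pow_clog (by norm_num) M
  have haM' : (2 : ℝ) ^ a ≤ 2 * M := by
    have : 2 ^ a ≤ 2 * M := by
      rcases Nat.eq_zero_or_pos a with h0 | h0
      · rw [h0]; omega
      · have h1 : 2 ^ (a - 1) < M := Nat.pow_lt_of_lt_clog (by omega)
        obtain ⟨a', ha'⟩ : ∃ a', a = a' + 1 := ⟨a - 1, by omega⟩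
        rw [ha', Nat.add_sub_cancel] at h1
        rw [ha', pow_succ]
        omega
    exact_mod_cast this
  have hKa : K ^ a ≤ (20 * μ * g : ℝ) ^ κ := by
    calc K ^ a ≤ (2 ^ κ) ^ a := pow_le_pow_left₀ hK0.le hκ.le a
      _ = (2 ^ a) ^ κ := by rw [← pow_mul, ← pow_mul, mul_comm]
      _ ≤ (20 * μ * g : ℝ) ^ κ := by
        refine pow_le_pow_left₀ (by positivity) (haM'.trans_eq ?_) κ
        rw [hMR]; ring
  have hK2 : K ^ 2 ≤ 2 ^ (2 * κ) := by
    calc K ^ 2 ≤ (2 ^ κ) ^ 2 := pow_le_pow_left₀ hK0.le hκ.le 2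
      _ = 2 ^ (2 * κ) := by rw [← pow_mul, mul_comm]
  set Δ : ℝ := 4 * Real.pi / B ^ 10 + 2 * M * B⁻¹ + 8 * Real.pi * L * (B ^ 6)⁻¹ with hΔ
  have hΔ0 : 0 ≤ Δ := by positivity
  have hΔB : Δ ≤ 60 * μ * g / B := by
    have h1 : 4 * Real.pi / B ^ 10 ≤ 16 / B :=
      div_le_div₀ (by norm_num) (by linarith) hB0 (le_self_pow₀ hB1 (by norm_num))
    have h2 : 8 * Real.pi * L * (B ^ 6)⁻¹ ≤ 32 / B := by
      rw [hLR]
      have : 8 * Real.pi * B ^ 5 * (B ^ 6)⁻¹ = 8 * Real.pi / B := by field_simp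
      rw [this]
      exact div_le_div_of_nonneg_right (by linarith) hB0.le
    have h3 : 2 * M * B⁻¹ = 2 * M / B := by rw [div_eq_mul_inv]
    have hmug : (2 : ℝ) ≤ μ * g := by
      have : 2 ≤ μ * g := hg2.trans (Nat.le_mul_of_pos_left g hμ)
      exact_mod_cast this
    calc Δ ≤ 16 / B + 2 * M / B + 32 / B := by rw [hΔ, h3]; linarith
      _ = (2 * M + 48) / B := by ring
      _ ≤ 60 * μ * g / B := by
        refine div_le_div_of_nonneg_right ?_ hB0.le
        rw [hMR]
        nlinarith
  set C₁ : ℝ := (K * (1 + K ^ L * K ^ L)) ^ (M * 2) with hC₁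
  have hC₁0 : 0 ≤ C₁ := by positivity
  have hcoef : K ^ a * M * 3 * K ^ 2 * Δ ≤ 1 / 2 := by
    have h1 : K ^ a * M * 3 * K ^ 2 * Δ
        ≤ (20 * μ * g : ℝ) ^ κ * (10 * μ * g) * 3 * 2 ^ (2 * κ) * (60 * μ * g / B) := by
      rw [hMR]
      gcongr
    refine h1.trans ?_
    rw [← mul_div_assoc, div_le_iff₀ hB0]
    linarith
  refine ⟨2 * (K ^ a * M * 3 * K ^ 2 * C₁), by positivity,
    fun E hE hcount x S₀ hS z hz => ?_⟩
  obtain ⟨cls, hcls⟩ := exists_separated_classes (Q := B ^ 10) hM0 E (by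
    intro r hr
    refine le_trans (Finset.card_le_card ?_) ((hcount (10 * g) r (by omega)).trans_eq ?_)
    · intro n hn
      rw [Finset.mem_filter] at hn ⊢
      refine ⟨hn.1, hn.2.1, ?_⟩
      have h1 := hn.2.2
      rw [hB, ← pow_mul, mul_comm g 10] at h1
      exact_mod_cast h1
    · rw [hM]; ring)
  have hmain : ∀ A, 0 ≤ A → (∀ z : ℕ → ℂ, (∀ n, ‖z n‖ ≤ 1) → N (∑ n ∈ E, z n • x n) ≤ A) →
      ∀ z : ℕ → ℂ, (∀ n, ‖z n‖ ≤ 1) → N (∑ n ∈ E, z n • x n)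
        ≤ K ^ a * M * 3 * K ^ 2 * C₁ * S₀ + K ^ a * M * 3 * K ^ 2 * Δ * A := by
    intro A _ hA z hz
    have hclass : ∀ d ∈ (Finset.univ : Finset (Fin M)), N (∑ n ∈ E with cls n = d, z n • x n)
        ≤ 3 * (K ^ 2 * (C₁ * S₀ + Δ * A)) := fun d _ => by
      refine hN.sum_class_le hK S hL0 (inv_pos.2 hB0) (inv_le_one_of_one_le₀ hB1) ?_ ?_ hE cls hcls d
        x hS hA z hz
      · rw [hLc]
        rw [div_le_iff₀ (by positivity)]
        nlinarith
      · rw [hLc, inv_inv]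
        have hlog : Real.log B ≤ g := by
          rw [hB, Real.log_pow]
          exact mul_le_of_le_one_right (by positivity) (by linarith [Real.log_two_lt_d9])
        have hlog0 : 0 ≤ Real.log B := Real.log_nonneg hB1
        have hβ : 36 * ((B ^ 4)⁻¹ + (B ^ 3)⁻¹) + 2 * (B ^ 4)⁻¹ / (B ^ 3 / 32 * (B ^ 6)⁻¹)
            + 36 / ((B ^ 6)⁻¹ * B ^ 10) ≤ 172 / B := by
          have e1 : 2 * (B ^ 4)⁻¹ / (B ^ 3 / 32 * (B ^ 6)⁻¹) = 64 / B := by field_simp; norm_num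
          have e2 : 36 / ((B ^ 6)⁻¹ * B ^ 10) = 36 * (B ^ 4)⁻¹ := by field_simp
          have h3 : (B ^ 3)⁻¹ ≤ B⁻¹ := inv_anti₀ hB0 (le_self_pow₀ hB1 (by norm_num))
          have h4 : (B ^ 4)⁻¹ ≤ B⁻¹ := inv_anti₀ hB0 (le_self_pow₀ hB1 (by norm_num))
          rw [e1, e2, div_eq_mul_inv, div_eq_mul_inv]
          linarith
        have h8 : 8 / B ^ 2 ≤ 8 / B :=
          div_le_div_of_nonneg_left (by norm_num) hB0 (le_self_pow₀ hB1 (by norm_num))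
        calc _ ≤ 2 * (M : ℝ) * (172 / B * g + 8 / B) := by
              gcongr
          _ = (20 * μ * g : ℝ) * (172 * g + 8) / B := by rw [hMR]; ring
          _ ≤ 1 := (div_le_one hB0).2 hg1
    have e : ∑ n ∈ E, z n • x n = ∑ d : Fin M, ∑ n ∈ E with cls n = d, z n • x n :=
      (Finset.sum_fiberwise E cls _).symm
    rw [e]
    refine (hK.sum_le_pow a _ (by rwa [Finset.card_univ, Fintype.card_fin]) _).trans ?_
    refine (mul_le_mul_of_nonneg_left (Finset.sum_le_card_nsmul _ _ _ hclass)
      (pow_nonneg hK0.le _)).trans_eq ?_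
    rw [Finset.card_univ, Fintype.card_fin, nsmul_eq_mul]
    ring
  have := hK.le_of_self_improving E x (fun z => ∀ n, ‖z n‖ ≤ 1) (fun z hz n _ => hz n) hcoef hmain z hz
  linarith

end QuasiNorm

/-! ### Suprema and essential suprema on the Cantor group and on compact groups -/

instance Int.instMeasurableSingletonClassUnits : MeasurableSingletonClass ℤˣ where
  measurableSet_singleton a := by
    refine ⟨{(a : ℤ)}, measurableSet_singleton _, ?_⟩
    ext b
    simp [Units.ext_iff]

/-- A property that holds almost everywhere on the Cantor group holds somewhere on each cylinder. -/
theorem exists_eq_of_ae_cantorMeasure {p : (ℕ → ℤˣ) → Prop} (h : ∀ᵐ t ∂cantorMeasure, p t) (n : ℕ)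
    (ε : ℕ → ℤˣ) : ∃ t, p t ∧ ∀ k < n, t k = ε k := by
  have hpos : cantorMeasure ((Finset.range n : Set ℕ).pi fun k => {ε k}) ≠ 0 := by
    rw [cantorMeasure, Measure.infinitePi_pi _ fun k _ => measurableSet_singleton _,
      Finset.prod_ne_zero_iff]
    intro k _
    rw [ProbabilityTheory.uniformOn_univ, Measure.count_singleton]
    simp
  obtain ⟨t, ht, hpt⟩ := ((frequently_ae_mem_iff.2 hpos).and_eventually h).exists
  exact ⟨t, hpt, fun k hk => ht k (by simpa using hk)⟩

theorem norm_cantorCoord (k : ℕ) (t : ℕ → ℤˣ) : ‖cantorCoord k t‖ = 1 := by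
  rcases Int.units_eq_one_or (t k) with h | h <;> simp [cantorCoord, h]

namespace QuasiNorm

variable {X : Type u} [AddCommGroup X] [Module ℂ X] {N : QuasiNorm X} {K : ℝ}

theorem eLpNorm_top_le {α : Type*} [MeasurableSpace α] (μ : Measure α) (N : QuasiNorm X)
    (f : α → X) {b : ℝ} (h : ∀ a, N (f a) ≤ b) :
    eLpNorm (fun a => N (f a)) ∞ μ ≤ ENNReal.ofReal b := by
  rw [eLpNorm_exponent_top]
  refine eLpNormEssSup_le_of_ae_bound (Filter.Eventually.of_forall fun a => ?_)
  rw [Real.norm_of_nonneg (N.nonneg _)]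
  exact h a

theorem ae_le_toReal_eLpNorm_top {α : Type*} [MeasurableSpace α] {μ : Measure α}
    (N : QuasiNorm X) (f : α → X) (h : eLpNorm (fun a => N (f a)) ∞ μ ≠ ⊤) :
    ∀ᵐ a ∂μ, N (f a) ≤ (eLpNorm (fun a => N (f a)) ∞ μ).toReal := by
  rw [eLpNorm_exponent_top] at h ⊢
  filter_upwards [enorm_ae_le_eLpNormEssSup (fun a => N (f a)) μ] with a ha
  have h1 := ENNReal.toReal_mono h ha
  rwa [toReal_enorm, Real.norm_of_nonneg (N.nonneg _)] at h1

theorem HasModulus.eLpNorm_top_ne_top (hK : N.HasModulus K) {α : Type*} [MeasurableSpace α]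
    (μ : Measure α) {n : ℕ} (φ : α → Fin n → ℂ) (hφ : ∀ a k, ‖φ a k‖ ≤ 1) (x : Fin n → X) :
    eLpNorm (fun a => N (∑ k, φ a k • x k)) ∞ μ ≠ ⊤ := by
  obtain ⟨b, -, hb⟩ := hK.exists_bound Finset.univ x
  exact ((N.eLpNorm_top_le μ _ fun a => hb (φ a) fun k _ => hφ a k).trans_lt
    ENNReal.ofReal_lt_top).ne

theorem HasModulus.signs_le_toReal_eLpNorm_top (hK : N.HasModulus K) {n : ℕ} (x : Fin n → X)
    (ε : Fin n → ℤˣ) : N (∑ k, ((ε k : ℤ) : ℂ) • x k) ≤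
      (eLpNorm (fun t => N (∑ k : Fin n, cantorCoord (Fin.val k) t • x k)) ∞
        cantorMeasure).toReal := by
  have hfin := hK.eLpNorm_top_ne_top cantorMeasure
    (fun t (k : Fin n) => cantorCoord (Fin.val k) t) (fun t k => (norm_cantorCoord _ t).le) x
  obtain ⟨t, ht, htε⟩ := exists_eq_of_ae_cantorMeasure
    (N.ae_le_toReal_eLpNorm_top _ hfin) n fun k => if h : k < n then ε ⟨k, h⟩ else 1
  convert ht using 4 with k
  rw [cantorCoord, htε _ k.2, dif_pos k.2]

section CompactGroup

variable {G : Type v} [CommGroup G] [TopologicalSpace G] [IsTopologicalGroup G]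
  [CompactSpace G] [MeasurableSpace G] [BorelSpace G]

/-- The quasi-norm need not be continuous, so the supremum of a trigonometric polynomial is only
bounded by a multiple of its essential supremum. -/
theorem HasModulus.le_toReal_eLpNorm_top (hK : N.HasModulus K) {n : ℕ}
    (γ : Fin n → PontryaginDual G) (x : Fin n → X) (g₀ : G) :
    N (∑ k, (γ k g₀ : ℂ) • x k) ≤
      K * (eLpNorm (fun g : G => N (∑ k, (γ k g : ℂ) • x k)) ∞ (normalizedHaar G)).toReal := by
  have hfin := hK.eLpNorm_top_ne_top (normalizedHaar G) (fun g k => (γ k g : ℂ))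
    (fun g k => (Circle.norm_coe _).le) x
  set s := (eLpNorm (fun g : G => N (∑ k, (γ k g : ℂ) • x k)) ∞ (normalizedHaar G)).toReal
  have hcont : ∀ k, Continuous fun g => (γ k g : ℂ) := fun k =>
    continuous_subtype_val.comp (ContinuousMonoidHom.continuous_toFun (γ k))
  have : (normalizedHaar G).IsOpenPosMeasure := by unfold normalizedHaar; infer_instance
  have hdense := Measure.dense_of_ae (N.ae_le_toReal_eLpNorm_top _ hfin)
  set R : G → ℝ := fun g => K * (K ^ (Finset.univ : Finset (Fin n)).card *
    ∑ k, ‖(γ k g₀ : ℂ) - (γ k g : ℂ)‖ * N (x k)) + K * s with hR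
  have hRc : Continuous R := by
    refine ((Continuous.mul continuous_const (Continuous.mul continuous_const
      (continuous_finsetSum _ fun k _ => ?_)))).add continuous_const
    exact ((continuous_const.sub (hcont k)).norm).mul continuous_const
  have hle : ∀ g ∈ {g : G | N (∑ k, (γ k g : ℂ) • x k) ≤ s},
      N (∑ k, (γ k g₀ : ℂ) • x k) ≤ R g := by
    intro g hg
    have e : ∑ k, (γ k g₀ : ℂ) • x k
        = ∑ k, ((γ k g₀ : ℂ) - (γ k g : ℂ)) • x k + ∑ k, (γ k g : ℂ) • x k := by
      rw [← Finset.sum_add_distrib]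
      exact Finset.sum_congr rfl fun k _ => by rw [← add_smul, sub_add_cancel]
    rw [e]
    refine (hK.add_le _ _).trans ?_
    rw [mul_add]
    exact add_le_add (mul_le_mul_of_nonneg_left (hK.sum_smul_le _ x _) hK.pos.le)
      (mul_le_mul_of_nonneg_left hg hK.pos.le)
  have h1 : ∀ g ∈ closure {g : G | N (∑ k, (γ k g : ℂ) • x k) ≤ s},
      N (∑ k, (γ k g₀ : ℂ) • x k) ≤ R g := fun g hg =>
    closure_minimal (s := {g : G | N (∑ k, (γ k g : ℂ) • x k) ≤ s})
      (t := {g | N (∑ k, (γ k g₀ : ℂ) • x k) ≤ R g}) hle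
      (isClosed_le continuous_const hRc) hg
  have h2 := h1 g₀ (hdense g₀)
  simpa [hR] using h2

/-- Property `C_∞` amounts to bounding all choices of signs by the supremum of the trigonometric
polynomial; the other inequality holds for every set of characters. -/
theorem hasPropertyC_top_of_signs_le [T2Space G] (N : QuasiNorm X) (E : Set (PontryaginDual G)) {C : ℝ}
    (H : ∀ (n : ℕ) (γ : Fin n → PontryaginDual G) (x : Fin n → X), Function.Injective γ →
      (∀ k, γ k ∈ E) → ∀ b : ℝ, (∀ g, N (∑ k, (γ k g : ℂ) • x k) ≤ b) →
      ∀ ε : Fin n → ℤˣ, N (∑ k, ((ε k : ℤ) : ℂ) • x k) ≤ C * b) :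
    HasPropertyC ∞ N E := by
  obtain ⟨K, hK⟩ := N.exists_hasModulus
  obtain ⟨C', hC', hcoeff⟩ := hK.exists_coeff_bound
  set M : ℝ := max (max C' (C * K)) 1 with hM
  have hM1 : 1 ≤ M := le_max_right _ _
  have hM0 : 0 < M := by linarith
  refine ⟨M.toNNReal, Real.toNNReal_pos.2 hM0, fun n γ x hγ hE => ⟨?_, ?_⟩⟩
  · have hfin := hK.eLpNorm_top_ne_top (normalizedHaar G) (fun g k => (γ k g : ℂ))
      (fun g k => (Circle.norm_coe _).le) x
    set s := eLpNorm (fun g : G => N (∑ k, (γ k g : ℂ) • x k)) ∞ (normalizedHaar G) with hs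
    have hsign := H n γ x hγ hE (K * s.toReal) (hK.le_toReal_eLpNorm_top γ x)
    have h1 := N.eLpNorm_top_le cantorMeasure
      (fun t => ∑ k : Fin n, cantorCoord (Fin.val k) t • x k) (b := M * s.toReal) fun t => by
        refine (hsign fun k => t k).trans ?_
        rw [← mul_assoc]
        exact mul_le_mul_of_nonneg_right ((le_max_right _ _).trans (le_max_left _ _))
          ENNReal.toReal_nonneg
    rw [ENNReal.ofReal_mul hM0.le, ENNReal.ofReal_toReal hfin] at h1
    rw [ENNReal.inv_mul_le_iff (by simpa using hM0) ENNReal.coe_ne_top]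
    exact h1
  · have hfin := hK.eLpNorm_top_ne_top cantorMeasure
      (fun t (k : Fin n) => cantorCoord (Fin.val k) t) (fun t k => (norm_cantorCoord _ t).le) x
    have hsign := hK.signs_le_toReal_eLpNorm_top x
    set s := eLpNorm (fun t => N (∑ k : Fin n, cantorCoord (Fin.val k) t • x k)) ∞ cantorMeasure
      with hs
    have h1 := N.eLpNorm_top_le (normalizedHaar G) (fun g : G => ∑ k, (γ k g : ℂ) • x k)
      (b := M * s.toReal) fun g => by
        refine (hcoeff Finset.univ x s.toReal hsign (fun k => (γ k g : ℂ))
          fun k => (Circle.norm_coe _).le).trans ?_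
        exact mul_le_mul_of_nonneg_right ((le_max_left _ _).trans (le_max_left _ _))
          ENNReal.toReal_nonneg
    rw [ENNReal.ofReal_mul hM0.le, ENNReal.ofReal_toReal hfin] at h1
    exact h1

end CompactGroup

end QuasiNorm

/-! ### Hadamard gap sequences -/

/-- A set of positive integers has property `C_∞` in every A-convex space, if the number of its
elements in `[R, 2 ^ h R)` is at most proportional to `h`. -/
theorem isAnalyticSidon_of_card_le {E : Set ℕ} (hE : ∀ n ∈ E, 0 < n) {μ : ℕ} (hμ : 0 < μ)
    (hcount : ∀ F : Finset ℕ, (∀ n ∈ F, n ∈ E) → ∀ h R : ℕ, 0 < h →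
      (F.filter fun n => R ≤ n ∧ n < 2 ^ h * R).card ≤ μ * h) :
    IsAnalyticSidon.{u, 0} (natCharacters E) := by
  intro X _ _ N _ ⟨N', ⟨c, c', hc, hc', hNN'⟩, hN'⟩
  obtain ⟨K, hK⟩ := N'.exists_hasModulus
  obtain ⟨C, hC, hmain⟩ := hN'.exists_sidon_bound hK μ hμ
  refine N.hasPropertyC_top_of_signs_le _ (C := c⁻¹ * (C * c')) ?_
  intro n γ x hγ hγE b hb ε
  choose e heE heγ using hγE
  have he : Function.Injective e := fun i j h => hγ (by rw [← heγ i, ← heγ j, h])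
  have hsum : ∀ z : ℕ → ℂ, ∑ m ∈ Finset.univ.image e, z m • Function.extend e x 0 m
      = ∑ k, z (e k) • x k := by
    intro z
    rw [Finset.sum_image fun i _ j _ h => he h]
    exact Finset.sum_congr rfl fun k _ => by rw [he.extend_apply]
  have hFE : ∀ m ∈ Finset.univ.image e, m ∈ E := by
    intro m hm
    obtain ⟨k, -, rfl⟩ := Finset.mem_image.1 hm
    exact heE k
  have h1 := hmain (Finset.univ.image e) (fun m hm => hE m (hFE m hm)) (hcount _ hFE)
    (Function.extend e x 0) (c' * b) (fun T => by
      rw [hsum fun m => cis (m * T)]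
      refine (hNN' _).2.trans (mul_le_mul_of_nonneg_left ?_ hc'.le)
      refine le_trans (le_of_eq ?_) (hb (Circle.exp (2 * Real.pi * T)))
      congr 1
      refine Finset.sum_congr rfl fun k _ => ?_
      congr 1
      rw [← heγ k, cis_nat_mul]
      show _ = (((Circle.exp (2 * Real.pi * T)) ^ ((e k : ℕ) : ℤ) : Circle) : ℂ)
      rw [zpow_natCast, Circle.coe_pow, Circle.coe_exp, cis]
      push_cast
      rfl)
    (Function.extend e (fun k => ((ε k : ℤ) : ℂ)) 0) (fun m => by
      by_cases h : ∃ k, e k = m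
      · obtain ⟨k, rfl⟩ := h
        rw [he.extend_apply]
        rcases Int.units_eq_one_or (ε k) with h | h <;> simp [h]
      · rw [Function.extend_apply' _ _ _ h]
        simp)
  rw [hsum] at h1
  simp only [he.extend_apply] at h1
  rw [mul_assoc, le_inv_mul_iff₀ hc, mul_assoc]
  exact (hNN' _).1.trans h1

/-- A Hadamard gap sequence has at most `s h` terms in `[R, 2 ^ h R)`, if `2 ≤ q ^ s`. -/
theorem IsHadamardGapSequence.exists_card_le {l : ℕ → ℕ} (hl : IsHadamardGapSequence l) :
    ∃ s : ℕ, ∀ h R : ℕ, ∃ T : Finset ℕ, T.card ≤ s * h ∧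
      ∀ k, R ≤ l k → l k < 2 ^ h * R → k ∈ T := by
  obtain ⟨hpos, q, hq, hratio⟩ := hl
  obtain ⟨s, hs⟩ := pow_unbounded_of_one_lt 2 hq
  have hstep : ∀ k, q * l k ≤ l (k + 1) := fun k =>
    (le_div_iff₀ (by exact_mod_cast hpos k)).1 (hratio k)
  have hmono : Monotone l := by
    refine monotone_nat_of_le_succ fun k => ?_
    have h1 : (l k : ℝ) ≤ q * l k := le_mul_of_one_le_left (by positivity) hq.le
    exact_mod_cast h1.trans (hstep k)
  have hpow : ∀ j k, q ^ j * l k ≤ l (k + j) := by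
    intro j k
    induction j with
    | zero => simp
    | succ j ih =>
      calc q ^ (j + 1) * l k = q * (q ^ j * l k) := by ring
        _ ≤ q * l (k + j) := mul_le_mul_of_nonneg_left ih (by linarith)
        _ ≤ l (k + (j + 1)) := hstep _
  have hdouble : ∀ h k, 2 ^ h * l k ≤ l (k + s * h) := by
    intro h k
    have h1 : (2 : ℝ) ^ h * l k ≤ q ^ (s * h) * l k := by
      rw [pow_mul]
      exact mul_le_mul_of_nonneg_right (pow_le_pow_left₀ (by norm_num) hs.le h) (by positivity)
    exact_mod_cast h1.trans (hpow _ _)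
  refine ⟨s, fun h R => ?_⟩
  by_cases hex : ∃ k, R ≤ l k
  · refine ⟨Finset.Ico (Nat.find hex) (Nat.find hex + s * h), by simp, fun k h1 h2 => ?_⟩
    rw [Finset.mem_Ico]
    refine ⟨Nat.find_min' hex h1, ?_⟩
    by_contra! h3
    have h4 := (hdouble h (Nat.find hex)).trans (hmono h3)
    have h5 := Nat.mul_le_mul_left (2 ^ h) (Nat.find_spec hex)
    omega
  · exact ⟨∅, by simp, fun k h1 _ => absurd ⟨k, h1⟩ hex⟩

theorem IsFiniteUnionOfHadamard.isAnalyticSidon {E : Set ℕ} (hE : IsFiniteUnionOfHadamard E) :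
    IsAnalyticSidon.{u, 0} (natCharacters E) := by
  classical
  obtain ⟨m, l, hl, rfl⟩ := hE
  choose s hs using fun i => (hl i).exists_card_le
  refine isAnalyticSidon_of_card_le (μ := ∑ i, s i + 1) ?_ (Nat.succ_pos _) ?_
  · intro n hn
    obtain ⟨i, k, rfl⟩ := Set.mem_iUnion.1 hn
    exact (hl i).1 k
  · intro F hF h R _
    choose T hTc hT using fun i => hs i h R
    have hsub : (F.filter fun n => R ≤ n ∧ n < 2 ^ h * R)
        ⊆ Finset.univ.biUnion fun i => (T i).image (l i) := by
      intro n hn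
      rw [Finset.mem_filter] at hn
      obtain ⟨i, k, rfl⟩ := Set.mem_iUnion.1 (hF n hn.1)
      exact Finset.mem_biUnion.2 ⟨i, Finset.mem_univ i,
        Finset.mem_image_of_mem _ (hT i k hn.2.1 hn.2.2)⟩
    calc _ ≤ ∑ i, ((T i).image (l i)).card :=
          (Finset.card_le_card hsub).trans Finset.card_biUnion_le
      _ ≤ ∑ i, s i * h := Finset.sum_le_sum fun i _ => Finset.card_image_le.trans (hTc i)
      _ ≤ (∑ i, s i + 1) * h := by
        rw [← Finset.sum_mul]
        exact Nat.mul_le_mul_right h (Nat.le_succ _)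

theorem isHadamardGapSequence_of_two_mul_le {l : ℕ → ℕ} (h0 : ∀ k, 0 < l k)
    (h : ∀ k, 2 * l k ≤ l (k + 1)) : IsHadamardGapSequence l := by
  refine ⟨h0, 2, one_lt_two, fun k => ?_⟩
  rw [le_div_iff₀ (by exact_mod_cast h0 k)]
  exact_mod_cast h k

theorem isFiniteUnionOfHadamard_pow_three_union :
    IsFiniteUnionOfHadamard
      ({k | ∃ n : ℕ, 1 ≤ n ∧ k = 3 ^ n} ∪ {k | ∃ n : ℕ, 1 ≤ n ∧ k = 3 ^ n + n}) := by
  refine ⟨2, ![fun k => 3 ^ (k + 1), fun k => 3 ^ (k + 1) + (k + 1)], fun i => ?_, ?_⟩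
  · fin_cases i
    · refine isHadamardGapSequence_of_two_mul_le (l := fun k => 3 ^ (k + 1))
        (fun k => by positivity) fun k => ?_
      simp only [pow_succ]
      omega
    · refine isHadamardGapSequence_of_two_mul_le (l := fun k => 3 ^ (k + 1) + (k + 1))
        (fun k => by positivity) fun k => ?_
      have h : k < 3 ^ k := Nat.lt_pow_self (by norm_num)
      simp only [pow_succ]
      omega
  · ext k
    simp only [Set.mem_union, Set.mem_ofPred_eq, Set.mem_iUnion, Set.mem_range, Fin.exists_fin_two,
      Matrix.cons_val_zero, Matrix.cons_val_one]
    refine or_congr ?_ ?_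
    all_goals
      constructor
      · rintro ⟨n, hn, rfl⟩
        exact ⟨n - 1, by rw [Nat.sub_add_cancel hn]⟩
      · rintro ⟨n, rfl⟩
        exact ⟨n + 1, by omega, rfl⟩

/-! ### A Sidon set which is not a set of interpolation -/

theorem circleCharacter_injective : Function.Injective circleCharacter := by
  intro m n h
  have h1 : ∀ z : Circle, z ^ m = z ^ n := fun z => DFunLike.congr_fun h z
  have h2 := h1 (Circle.exp 1)
  rw [← Circle.exp_zsmul, ← Circle.exp_zsmul, Circle.exp_eq_exp] at h2
  obtain ⟨j, hj⟩ := h2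
  simp only [mul_one, zsmul_eq_mul] at hj
  by_contra hne
  have hj0 : j ≠ 0 := by
    rintro rfl
    apply hne
    simpa using hj
  refine irrational_pi ⟨((m - n : ℤ) : ℚ) / (2 * j), ?_⟩
  push_cast
  have : (j : ℝ) ≠ 0 := by exact_mod_cast hj0
  rw [div_eq_iff (by positivity)]
  linarith

theorem circleCharacter_natCast_apply (n : ℕ) (z : Circle) : circleCharacter n z = z ^ n :=
  zpow_natCast z n

/-- There are filters of positive integers converging to `0` in the Bohr compactification of `ℤ`:
differences of an ultrafilter with itself. -/
theorem exists_filter_tendsto_pow_one : ∃ W : Filter ℕ, W.NeBot ∧ (∀ᶠ k in W, 1 ≤ k) ∧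
    ∀ z : Circle, Filter.Tendsto (fun k : ℕ => z ^ k) W (nhds 1) := by
  set U : Filter ℕ := (Filter.hyperfilter ℕ : Filter ℕ) with hU
  have hlt : ∀ᶠ p in U.curry U, p.1 < p.2 := by
    rw [Filter.eventually_curry_iff]
    refine Filter.Eventually.of_forall fun n => ?_
    exact (Nat.hyperfilter_le_atTop) (Filter.eventually_gt_atTop n)
  have hne : (U.curry U).NeBot := ⟨fun h => by
    have h1 : ∀ᶠ _ in U.curry U, False := by rw [h]; exact Filter.eventually_bot
    rw [Filter.eventually_curry_iff] at h1
    simp [-Filter.eventually_false_iff_eq_bot] at h1⟩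
  refine ⟨(U.curry U).map fun p => p.2 - p.1, hne.map _, ?_, fun z => ?_⟩
  · rw [Filter.eventually_map]
    filter_upwards [hlt] with p hp
    omega
  · obtain ⟨w, -, hw⟩ := isCompact_univ.ultrafilter_le_nhds
      ((Filter.hyperfilter ℕ).map fun k : ℕ => z ^ k) (by simp)
    have hw' : Filter.Tendsto (fun k : ℕ => z ^ k) U (nhds w) := hw
    rw [Filter.tendsto_map'_iff]
    have h1 : Filter.Tendsto (fun p : ℕ × ℕ => z ^ p.2 / z ^ p.1) (U.curry U) (nhds (w / w)) :=
      ((hw'.comp Filter.tendsto_snd).div' (hw'.comp Filter.tendsto_fst)).mono_left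
        Filter.curry_le_prod
    rw [div_self'] at h1
    refine h1.congr' ?_
    filter_upwards [hlt] with p hp
    simp only [Function.comp_apply]
    rw [pow_sub z hp.le, div_eq_mul_inv]

theorem BohrCompactification.tendsto_of_apply {G ι : Type*} [CommGroup G] {f : Filter ι}
    {u : ι → G →* Circle} {χ : G →* Circle}
    (h : ∀ g, Filter.Tendsto (fun i => u i g) f (nhds (χ g))) :
    Filter.Tendsto (β := BohrCompactification G) u f (nhds (χ : BohrCompactification G)) := by
  have h1 : @Topology.IsInducing (BohrCompactification G) (G → Circle) _ _
    (fun (χ : G →* Circle) g => χ g) := ⟨rfl⟩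
  exact h1.tendsto_nhds_iff.2 (tendsto_pi_nhds.2 h)

/-- Along `k → 0` in the Bohr compactification, the points `3 ^ k` and `3 ^ k + k` have a common
limit, so a continuous function cannot separate them. -/
theorem not_isInterpolationSet_pow_three_union : ¬ IsInterpolationSet
    (natCharacters ({k | ∃ n : ℕ, 1 ≤ n ∧ k = 3 ^ n} ∪ {k | ∃ n : ℕ, 1 ≤ n ∧ k = 3 ^ n + n})) := by
  classical
  intro h
  obtain ⟨F, hF, hFf⟩ := h
    (fun γ => if γ.1 ∈ natCharacters {k | ∃ n : ℕ, 1 ≤ n ∧ k = 3 ^ n} then 0 else 1)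
    ⟨1, fun γ => by split_ifs <;> simp⟩
  have hF0 : ∀ k : ℕ, 1 ≤ k → F (toBohr (circleCharacter (3 ^ k : ℕ))) = 0 := by
    intro k hk
    have hmem : circleCharacter (3 ^ k : ℕ) ∈ natCharacters {k | ∃ n : ℕ, 1 ≤ n ∧ k = 3 ^ n} :=
      ⟨3 ^ k, ⟨k, hk, rfl⟩, rfl⟩
    have h1 := hFf ⟨circleCharacter (3 ^ k : ℕ), ⟨3 ^ k, Or.inl ⟨k, hk, rfl⟩, rfl⟩⟩
    rw [h1, if_pos hmem]
  have hF1 : ∀ k : ℕ, 1 ≤ k → F (toBohr (circleCharacter (3 ^ k + k : ℕ))) = 1 := by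
    intro k hk
    have hmem : circleCharacter (3 ^ k + k : ℕ) ∉
        natCharacters {k | ∃ n : ℕ, 1 ≤ n ∧ k = 3 ^ n} := by
      rintro ⟨_, ⟨n, -, rfl⟩, he⟩
      have h1 : 3 ^ n = 3 ^ k + k := by exact_mod_cast circleCharacter_injective he
      -- `3 ^ k + k` lies strictly between two consecutive powers of `3`
      have h2 : k < 3 ^ k := Nat.lt_pow_self (by norm_num)
      have h3 : k < n := (Nat.pow_lt_pow_iff_right (by norm_num : 1 < 3)).1 (by omega)
      have h4 : 3 ^ (k + 1) ≤ 3 ^ n := Nat.pow_le_pow_right (by norm_num) h3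
      rw [pow_succ] at h4
      omega
    have h1 := hFf ⟨circleCharacter (3 ^ k + k : ℕ), ⟨3 ^ k + k, Or.inr ⟨k, hk, rfl⟩, rfl⟩⟩
    rw [h1, if_neg hmem]
  obtain ⟨W, hW, hW1, hWz⟩ := exists_filter_tendsto_pow_one
  set V : Ultrafilter ℕ := Ultrafilter.of W with hV
  have hVW : (V : Filter ℕ) ≤ W := Ultrafilter.of_le W
  have hlim : ∀ z : Circle, ∃ w, Filter.Tendsto (fun k : ℕ => z ^ 3 ^ k) V (nhds w) := fun z => by
    obtain ⟨w, -, hw⟩ := isCompact_univ.ultrafilter_le_nhds (V.map fun k : ℕ => z ^ 3 ^ k) (by simp)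
    exact ⟨w, hw⟩
  choose c hc using hlim
  set χ : Circle →* Circle := MonoidHom.mk' c fun z w => by
    refine tendsto_nhds_unique (hc (z * w)) ?_
    simpa only [mul_pow] using (hc z).mul (hc w) with hχ
  have hχ1 : Filter.Tendsto (fun k : ℕ => toBohr (circleCharacter (3 ^ k : ℕ))) V
      (nhds (χ : BohrCompactification Circle)) := by
    refine BohrCompactification.tendsto_of_apply fun z => ?_
    exact (hc z).congr fun k => (circleCharacter_natCast_apply _ z).symm
  have hχ2 : Filter.Tendsto (fun k : ℕ => toBohr (circleCharacter (3 ^ k + k : ℕ))) V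
      (nhds (χ : BohrCompactification Circle)) := by
    refine BohrCompactification.tendsto_of_apply fun z => ?_
    have h1 := (hc z).mul ((hWz z).mono_left hVW)
    rw [mul_one] at h1
    refine h1.congr fun k => ?_
    rw [← pow_add]
    exact (circleCharacter_natCast_apply _ z).symm
  have hV1 : ∀ᶠ k in (V : Filter ℕ), 1 ≤ k := hVW hW1
  have e0 : F χ = 0 := tendsto_nhds_unique ((hF.tendsto _).comp hχ1)
    (tendsto_const_nhds.congr' (hV1.mono fun k hk => (hF0 k hk).symm))
  have e1 : F χ = 1 := tendsto_nhds_unique ((hF.tendsto _).comp hχ2)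
    (tendsto_const_nhds.congr' (hV1.mono fun k hk => (hF1 k hk).symm))
  exact zero_ne_one (e0.symm.trans e1)

theorem theorem6 :
    (∀ E : Set ℕ, IsFiniteUnionOfHadamard E → IsAnalyticSidon.{u, 0} (natCharacters E)) ∧
    IsAnalyticSidon.{u, 0}
      (natCharacters ({k | ∃ n : ℕ, 1 ≤ n ∧ k = 3 ^ n} ∪ {k | ∃ n : ℕ, 1 ≤ n ∧ k = 3 ^ n + n})) ∧
    ¬ IsInterpolationSet
      (natCharacters ({k | ∃ n : ℕ, 1 ≤ n ∧ k = 3 ^ n} ∪ {k | ∃ n : ℕ, 1 ≤ n ∧ k = 3 ^ n + n})) :=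
  ⟨fun _ hE => hE.isAnalyticSidon, isFiniteUnionOfHadamard_pow_three_union.isAnalyticSidon,
    not_isInterpolationSet_pow_three_union⟩
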